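/- Let $\Omega=(0,2\pi)^2$, $\Upsilon=\Omega\times(0,2\pi)$, $\boldsymbol\xi=(x,\theta)$, and let $\mathrm{Pe}\in\mathbb R$, $D_e>0$, $T>0$. Subscript "per" denotes spaces of functions that are $2\pi$-periodic in each coordinate. For non-negative $f_0\in L^2_{\mathrm{per}}(\Upsilon)$ with $\int_0^{2\pi}f_0(x,\theta)\,d\theta\in[0,1]$ for a.e. $x\in\Omega$, a weak solution of $$\partial_t f+\mathrm{Pe}\,\mathrm{div}_x\big((1-\rho)f\,\mathbf e(\theta)\big)=D_e\Delta_x f+\partial_\theta^2 f,\qquad \rho(t,x)=\int_0^{2\pi}f(t,x,\theta)\,d\theta,\quad \mathbf e(\theta)=(\cos\theta,\sin\theta),$$ on $(0,T)\times\Upsilon$ with initial data $f_0$ is a function $f\in C([0,T];L^2_{\mathrm{per}}(\Upsilon))\cap L^2(0,T;H^1_{\mathrm{per}}(\Upsilon))$ with $\partial_tf\in L^2(0,T;(H^1_{\mathrm{per}}(\Upsilon))')$, with $0\le\rho\le1$ a.e. in $(0,T)\times\Omega$ and $f(t)\to f_0$ in $L^2(\Upsilon)$ as $t\to0^+$, such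 that for all $\varphi\in L^2(0,T;H^1_{\mathrm{per}}(\Upsilon))$ $$\langle\partial_tf,\varphi\rangle=\mathrm{Pe}\int_0^T\!\!\int_\Upsilon(1-\rho)f\,\mathbf e(\theta)\cdot\nabla_x\varphi\,d\boldsymbol\xi\,dt-D_e\int_0^T\!\!\int_\Upsilon\nabla_xf\cdot\nabla_x\varphi\,d\boldsymbol\xi\,dt-\int_0^T\!\!\int_\Upsilon\partial_\theta f\,\partial_\theta\varphi\,d\boldsymbol\xi\,dt .$$ Write $\|f\|_{\mathscr P}^2=\|f\|^2_{L^\infty(0,T;L^2(\Upsilon))}+\|\nabla_{\boldsymbol\xi}f\|^2_{L^2((0,T)\times\Upsilon)}$. **Proposition 3.1.** There is a constant $C>0$, depending only on $\mathrm{Pe}$, $D_e$ and $T$ (thus only on $T$ in the normalised case $\mathrm{Pe}=D_e=1$), such that for every such $f_0$, every weak solution $f$ with initial data $f_0$, and every $t\in(0,T)$, $$\|f\|_{L^\infty((t,T)\times\Upsilon)}\le C\,\big(1+t^{-13/4}\big)\,\|f\|_{\mathscr P}.$$ -/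

import Mathlib

open MeasureTheory Set Filter Topology
open scoped ENNReal ContDiff

noncomputable section

namespace ActiveMatter

/-- The open periodic cell `(0, 2π)^d`: `cell 2` is the spatial cell `Ω`, and `cell 3` is the
space-angle cell `Υ`, with coordinates `ξ = (x, θ)`, `x = (ξ 0, ξ 1)`, `θ = ξ 2`. -/
def cell (d : ℕ) : Set (Fin d → ℝ) := Set.univ.pi fun _ => Ioo 0 (2 * Real.pi)

/-- `2π`-periodicity in each coordinate. -/
def CellPeriodic {d : ℕ} (g : (Fin d → ℝ) → ℝ) : Prop :=
  ∀ (y : Fin d → ℝ) (i : Fin d), g (y + Pi.single i (2 * Real.pi)) = g y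

/-- `L²(Υ)`. -/
abbrev L2Cell : Type := Lp ℝ 2 (volume.restrict (cell 3))

/-- `L²(Υ; ℝ³)`, with the Euclidean norm on `ℝ³`. -/
abbrev L2CellVec : Type := Lp (EuclideanSpace ℝ (Fin 3)) 2 (volume.restrict (cell 3))

lemma volume_cell_ne_top (d : ℕ) : volume (cell d) ≠ ⊤ := by
  have : cell d ⊆ Set.Icc (fun _ => 0) (fun _ => 2 * Real.pi) := by
    intro x hx
    simp only [cell, Set.mem_pi, Set.mem_univ, true_implies, Set.mem_Ioo] at hx
    exact ⟨fun i => (hx i).1.le, fun i => (hx i).2.le⟩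
  exact ne_top_of_le_ne_top isCompact_Icc.measure_lt_top.ne (measure_mono this)

/-- A continuous function is square integrable on the cell. -/
lemma memLp_cell_of_continuous {d : ℕ} {g : (Fin d → ℝ) → ℝ} (hg : Continuous g) :
    MemLp g 2 (volume.restrict (cell d)) := by
  have hsub : cell d ⊆ Set.Icc (fun _ => 0) (fun _ => 2 * Real.pi) := by
    intro x hx
    simp only [cell, Set.mem_pi, Set.mem_univ, true_implies, Set.mem_Ioo] at hx
    exact ⟨fun i => (hx i).1.le, fun i => (hx i).2.le⟩
  have hK : IsCompact (Set.Icc (fun _ : Fin d => (0 : ℝ)) (fun _ => 2 * Real.pi)) := isCompact_Icc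
  obtain ⟨M, hM⟩ := hK.exists_bound_of_continuousOn hg.continuousOn
  have : IsFiniteMeasure (volume.restrict (cell d)) :=
    ⟨by simpa using (volume_cell_ne_top d).lt_top⟩
  have hmeas : MeasurableSet (cell d) := MeasurableSet.univ_pi fun _ => measurableSet_Ioo
  exact MemLp.of_bound hg.aestronglyMeasurable M
    ((ae_restrict_iff' hmeas).2 (Eventually.of_forall fun x hx => hM x (hsub hx)))

lemma continuous_partial {ψ : (Fin 3 → ℝ) → ℝ} (hψ : ContDiff ℝ ∞ ψ) (i : Fin 3) :
    Continuous fun ξ => fderiv ℝ ψ ξ (Pi.single i 1) :=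
  (hψ.continuous_fderiv (by simp)).clm_apply continuous_const

lemma integrable_mul_partial (v : L2Cell) {ψ : (Fin 3 → ℝ) → ℝ} (hψ : ContDiff ℝ ∞ ψ)
    (i : Fin 3) :
    IntegrableOn (fun ξ => v ξ * fderiv ℝ ψ ξ (Pi.single i 1)) (cell 3) :=
  (Lp.memLp v).integrable_mul (memLp_cell_of_continuous (continuous_partial hψ i))

lemma memLp_coord (g : L2CellVec) (i : Fin 3) :
    MemLp (fun ξ => g ξ i) 2 (volume.restrict (cell 3)) :=
  (Lp.memLp g).continuousLinearMap_comp (EuclideanSpace.proj (𝕜 := ℝ) i)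

lemma integrable_coord_mul (g : L2CellVec) {ψ : (Fin 3 → ℝ) → ℝ} (hψ : ContDiff ℝ ∞ ψ)
    (i : Fin 3) : IntegrableOn (fun ξ => g ξ i * ψ ξ) (cell 3) :=
  (memLp_coord g i).integrable_mul (memLp_cell_of_continuous hψ.continuous)

/-- The periodic Sobolev space `H¹_per(Υ)`, with its Hilbert norm
`(‖v‖²_{L²} + ‖∇v‖²_{L²})^{1/2}`: the pairs `(v, ∇v)` in `L²(Υ) × L²(Υ; ℝ³)` such that `∇v` is the
weak gradient of `v` on the torus, that is, tested against all smooth periodic functions (not only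
those compactly supported inside the cell, so that there is no jump across its boundary). -/
def h1Submodule : Submodule ℝ (WithLp 2 (L2Cell × L2CellVec)) where
  carrier := {w | ∀ ψ : (Fin 3 → ℝ) → ℝ, ContDiff ℝ ∞ ψ → CellPeriodic ψ → ∀ i : Fin 3,
    ∫ ξ in cell 3, w.fst ξ * fderiv ℝ ψ ξ (Pi.single i 1) = -∫ ξ in cell 3, w.snd ξ i * ψ ξ}
  zero_mem' := by
    intro ψ hψ _ i
    have h1 : ∀ᵐ ξ ∂(volume.restrict (cell 3)), (0 : L2Cell) ξ = 0 := Lp.coeFn_zero _ _ _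
    have h2 : ∀ᵐ ξ ∂(volume.restrict (cell 3)), (0 : L2CellVec) ξ = 0 := Lp.coeFn_zero _ _ _
    rw [integral_eq_zero_of_ae, integral_eq_zero_of_ae, neg_zero]
    · filter_upwards [h2] with ξ h
      rw [WithLp.zero_snd, h, PiLp.zero_apply, zero_mul, Pi.zero_apply]
    · filter_upwards [h1] with ξ h
      rw [WithLp.zero_fst, h, zero_mul, Pi.zero_apply]
  add_mem' := by
    intro a b ha hb ψ hψ hp i
    have h1 : ∫ ξ in cell 3, (a + b).fst ξ * fderiv ℝ ψ ξ (Pi.single i 1)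
        = ∫ ξ in cell 3, (a.fst ξ * fderiv ℝ ψ ξ (Pi.single i 1)
          + b.fst ξ * fderiv ℝ ψ ξ (Pi.single i 1)) := by
      refine integral_congr_ae ?_
      filter_upwards [Lp.coeFn_add a.fst b.fst] with ξ h
      rw [WithLp.add_fst, h, Pi.add_apply, add_mul]
    have h2 : ∫ ξ in cell 3, (a + b).snd ξ i * ψ ξ
        = ∫ ξ in cell 3, (a.snd ξ i * ψ ξ + b.snd ξ i * ψ ξ) := by
      refine integral_congr_ae ?_
      filter_upwards [Lp.coeFn_add a.snd b.snd] with ξ h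
      rw [WithLp.add_snd, h, Pi.add_apply, PiLp.add_apply, add_mul]
    rw [h1, h2, integral_add (integrable_mul_partial _ hψ i) (integrable_mul_partial _ hψ i),
      integral_add (integrable_coord_mul _ hψ i) (integrable_coord_mul _ hψ i),
      ha ψ hψ hp i, hb ψ hψ hp i, neg_add]
  smul_mem' := by
    intro c a ha ψ hψ hp i
    have h1 : ∫ ξ in cell 3, (c • a).fst ξ * fderiv ℝ ψ ξ (Pi.single i 1)
        = ∫ ξ in cell 3, c * (a.fst ξ * fderiv ℝ ψ ξ (Pi.single i 1)) := by
      refine integral_congr_ae ?_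
      filter_upwards [Lp.coeFn_smul c a.fst] with ξ h
      rw [WithLp.smul_fst, h, Pi.smul_apply, smul_eq_mul, mul_assoc]
    have h2 : ∫ ξ in cell 3, (c • a).snd ξ i * ψ ξ
        = ∫ ξ in cell 3, c * (a.snd ξ i * ψ ξ) := by
      refine integral_congr_ae ?_
      filter_upwards [Lp.coeFn_smul c a.snd] with ξ h
      rw [WithLp.smul_snd, h, Pi.smul_apply, PiLp.smul_apply, smul_eq_mul, mul_assoc]
    rw [h1, h2, integral_const_mul, integral_const_mul, ha ψ hψ hp i, mul_neg]

/-- `H¹_per(Υ)` as a type, with the norm and inner product of `h1Submodule`. -/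
def H1per : Type := h1Submodule

instance : NormedAddCommGroup H1per := inferInstanceAs (NormedAddCommGroup h1Submodule)

instance : InnerProductSpace ℝ H1per := inferInstanceAs (InnerProductSpace ℝ h1Submodule)

/-- The underlying `L²(Υ)` function of an element of `H¹_per(Υ)`. -/
def h1Val (w : H1per) : L2Cell := w.1.fst

/-- The weak gradient `∇_ξ w = (∂_{x₁} w, ∂_{x₂} w, ∂_θ w)` of an element of `H¹_per(Υ)`. -/
def h1Grad (w : H1per) : L2CellVec := w.1.snd

/-- The angle-independent density of a function on space-angle. -/
def density (g : (Fin 3 → ℝ) → ℝ) (x : Fin 2 → ℝ) : ℝ :=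
  ∫ θ in (0 : ℝ)..(2 * Real.pi), g ![x 0, x 1, θ]

/-- `u` is `f` seen as an element of `L²(0,T; H¹_per(Υ))`. By uniqueness of weak gradients, `u` is
determined by `f` up to a null set of times. -/
structure IsL2H1Lift (T : ℝ) (f : ℝ → (Fin 3 → ℝ) → ℝ) (u : ℝ → H1per) : Prop where
  memLp : MemLp u 2 (volume.restrict (Ioo 0 T))
  ae_eq : ∀ᵐ t ∂(volume.restrict (Ioo 0 T)), h1Val (u t) =ᵐ[volume.restrict (cell 3)] f t

/-- `F ∈ L²(0,T; (H¹_per(Υ))')` is the distributional time derivative of `f`, where `L²(Υ)` is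
embedded in `(H¹_per(Υ))'` through the `L²(Υ)` inner product. -/
structure IsTimeDeriv (T : ℝ) (f : ℝ → (Fin 3 → ℝ) → ℝ) (F : ℝ → StrongDual ℝ H1per) :
    Prop where
  measurable : AEStronglyMeasurable F (volume.restrict (Ioo 0 T))
  memLp_norm : MemLp (fun t => ‖F t‖) 2 (volume.restrict (Ioo 0 T))
  integral_eq : ∀ η : ℝ → ℝ, ContDiff ℝ ∞ η → HasCompactSupport η → tsupport η ⊆ Ioo 0 T →
    ∀ v : H1per, ∫ t in Ioo 0 T, deriv η t * ∫ ξ in cell 3, f t ξ * h1Val v ξ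
      = -∫ t in Ioo 0 T, η t * F t v

/-- Admissible initial data: periodic, in `L²(Υ)`, non-negative, with density in `[0,1]`. -/
structure IsAdmissible (f₀ : (Fin 3 → ℝ) → ℝ) : Prop where
  periodic : CellPeriodic f₀
  memLp : MemLp f₀ 2 (volume.restrict (cell 3))
  nonneg : ∀ᵐ ξ ∂(volume.restrict (cell 3)), 0 ≤ f₀ ξ
  density_mem : ∀ᵐ x ∂(volume.restrict (cell 2)), density f₀ x ∈ Icc (0 : ℝ) 1

/-- `f` is a weak solution on `(0,T)` of
`∂_t f + Pe div((1 - ρ) f e(θ)) = De Δ f + ∂_θ² f`, `ρ(t,x) = ∫_0^{2π} f(t,x,θ) dθ`,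
`e(θ) = (cos θ, sin θ)`, with periodic boundary conditions and initial data `f₀`. The function `f`
is a jointly measurable representative. -/
structure IsWeakSolution (Pe De T : ℝ) (f₀ : (Fin 3 → ℝ) → ℝ) (f : ℝ → (Fin 3 → ℝ) → ℝ) :
    Prop where
  measurable : AEStronglyMeasurable (fun p : ℝ × (Fin 3 → ℝ) => f p.1 p.2)
    (volume.restrict (Ioo 0 T ×ˢ cell 3))
  periodic : ∀ t ∈ Icc 0 T, CellPeriodic (f t)
  memLp : ∀ t ∈ Icc 0 T, MemLp (f t) 2 (volume.restrict (cell 3))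
  continuous : ∀ s ∈ Icc 0 T,
    Tendsto (fun t => eLpNorm (f t - f s) 2 (volume.restrict (cell 3))) (𝓝[Icc 0 T] s) (𝓝 0)
  initial : Tendsto (fun t => eLpNorm (f t - f₀) 2 (volume.restrict (cell 3))) (𝓝[>] 0) (𝓝 0)
  density_mem : ∀ᵐ p ∂(volume.restrict (Ioo 0 T ×ˢ cell 2) : Measure (ℝ × (Fin 2 → ℝ))),
    density (f p.1) p.2 ∈ Icc (0 : ℝ) 1
  weak_form : ∃ (u : ℝ → H1per) (F : ℝ → StrongDual ℝ H1per),
    IsL2H1Lift T f u ∧ IsTimeDeriv T f F ∧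
    ∀ φ : ℝ → H1per, MemLp φ 2 (volume.restrict (Ioo 0 T)) →
      ∫ t in Ioo 0 T, F t (φ t)
        = Pe * (∫ t in Ioo 0 T, ∫ ξ in cell 3, (1 - density (f t) ![ξ 0, ξ 1]) * f t ξ *
            (Real.cos (ξ 2) * h1Grad (φ t) ξ 0 + Real.sin (ξ 2) * h1Grad (φ t) ξ 1))
          - De * (∫ t in Ioo 0 T, ∫ ξ in cell 3,
            (h1Grad (u t) ξ 0 * h1Grad (φ t) ξ 0 + h1Grad (u t) ξ 1 * h1Grad (φ t) ξ 1))
          - ∫ t in Ioo 0 T, ∫ ξ in cell 3, h1Grad (u t) ξ 2 * h1Grad (φ t) ξ 2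

/-- The parabolic norm
`(‖f‖²_{L^∞(0,T; L²(Υ))} + ‖∇_ξ f‖²_{L²(Υ_T)})^{1/2}`. The gradient `∇_ξ f` is that of the
(essentially unique) lift of `f` to `L²(0,T; H¹_per(Υ))`, so that the infimum is over one value;
the norm is `∞` when there is no such lift. -/
def parabolicNorm (T : ℝ) (f : ℝ → (Fin 3 → ℝ) → ℝ) : ℝ≥0∞ :=
  ((essSup (fun t => eLpNorm (f t) 2 (volume.restrict (cell 3))) (volume.restrict (Ioo 0 T))) ^ 2
    + ⨅ (u : ℝ → H1per) (_ : IsL2H1Lift T f u),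
        ∫⁻ t in Ioo 0 T, ‖h1Grad (u t)‖ₑ ^ 2) ^ (1 / 2 : ℝ)

end ActiveMatter

end

/-!
The estimate is a consequence of a Duhamel formula and of Young's inequality for kernels; of the
norm `‖f‖_𝒫` only the `L^∞(0, T; L²(Υ))` part is needed. Since `0 ≤ ρ ≤ 1`, the drift
`Pe (1 - ρ) f e(θ)` is bounded by `|Pe| |f|`, so that the equation may be treated as a linear heat
equation with a source in divergence form.

In place of the heat kernel of the torus, the argument uses the explicit periodic parametrix
`K(τ, w) = τ^{-3/2} exp (-∑ᵢ sin²(wᵢ/2) / (dᵢ τ))`, `d = (De, De, 1)`. As for the Gaussian, the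
terms of order `τ⁻¹` in `(∂_τ - ∑ᵢ dᵢ ∂ᵢ²) K` cancel. Both this defect and the gradient of `K` are
therefore bounded by multiples of `majorant d τ w = τ⁻² exp (-∑ᵢ sin²(wᵢ/2) / (2 dᵢ τ))`
(`abs_parametrix_defect_le`, `abs_fderiv_parametrix_le`), a kernel whose space-time `L^{6/5}` norm
is finite (`exists_lintegral_spaceTimeKernel_le`): its `L^{6/5}(Υ)` norm to the power `6/5` is of
order `τ^{-12/5 + 3/2} = τ^{-9/10}`.

Testing the weak formulation against `K(t₀ - τ, · - z)` on `(s, b)` gives a Duhamel inequality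
(`IsWeakSolution.duhamel`). The time-dependent test function is reached from test functions frozen
on short time intervals (`IsWeakSolution.abs_increment_sub_le`, `abs_pairing_sub_le`). With
`t₀ = t` and `b → t`, along which `K`, normalised, is an approximate identity, one gets the pointwise bound
(`exists_ae_enorm_le`)
`|f(t, z)| ≤ c ((t - s)^{-3/2} ‖f(s)‖_{L¹} + ∫_s^t ∫_Υ majorant d (t - τ) (ξ - z) |f(τ, ξ)| dξ dτ)`.

Young's inequality with a kernel in `L^{6/5}` (`lintegral_rpow_lintegral_kernel_le`) lowers the
reciprocal of the integrability exponent by `1/6`, so that three steps lead from `L²` through `L³`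
and `L⁶` to `L^∞`, on the time intervals starting at `t/4`, `t/2`, `3t/4` and `t`
(`ae_le_of_duhamel`). The resulting power `t^{-3/2}` is dominated by `1 + t^{-13/4}`.
-/

namespace ActiveMatter

/-! ### The parametrix -/

/-- The periodic substitute `∑ᵢ sin²(wᵢ/2) / dᵢ` for the quadratic form `∑ᵢ wᵢ² / (4 dᵢ)`. -/
noncomputable def sinQuad (d w : Fin 3 → ℝ) : ℝ := ∑ i, Real.sin (w i / 2) ^ 2 / d i

/-- An explicit smooth periodic parametrix for `∂_τ - ∑ᵢ dᵢ ∂ᵢ²`: the Gaussian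
`τ^{-3/2} exp (-∑ᵢ wᵢ² / (4 dᵢ τ))` with the quadratic form replaced by `sinQuad`. Its total mass
over the cell is bounded above and below as `τ → 0`, but is not normalised to be `1`. -/
noncomputable def parametrix (d : Fin 3 → ℝ) (τ : ℝ) (w : Fin 3 → ℝ) : ℝ :=
  τ ^ (-(3 / 2) : ℝ) * Real.exp (-(sinQuad d w / τ))

/-- A common majorant, up to a constant, of the gradient of `parametrix` and of its defect
in the heat equation. -/
noncomputable def majorant (d : Fin 3 → ℝ) (τ : ℝ) (w : Fin 3 → ℝ) : ℝ :=
  (τ ^ 2)⁻¹ * Real.exp (-(sinQuad d w / (2 * τ)))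

/-- The time derivative of `parametrix`. -/
noncomputable def parametrixDeriv (d : Fin 3 → ℝ) (τ : ℝ) (w : Fin 3 → ℝ) : ℝ :=
  (-(3 / (2 * τ)) + sinQuad d w / τ ^ 2) * parametrix d τ w

lemma sinQuad_nonneg {d : Fin 3 → ℝ} (hd : ∀ i, 0 < d i) (w : Fin 3 → ℝ) : 0 ≤ sinQuad d w :=
  Finset.sum_nonneg fun i _ => div_nonneg (sq_nonneg _) (hd i).le

lemma sinQuad_le {d : Fin 3 → ℝ} (hd : ∀ i, 0 < d i) (w : Fin 3 → ℝ) :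
    sinQuad d w ≤ ∑ i, 1 / d i :=
  Finset.sum_le_sum fun i _ => div_le_div_of_nonneg_right (Real.sin_sq_le_one _) (hd i).le

lemma continuous_sinQuad (d : Fin 3 → ℝ) : Continuous (sinQuad d) := by
  unfold sinQuad; fun_prop

lemma sinQuad_sub_comm (d ξ z : Fin 3 → ℝ) : sinQuad d (ξ - z) = sinQuad d (z - ξ) := by
  unfold sinQuad
  refine Finset.sum_congr rfl fun i _ => ?_
  rw [← neg_sub ξ z, Pi.neg_apply, neg_div, Real.sin_neg, neg_sq]

lemma sin_half_sq_periodic : Function.Periodic (fun x : ℝ => Real.sin (x / 2) ^ 2)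
    (2 * Real.pi) := by
  intro x
  have : (x + 2 * Real.pi) / 2 = x / 2 + Real.pi := by ring
  simp only [this, Real.sin_add_pi, neg_sq]

lemma sinQuad_add_single (d w : Fin 3 → ℝ) (i : Fin 3) :
    sinQuad d (w + Pi.single i (2 * Real.pi)) = sinQuad d w := by
  unfold sinQuad
  refine Finset.sum_congr rfl fun j _ => ?_
  congr 1
  by_cases h : j = i
  · subst h
    simpa using sin_half_sq_periodic (w j)
  · simp [h]

lemma parametrix_pos (d : Fin 3 → ℝ) {τ : ℝ} (hτ : 0 < τ) (w : Fin 3 → ℝ) :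
    0 < parametrix d τ w :=
  mul_pos (Real.rpow_pos_of_pos hτ _) (Real.exp_pos _)

lemma parametrix_le {d : Fin 3 → ℝ} (hd : ∀ i, 0 < d i) {τ : ℝ} (hτ : 0 < τ) (w : Fin 3 → ℝ) :
    parametrix d τ w ≤ τ ^ (-(3 / 2) : ℝ) := by
  refine mul_le_of_le_one_right (Real.rpow_nonneg hτ.le _) (Real.exp_le_one_iff.2 ?_)
  exact neg_nonpos.2 (div_nonneg (sinQuad_nonneg hd w) hτ.le)

lemma majorant_nonneg (d : Fin 3 → ℝ) (τ : ℝ) (w : Fin 3 → ℝ) : 0 ≤ majorant d τ w :=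
  mul_nonneg (inv_nonneg.2 (sq_nonneg _)) (Real.exp_pos _).le

lemma contDiff_parametrix (d : Fin 3 → ℝ) (τ : ℝ) (z : Fin 3 → ℝ) :
    ContDiff ℝ ∞ fun ξ => parametrix d τ (ξ - z) := by
  unfold parametrix sinQuad
  refine contDiff_const.mul (Real.contDiff_exp.comp (ContDiff.neg (ContDiff.div_const
    (ContDiff.sum fun i _ => ContDiff.div_const (ContDiff.pow (Real.contDiff_sin.comp
      (ContDiff.div_const ?_ _)) _) _) _)))
  exact (contDiff_apply ℝ ℝ i).comp (contDiff_id.sub contDiff_const)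

lemma cellPeriodic_parametrix (d : Fin 3 → ℝ) (τ : ℝ) (z : Fin 3 → ℝ) :
    CellPeriodic fun ξ => parametrix d τ (ξ - z) := by
  intro ξ i
  simp only [parametrix]
  rw [add_sub_right_comm, sinQuad_add_single]

lemma hasDerivAt_sin_half_sq (x : ℝ) :
    HasDerivAt (fun x : ℝ => Real.sin (x / 2) ^ 2) (Real.sin x / 2) x := by
  have h := (((hasDerivAt_id x).div_const 2).sin).pow 2
  refine h.congr_deriv ?_
  have : Real.sin x = 2 * Real.sin (x / 2) * Real.cos (x / 2) := by
    rw [← Real.sin_two_mul]; ring_nf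
  rw [this]; simp; ring

lemma hasFDerivAt_coord_sub (z ξ : Fin 3 → ℝ) (i : Fin 3) :
    HasFDerivAt (fun ξ : Fin 3 → ℝ => (ξ - z) i)
      (ContinuousLinearMap.proj (R := ℝ) (φ := fun _ : Fin 3 => ℝ) i) ξ := by
  simpa using ((ContinuousLinearMap.proj (R := ℝ) (φ := fun _ : Fin 3 => ℝ) i).hasFDerivAt
    (x := ξ)).sub_const (z i)

lemma hasFDerivAt_parametrix (d : Fin 3 → ℝ) (τ : ℝ) (z ξ : Fin 3 → ℝ) :
    HasFDerivAt (fun ξ => parametrix d τ (ξ - z))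
      (∑ i, (-(Real.sin ((ξ - z) i) / (2 * d i * τ)) * parametrix d τ (ξ - z)) •
        ContinuousLinearMap.proj (R := ℝ) (φ := fun _ : Fin 3 => ℝ) i) ξ := by
  have h1 : ∀ i : Fin 3, HasFDerivAt (fun ξ : Fin 3 → ℝ => Real.sin ((ξ - z) i / 2) ^ 2 / d i)
      ((Real.sin ((ξ - z) i) / 2 / d i) •
        ContinuousLinearMap.proj (R := ℝ) (φ := fun _ : Fin 3 => ℝ) i) ξ := fun i =>
    ((hasDerivAt_sin_half_sq _).div_const (d i)).comp_hasFDerivAt (f := fun ξ => (ξ - z) i)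
      ξ (hasFDerivAt_coord_sub z ξ i)
  have h2 : HasFDerivAt (fun ξ => sinQuad d (ξ - z)) _ ξ :=
    HasFDerivAt.fun_sum fun i _ => h1 i
  have h3 := (((hasDerivAt_id (sinQuad d (ξ - z))).div_const τ).neg.exp.const_mul
    (τ ^ (-(3 / 2) : ℝ))).comp_hasFDerivAt (f := fun ξ => sinQuad d (ξ - z)) ξ h2
  refine h3.congr_fderiv ?_
  rw [Finset.smul_sum]
  refine Finset.sum_congr rfl fun i _ => ?_
  rw [smul_smul]
  congr 1
  simp only [parametrix, id]
  simp only [Pi.neg_apply, div_eq_mul_inv, mul_inv]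
  ring

lemma sum_smul_proj_single (c : Fin 3 → ℝ) (i : Fin 3) :
    (∑ j, c j • ContinuousLinearMap.proj (R := ℝ) (φ := fun _ : Fin 3 => ℝ) j)
      (Pi.single i 1) = c i := by
  simp [Pi.single_apply]

lemma fderiv_parametrix (d : Fin 3 → ℝ) (τ : ℝ) (z ξ : Fin 3 → ℝ) (i : Fin 3) :
    fderiv ℝ (fun ξ => parametrix d τ (ξ - z)) ξ (Pi.single i 1)
      = -(Real.sin ((ξ - z) i) / (2 * d i * τ)) * parametrix d τ (ξ - z) := by
  rw [(hasFDerivAt_parametrix d τ z ξ).fderiv, sum_smul_proj_single]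

lemma fderiv_fderiv_parametrix (d : Fin 3 → ℝ) (τ : ℝ) (z ξ : Fin 3 → ℝ) (i : Fin 3) :
    fderiv ℝ (fun ξ => fderiv ℝ (fun ξ => parametrix d τ (ξ - z)) ξ (Pi.single i 1)) ξ
        (Pi.single i 1)
      = ((Real.sin ((ξ - z) i) / (2 * d i * τ)) ^ 2 - Real.cos ((ξ - z) i) / (2 * d i * τ)) *
        parametrix d τ (ξ - z) := by
  simp only [fderiv_parametrix]
  have h1 : HasFDerivAt (fun ξ : Fin 3 → ℝ => -(Real.sin ((ξ - z) i) / (2 * d i * τ)))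
      (-(Real.cos ((ξ - z) i) / (2 * d i * τ)) •
        ContinuousLinearMap.proj (R := ℝ) (φ := fun _ : Fin 3 => ℝ) i) ξ :=
    (((Real.hasDerivAt_sin _).div_const _).neg).comp_hasFDerivAt (f := fun ξ => (ξ - z) i)
      ξ (hasFDerivAt_coord_sub z ξ i)
  rw [(h1.fun_mul (hasFDerivAt_parametrix d τ z ξ)).fderiv]
  simp only [add_apply, smul_apply, sum_smul_proj_single,
    ContinuousLinearMap.proj_apply, Pi.single_eq_same, smul_eq_mul]
  ring

lemma hasDerivAt_parametrix (d : Fin 3 → ℝ) {τ : ℝ} (hτ : 0 < τ) (w : Fin 3 → ℝ) :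
    HasDerivAt (fun τ => parametrix d τ w) (parametrixDeriv d τ w) τ := by
  have h1 := Real.hasDerivAt_rpow_const (x := τ) (p := (-(3 / 2) : ℝ)) (Or.inl hτ.ne')
  have h2 := ((hasDerivAt_inv hτ.ne').const_mul (sinQuad d w)).neg.exp
  refine ((h1.mul h2).congr_deriv ?_)
  simp only [parametrixDeriv, parametrix]
  rw [Real.rpow_sub_one hτ.ne']
  simp only [Pi.neg_apply, div_eq_mul_inv, mul_inv]
  ring

lemma mul_exp_neg_le (y : ℝ) : y * Real.exp (-y) ≤ Real.exp (-(y / 2)) := by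
  have h : y ≤ Real.exp (y / 2) := by
    have := Real.add_one_le_exp (y / 4)
    have h2 : Real.exp (y / 2) = Real.exp (y / 4) ^ 2 := by rw [← Real.exp_nat_mul]; ring_nf
    rcases le_or_gt y 0 with hy | hy
    · exact hy.trans (Real.exp_pos _).le
    · rw [h2]; nlinarith [sq_nonneg (y / 4 - 1)]
  calc y * Real.exp (-y) ≤ Real.exp (y / 2) * Real.exp (-y) := by gcongr
    _ = Real.exp (-(y / 2)) := by rw [← Real.exp_add]; ring_nf

lemma sq_mul_exp_neg_le {y : ℝ} (hy : 0 ≤ y) :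
    y ^ 2 * Real.exp (-y) ≤ 8 * Real.exp (-(y / 2)) := by
  have h : y ^ 2 ≤ 8 * Real.exp (y / 2) := by
    nlinarith [Real.quadratic_le_exp_of_nonneg (x := y / 2) (by positivity)]
  calc y ^ 2 * Real.exp (-y) ≤ 8 * Real.exp (y / 2) * Real.exp (-y) := by gcongr
    _ = 8 * Real.exp (-(y / 2)) := by rw [mul_assoc, ← Real.exp_add]; ring_nf

lemma sin_half_sq_div_le {d : Fin 3 → ℝ} (hd : ∀ i, 0 < d i) (w : Fin 3 → ℝ) (i : Fin 3) :
    Real.sin (w i / 2) ^ 2 / d i ≤ sinQuad d w :=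
  Finset.single_le_sum (f := fun i => Real.sin (w i / 2) ^ 2 / d i)
    (fun j _ => div_nonneg (sq_nonneg _) (hd j).le) (Finset.mem_univ i)

lemma sin_div_two_sq (x : ℝ) :
    (Real.sin x / 2) ^ 2 = Real.sin (x / 2) ^ 2 * (1 - Real.sin (x / 2) ^ 2) := by
  have h : Real.sin x = 2 * Real.sin (x / 2) * Real.cos (x / 2) := by
    rw [← Real.sin_two_mul]; ring_nf
  rw [h, ← Real.cos_sq']; ring

lemma cos_eq_one_sub_sin_half_sq (x : ℝ) : Real.cos x = 1 - 2 * Real.sin (x / 2) ^ 2 := by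
  have h : Real.cos x = 2 * Real.cos (x / 2) ^ 2 - 1 := by
    rw [← Real.cos_two_mul]; ring_nf
  rw [h, Real.cos_sq']; ring

/-- The gradient of the parametrix is bounded by the majorant: the factor `|w|/τ` costs only
`τ^{-1/2}` after half of the exponential has been spent. -/
lemma abs_fderiv_parametrix_le {d : Fin 3 → ℝ} (hd : ∀ i, 0 < d i) {τ : ℝ} (hτ : 0 < τ)
    (z ξ : Fin 3 → ℝ) (i : Fin 3) :
    |fderiv ℝ (fun ξ => parametrix d τ (ξ - z)) ξ (Pi.single i 1)|
      ≤ (1 + 1 / d i) * majorant d τ (ξ - z) := by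
  rw [fderiv_parametrix, abs_mul, abs_of_pos (parametrix_pos d hτ _), abs_neg]
  set w := ξ - z
  set y := sinQuad d w / τ with hy
  have hdi := hd i
  have hy0 : 0 ≤ y := div_nonneg (sinQuad_nonneg hd w) hτ.le
  set a := |Real.sin (w i) / (2 * d i * τ)| with ha
  have ha2 : a ^ 2 * τ ≤ y / d i := by
    have h1 : a ^ 2 = (Real.sin (w i) / 2) ^ 2 / (d i ^ 2 * τ ^ 2) := by
      rw [ha, sq_abs]; field_simp
    have h2 : (Real.sin (w i) / 2) ^ 2 ≤ Real.sin (w i / 2) ^ 2 := by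
      rw [sin_div_two_sq]; nlinarith [sq_nonneg (Real.sin (w i / 2) ^ 2)]
    have h3 := sin_half_sq_div_le hd w i
    rw [div_le_iff₀ hdi] at h3
    rw [h1, hy, div_div, div_mul_eq_mul_div, div_le_div_iff₀ (by positivity) (by positivity)]
    have : (Real.sin (w i) / 2) ^ 2 ≤ sinQuad d w * d i := h2.trans h3
    calc (Real.sin (w i) / 2) ^ 2 * τ * (τ * d i)
        ≤ (sinQuad d w * d i) * τ * (τ * d i) := by gcongr
      _ = _ := by ring
  have hs : 0 < τ ^ (1 / 2 : ℝ) := Real.rpow_pos_of_pos hτ _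
  have hss : τ ^ (1 / 2 : ℝ) * τ ^ (1 / 2 : ℝ) = τ := by
    rw [← Real.rpow_add hτ]; norm_num
  have h4 : a * τ ^ (1 / 2 : ℝ) ≤ 1 + y / d i := by
    nlinarith [sq_nonneg (a * τ ^ (1 / 2 : ℝ) - 1)]
  have h5 : τ ^ (-(3 / 2) : ℝ) = τ ^ (1 / 2 : ℝ) * (τ ^ 2)⁻¹ := by
    rw [← Real.rpow_natCast, ← Real.rpow_neg hτ.le, ← Real.rpow_add hτ]; norm_num
  have h6 : Real.exp (-y) ≤ Real.exp (-(y / 2)) := Real.exp_le_exp.2 (by linarith)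
  have h7 : sinQuad d w / (2 * τ) = y / 2 := by rw [hy]; field_simp
  rw [parametrix, majorant, h7, ← hy, h5]
  have hE : (0 : ℝ) < Real.exp (-y) := Real.exp_pos _
  calc a * (τ ^ (1 / 2 : ℝ) * (τ ^ 2)⁻¹ * Real.exp (-y))
      = (τ ^ 2)⁻¹ * ((a * τ ^ (1 / 2 : ℝ)) * Real.exp (-y)) := by ring
    _ ≤ (τ ^ 2)⁻¹ * ((1 + y / d i) * Real.exp (-y)) := by gcongr
    _ = (τ ^ 2)⁻¹ * (Real.exp (-y) + 1 / d i * (y * Real.exp (-y))) := by ring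
    _ ≤ (τ ^ 2)⁻¹ * (Real.exp (-(y / 2)) + 1 / d i * Real.exp (-(y / 2))) := by
        have := mul_exp_neg_le y
        gcongr
    _ = _ := by ring

/-- The defect of the parametrix in the heat equation is of the order of the parametrix itself:
the terms of order `τ⁻¹` cancel, as for the Gaussian. -/
lemma parametrix_defect_eq {d : Fin 3 → ℝ} (hd : ∀ i, 0 < d i) {τ : ℝ} (hτ : 0 < τ)
    (z ξ : Fin 3 → ℝ) :
    parametrixDeriv d τ (ξ - z) - ∑ i, d i *
        fderiv ℝ (fun ξ => fderiv ℝ (fun ξ => parametrix d τ (ξ - z)) ξ (Pi.single i 1)) ξ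
          (Pi.single i 1)
      = (∑ i, (Real.sin ((ξ - z) i / 2) ^ 2) ^ 2 / (d i * τ ^ 2)
          - ∑ i, Real.sin ((ξ - z) i / 2) ^ 2 / τ) * parametrix d τ (ξ - z) := by
  simp only [fderiv_fderiv_parametrix, parametrixDeriv]
  have h1 : ∀ i : Fin 3, d i * (((Real.sin ((ξ - z) i) / (2 * d i * τ)) ^ 2
      - Real.cos ((ξ - z) i) / (2 * d i * τ)) * parametrix d τ (ξ - z))
      = (Real.sin ((ξ - z) i / 2) ^ 2 / d i / τ ^ 2
        - (Real.sin ((ξ - z) i / 2) ^ 2) ^ 2 / (d i * τ ^ 2) - 1 / (2 * τ)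
        + Real.sin ((ξ - z) i / 2) ^ 2 / τ) * parametrix d τ (ξ - z) := by
    intro i
    have hdi := (hd i).ne'
    have h2 : (Real.sin ((ξ - z) i) / (2 * d i * τ)) ^ 2
        = (Real.sin ((ξ - z) i) / 2) ^ 2 / (d i ^ 2 * τ ^ 2) := by field_simp
    rw [h2, sin_div_two_sq, cos_eq_one_sub_sin_half_sq]
    field_simp
    ring
  simp only [h1, ← Finset.sum_mul]
  rw [← sub_mul]
  congr 1
  simp only [Finset.sum_add_distrib, Finset.sum_sub_distrib, ← Finset.sum_div, sinQuad]
  simp only [Finset.sum_const, Finset.card_univ, Fintype.card_fin, nsmul_eq_mul]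
  push_cast
  ring

/-- The numerators `sin⁴` and `sin²` in the defect are of order `(sinQuad)²` and `sinQuad`, so that
a part of the exponential absorbs them. -/
lemma abs_parametrix_defect_le {d : Fin 3 → ℝ} (hd : ∀ i, 0 < d i) {τ T : ℝ} (hτ : 0 < τ)
    (hT : τ ≤ T) (z ξ : Fin 3 → ℝ) :
    |parametrixDeriv d τ (ξ - z) - ∑ i, d i *
        fderiv ℝ (fun ξ => fderiv ℝ (fun ξ => parametrix d τ (ξ - z)) ξ (Pi.single i 1)) ξ
          (Pi.single i 1)|
      ≤ 9 * (∑ i, d i) * T ^ (1 / 2 : ℝ) * majorant d τ (ξ - z) := by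
  rw [parametrix_defect_eq hd hτ, abs_mul, abs_of_pos (parametrix_pos d hτ _)]
  set w := ξ - z
  set y := sinQuad d w / τ with hy
  have hQ := sinQuad_nonneg hd w
  have hy0 : 0 ≤ y := div_nonneg hQ hτ.le
  set D := ∑ i, d i with hD
  have hD0 : 0 ≤ D := Finset.sum_nonneg fun i _ => (hd i).le
  have hdD : ∀ i, d i ≤ D := fun i =>
    Finset.single_le_sum (f := d) (fun j _ => (hd j).le) (Finset.mem_univ i)
  have hS : ∀ i, Real.sin (w i / 2) ^ 2 ≤ D * (Real.sin (w i / 2) ^ 2 / d i) := fun i => by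
    have := hd i
    rw [← mul_div_assoc, le_div_iff₀ this, mul_comm]
    exact mul_le_mul_of_nonneg_right (hdD i) (sq_nonneg _)
  have h2 : ∑ i, Real.sin (w i / 2) ^ 2 / τ ≤ D * y := by
    rw [← Finset.sum_div, hy, ← mul_div_assoc]
    gcongr
    rw [sinQuad, Finset.mul_sum]
    exact Finset.sum_le_sum fun i _ => hS i
  have h1 : ∑ i, (Real.sin (w i / 2) ^ 2) ^ 2 / (d i * τ ^ 2) ≤ D * y ^ 2 := by
    have : ∀ i ∈ Finset.univ, (Real.sin (w i / 2) ^ 2) ^ 2 / (d i * τ ^ 2)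
        ≤ (Real.sin (w i / 2) ^ 2 / d i) * (D * sinQuad d w / τ ^ 2) := by
      intro i _
      have hdi := hd i
      have e : (Real.sin (w i / 2) ^ 2) ^ 2 / (d i * τ ^ 2)
        = (Real.sin (w i / 2) ^ 2 / d i) * (Real.sin (w i / 2) ^ 2 / τ ^ 2) := by field_simp
      rw [e]
      gcongr
      exact (hS i).trans (mul_le_mul_of_nonneg_left (sin_half_sq_div_le hd w i) hD0)
    refine (Finset.sum_le_sum this).trans (le_of_eq ?_)
    rw [← Finset.sum_mul, ← sinQuad, hy]
    field_simp
  have h10 : 0 ≤ ∑ i, (Real.sin (w i / 2) ^ 2) ^ 2 / (d i * τ ^ 2) :=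
    Finset.sum_nonneg fun i _ => by have := hd i; positivity
  have h20 : 0 ≤ ∑ i, Real.sin (w i / 2) ^ 2 / τ :=
    Finset.sum_nonneg fun i _ => by positivity
  have h3 : |∑ i, (Real.sin (w i / 2) ^ 2) ^ 2 / (d i * τ ^ 2)
      - ∑ i, Real.sin (w i / 2) ^ 2 / τ| ≤ D * (y ^ 2 + y) := by
    rw [abs_le]; constructor <;> nlinarith [mul_nonneg hD0 hy0, mul_nonneg hD0 (sq_nonneg y)]
  have h5 : τ ^ (-(3 / 2) : ℝ) = τ ^ (1 / 2 : ℝ) * (τ ^ 2)⁻¹ := by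
    rw [← Real.rpow_natCast, ← Real.rpow_neg hτ.le, ← Real.rpow_add hτ]; norm_num
  have h7 : sinQuad d w / (2 * τ) = y / 2 := by rw [hy]; field_simp
  have h8 : τ ^ (1 / 2 : ℝ) ≤ T ^ (1 / 2 : ℝ) := Real.rpow_le_rpow hτ.le hT (by norm_num)
  have hs : 0 < τ ^ (1 / 2 : ℝ) := Real.rpow_pos_of_pos hτ _
  have hT0 : 0 < T ^ (1 / 2 : ℝ) := hs.trans_le h8
  rw [parametrix, majorant, h7, ← hy, h5]
  calc _ ≤ D * (y ^ 2 + y) * (τ ^ (1 / 2 : ℝ) * (τ ^ 2)⁻¹ * Real.exp (-y)) := by gcongr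
    _ = D * τ ^ (1 / 2 : ℝ) * (τ ^ 2)⁻¹ * (y ^ 2 * Real.exp (-y) + y * Real.exp (-y)) := by ring
    _ ≤ D * T ^ (1 / 2 : ℝ) * (τ ^ 2)⁻¹ * (8 * Real.exp (-(y / 2)) + Real.exp (-(y / 2))) := by
        have e1 := mul_exp_neg_le y
        have e2 := sq_mul_exp_neg_le hy0
        gcongr
    _ = _ := by ring

/-! ### Integrals of the parametrix over the cell -/

lemma sq_le_sin_half_sq {x : ℝ} (hx : x ∈ Icc (-Real.pi) Real.pi) :
    x ^ 2 / Real.pi ^ 2 ≤ Real.sin (x / 2) ^ 2 := by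
  have hpi := Real.pi_pos
  have h : |x| ≤ Real.pi := abs_le.2 hx
  have h1 := Real.mul_le_sin (x := |x| / 2) (by positivity) (by linarith)
  have h2 : Real.sin (|x| / 2) ^ 2 = Real.sin (x / 2) ^ 2 := by
    rcases abs_cases x with ⟨e, _⟩ | ⟨e, _⟩ <;> rw [e]
    rw [neg_div, Real.sin_neg, neg_sq]
  rw [← h2, ← sq_abs x, ← div_pow]
  refine pow_le_pow_left₀ (by positivity) ?_ 2
  calc |x| / Real.pi = 2 / Real.pi * (|x| / 2) := by ring
    _ ≤ _ := h1

lemma sin_half_sq_le_sq (x : ℝ) : Real.sin (x / 2) ^ 2 ≤ x ^ 2 / 4 := by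
  have h := Real.abs_sin_le_abs (x := x / 2)
  have h2 : Real.sin (x / 2) ^ 2 ≤ (x / 2) ^ 2 := sq_le_sq.2 h
  linarith [show (x / 2) ^ 2 = x ^ 2 / 4 by ring]

lemma integral_exp_sin_half_sq_shift (b z : ℝ) :
    ∫ x in Ioo 0 (2 * Real.pi), Real.exp (-(b * Real.sin ((x - z) / 2) ^ 2))
      = ∫ x in (-Real.pi)..Real.pi, Real.exp (-(b * Real.sin (x / 2) ^ 2)) := by
  have hpi := Real.pi_pos
  rw [← integral_Ioc_eq_integral_Ioo, ← intervalIntegral.integral_of_le (by positivity),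
    intervalIntegral.integral_comp_sub_right
      (fun x => Real.exp (-(b * Real.sin (x / 2) ^ 2))) z]
  have hp : Function.Periodic (fun x => Real.exp (-(b * Real.sin (x / 2) ^ 2)))
      (2 * Real.pi) := fun x => by
    have := sin_half_sq_periodic x
    simp only at this
    simp only [this]
  have := hp.intervalIntegral_add_eq (0 - z) (-Real.pi)
  rw [show 0 - z + 2 * Real.pi = 2 * Real.pi - z by ring,
    show -Real.pi + 2 * Real.pi = Real.pi by ring] at this
  exact this

lemma integral_exp_sin_half_sq_le {b : ℝ} (hb : 0 < b) :
    ∫ x in (-Real.pi)..Real.pi, Real.exp (-(b * Real.sin (x / 2) ^ 2))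
      ≤ Real.sqrt (Real.pi ^ 3 / b) := by
  have hpi := Real.pi_pos
  have h1 : Real.sqrt (Real.pi ^ 3 / b) = ∫ x : ℝ, Real.exp (-(b / Real.pi ^ 2) * x ^ 2) := by
    rw [integral_gaussian]; congr 1; field_simp
  have hI := integrable_exp_neg_mul_sq (b := b / Real.pi ^ 2) (by positivity)
  rw [h1, intervalIntegral.integral_of_le (by linarith)]
  refine le_trans ?_ (setIntegral_le_integral (s := Ioc (-Real.pi) Real.pi) hI
    (Eventually.of_forall fun x => (Real.exp_pos _).le))
  refine setIntegral_mono_on ?_ hI.integrableOn measurableSet_Ioc fun x hx => ?_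
  · exact (Continuous.integrableOn_Icc (by fun_prop)).mono_set Ioc_subset_Icc_self
  · refine Real.exp_le_exp.2 ?_
    have := mul_le_mul_of_nonneg_left (sq_le_sin_half_sq (Ioc_subset_Icc_self hx)) hb.le
    rw [← mul_div_assoc] at this
    rw [neg_mul, div_mul_eq_mul_div]
    linarith

lemma le_integral_exp_sin_half_sq {b : ℝ} (hb : 1 ≤ b) :
    2 * Real.exp (-1) / Real.sqrt b
      ≤ ∫ x in (-Real.pi)..Real.pi, Real.exp (-(b * Real.sin (x / 2) ^ 2)) := by
  have hpi := Real.pi_gt_three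
  have hb0 : 0 < b := by linarith
  have hs : 1 ≤ Real.sqrt b := Real.one_le_sqrt.2 hb
  set r := 1 / Real.sqrt b with hr
  have hr0 : 0 < r := by positivity
  have hr1 : r ≤ 1 := by rw [hr, div_le_one (by positivity)]; exact hs
  have hrb : b * r ^ 2 = 1 := by
    rw [hr, div_pow, Real.sq_sqrt hb0.le]; field_simp
  have hint : ∀ u v : ℝ, IntervalIntegrable (fun x => Real.exp (-(b * Real.sin (x / 2) ^ 2)))
      volume u v := fun u v => Continuous.intervalIntegrable (by fun_prop) u v
  calc 2 * Real.exp (-1) / Real.sqrt b = ∫ _ in (-r)..r, Real.exp (-1) := by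
        rw [intervalIntegral.integral_const, smul_eq_mul, hr]; ring
    _ ≤ ∫ x in (-r)..r, Real.exp (-(b * Real.sin (x / 2) ^ 2)) := by
        refine intervalIntegral.integral_mono_on (by linarith) (by simp) (hint _ _) fun x hx => ?_
        refine Real.exp_le_exp.2 ?_
        have h1 := sin_half_sq_le_sq x
        have h2 : x ^ 2 ≤ r ^ 2 := sq_le_sq.2 ((abs_le.2 hx).trans (le_abs_self r))
        nlinarith [sq_nonneg x]
    _ ≤ _ := by
        refine intervalIntegral.integral_mono_interval (by linarith) (by linarith) (by linarith)
          (Eventually.of_forall fun x => (Real.exp_pos _).le) (hint _ _)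

lemma measurableSet_cell (n : ℕ) : MeasurableSet (cell n) :=
  MeasurableSet.univ_pi fun _ => measurableSet_Ioo

instance isFiniteMeasure_restrict_cell (n : ℕ) : IsFiniteMeasure (volume.restrict (cell n)) :=
  ⟨by simpa using (volume_cell_ne_top n).lt_top⟩

/-- The Gaussian-type integral over the cell factorises and, by periodicity, does not depend on
the centre. -/
lemma setIntegral_exp_sinQuad (d z : Fin 3 → ℝ) (a : ℝ) :
    ∫ ξ in cell 3, Real.exp (-(a * sinQuad d (ξ - z)))
      = ∏ i, ∫ x in (-Real.pi)..Real.pi, Real.exp (-(a / d i * Real.sin (x / 2) ^ 2)) := by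
  rw [Finset.prod_congr rfl fun i _ => (integral_exp_sin_half_sq_shift (a / d i) (z i)).symm]
  rw [cell, volume_pi, Measure.restrict_pi_pi,
    ← integral_fintype_prod_eq_prod (μ := fun _ : Fin 3 => volume.restrict (Ioo 0 (2 * Real.pi)))
      (fun i (x : ℝ) => Real.exp (-(a / d i * Real.sin ((x - z i) / 2) ^ 2)))]
  refine integral_congr_ae (Eventually.of_forall fun ξ => ?_)
  simp only
  rw [← Real.exp_sum, sinQuad, Finset.mul_sum, Finset.sum_neg_distrib]
  congr 2
  refine Finset.sum_congr rfl fun i _ => ?_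
  rw [Pi.sub_apply, ← mul_div_assoc, div_mul_eq_mul_div]

lemma exists_setIntegral_exp_sinQuad_le {d : Fin 3 → ℝ} (hd : ∀ i, 0 < d i) :
    ∃ C : ℝ, 0 < C ∧ ∀ (z : Fin 3 → ℝ) (a : ℝ), 0 < a →
      ∫ ξ in cell 3, Real.exp (-(a * sinQuad d (ξ - z))) ≤ C * a ^ (-(3 / 2) : ℝ) := by
  have hpi := Real.pi_pos
  refine ⟨∏ i, Real.sqrt (Real.pi ^ 3 * d i), Finset.prod_pos fun i _ => ?_, fun z a ha => ?_⟩
  · have := hd i; positivity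
  · have h1 : a ^ (-(3 / 2) : ℝ) = ∏ _i : Fin 3, a ^ (-(1 / 2) : ℝ) := by
      rw [Finset.prod_const, Finset.card_univ, Fintype.card_fin, ← Real.rpow_natCast,
        ← Real.rpow_mul ha.le]
      norm_num
    rw [setIntegral_exp_sinQuad, h1, ← Finset.prod_mul_distrib]
    refine Finset.prod_le_prod (fun i _ => ?_) fun i _ => ?_
    · exact intervalIntegral.integral_nonneg (by linarith) fun x _ => (Real.exp_pos _).le
    · have hdi := hd i
      refine (integral_exp_sin_half_sq_le (div_pos ha hdi)).trans (le_of_eq ?_)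
      rw [Real.rpow_neg ha.le, ← Real.sqrt_eq_rpow, ← Real.sqrt_inv,
        ← Real.sqrt_mul (by positivity)]
      congr 1
      field_simp

lemma exists_le_setIntegral_exp_sinQuad {d : Fin 3 → ℝ} (hd : ∀ i, 0 < d i) :
    ∃ c : ℝ, 0 < c ∧ ∀ (z : Fin 3 → ℝ) (a : ℝ), ∑ i, d i ≤ a →
      c * a ^ (-(3 / 2) : ℝ) ≤ ∫ ξ in cell 3, Real.exp (-(a * sinQuad d (ξ - z))) := by
  have hpi := Real.pi_pos
  refine ⟨∏ i, (2 * Real.exp (-1) * Real.sqrt (d i)), Finset.prod_pos fun i _ => ?_,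
    fun z a ha => ?_⟩
  · have := hd i; positivity
  · have hda : ∀ i, d i ≤ a := fun i =>
      (Finset.single_le_sum (f := d) (fun j _ => (hd j).le) (Finset.mem_univ i)).trans ha
    have ha : 0 < a := (hd 0).trans_le (hda 0)
    have h1 : a ^ (-(3 / 2) : ℝ) = ∏ _i : Fin 3, a ^ (-(1 / 2) : ℝ) := by
      rw [Finset.prod_const, Finset.card_univ, Fintype.card_fin, ← Real.rpow_natCast,
        ← Real.rpow_mul ha.le]
      norm_num
    rw [setIntegral_exp_sinQuad, h1, ← Finset.prod_mul_distrib]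
    refine Finset.prod_le_prod (fun i _ => by positivity) fun i _ => ?_
    have hdi := hd i
    refine le_trans (le_of_eq ?_) (le_integral_exp_sin_half_sq ((one_le_div hdi).2 (hda i)))
    rw [Real.rpow_neg ha.le, ← Real.sqrt_eq_rpow, Real.sqrt_div ha.le]
    field_simp

/-! ### Young's inequality and the space-time kernel -/

/-- Young's inequality for an integral operator with a kernel satisfying uniform `L^q` bounds in
either variable. -/
theorem lintegral_rpow_lintegral_kernel_le {X Y : Type*} [MeasurableSpace X] [MeasurableSpace Y]
    {μ : Measure X} {ν : Measure Y} [SFinite μ] [SFinite ν] {k : X → Y → ℝ≥0∞}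
    (hk : Measurable (Function.uncurry k)) {f : Y → ℝ≥0∞} (hf : Measurable f)
    {p q r : ℝ} (hp : 1 ≤ p) (hq : 1 ≤ q) (hr : 0 < r) (hpqr : 1 / r + 1 = 1 / p + 1 / q)
    {A : ℝ≥0∞} (h1 : ∀ x, ∫⁻ y, k x y ^ q ∂ν ≤ A) (h2 : ∀ y, ∫⁻ x, k x y ^ q ∂μ ≤ A) :
    ∫⁻ x, (∫⁻ y, k x y * f y ∂ν) ^ r ∂μ ≤ A ^ (r / q) * (∫⁻ y, f y ^ p ∂ν) ^ (r / p) := by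
  have hp0 : 0 < p := by linarith
  have hq0 : 0 < q := by linarith
  have ep : 0 ≤ 1 - 1 / p := by rw [sub_nonneg, div_le_one hp0]; exact hp
  have eq' : 0 ≤ 1 - 1 / q := by rw [sub_nonneg, div_le_one hq0]; exact hq
  have hkx : ∀ x, Measurable (k x) := fun x => hk.comp measurable_prodMk_left
  have hky : ∀ y, Measurable fun x => k x y := fun y => hk.comp measurable_prodMk_right
  set B := ∫⁻ y, f y ^ p ∂ν with hB
  -- Hölder's inequality with the exponents `1/r`, `1 - 1/p` and `1 - 1/q`, whose sum is `1`
  have key : ∀ x, ∫⁻ y, k x y * f y ∂ν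
      ≤ (∫⁻ y, k x y ^ q * f y ^ p ∂ν) ^ (1 / r) * A ^ (1 - 1 / p) * B ^ (1 - 1 / q) := by
    intro x
    have hol := ENNReal.lintegral_prod_norm_pow_le (μ := ν) (Finset.univ : Finset (Fin 3))
      (f := ![fun y => k x y ^ q * f y ^ p, fun y => k x y ^ q, fun y => f y ^ p])
      (by
        intro i _
        fin_cases i
        · exact (((hkx x).pow_const q).mul (hf.pow_const p)).aemeasurable
        · exact ((hkx x).pow_const q).aemeasurable
        · exact (hf.pow_const p).aemeasurable)
      (p := ![1 / r, 1 - 1 / p, 1 - 1 / q])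
      (by simp only [Fin.sum_univ_three, Matrix.cons_val]; linarith)
      (by
        intro i _
        fin_cases i
        · simpa using hr.le
        · exact ep
        · exact eq')
    simp only [Fin.prod_univ_three, Matrix.cons_val] at hol
    calc ∫⁻ y, k x y * f y ∂ν
        = ∫⁻ y, (k x y ^ q * f y ^ p) ^ (1 / r) * (k x y ^ q) ^ (1 - 1 / p)
            * (f y ^ p) ^ (1 - 1 / q) ∂ν := by
          refine lintegral_congr fun y => ?_
          rw [ENNReal.mul_rpow_of_nonneg _ _ (by positivity), ← ENNReal.rpow_mul,
            ← ENNReal.rpow_mul, ← ENNReal.rpow_mul, ← ENNReal.rpow_mul]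
          have a1 : k x y = k x y ^ (q * (1 / r)) * k x y ^ (q * (1 - 1 / p)) := by
            rw [← ENNReal.rpow_add_of_nonneg _ _ (by positivity) (by positivity), ← mul_add,
              show 1 / r + (1 - 1 / p) = 1 / q by linarith, mul_one_div_cancel hq0.ne',
              ENNReal.rpow_one]
          have a2 : f y = f y ^ (p * (1 / r)) * f y ^ (p * (1 - 1 / q)) := by
            rw [← ENNReal.rpow_add_of_nonneg _ _ (by positivity) (by positivity), ← mul_add,
              show 1 / r + (1 - 1 / q) = 1 / p by linarith, mul_one_div_cancel hp0.ne',
              ENNReal.rpow_one]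
          conv_lhs => rw [a1, a2]
          ring
      _ ≤ _ := hol
      _ ≤ _ := by gcongr; exact h1 x
  calc ∫⁻ x, (∫⁻ y, k x y * f y ∂ν) ^ r ∂μ
      ≤ ∫⁻ x, ((∫⁻ y, k x y ^ q * f y ^ p ∂ν) ^ (1 / r) * A ^ (1 - 1 / p)
          * B ^ (1 - 1 / q)) ^ r ∂μ := by
        refine lintegral_mono fun x => ?_
        gcongr
        exact key x
    _ = ∫⁻ x, (A ^ (1 - 1 / p) * B ^ (1 - 1 / q)) ^ r * (∫⁻ y, k x y ^ q * f y ^ p ∂ν) ∂μ := by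
        refine lintegral_congr fun x => ?_
        rw [mul_assoc, ENNReal.mul_rpow_of_nonneg _ _ hr.le, ← ENNReal.rpow_mul,
          one_div_mul_cancel hr.ne', ENNReal.rpow_one, mul_comm]
    _ = (A ^ (1 - 1 / p) * B ^ (1 - 1 / q)) ^ r * ∫⁻ x, ∫⁻ y, k x y ^ q * f y ^ p ∂ν ∂μ := by
        refine lintegral_const_mul _ ?_
        exact Measurable.lintegral_prod_right'
          (f := fun z : X × Y => k z.1 z.2 ^ q * f z.2 ^ p)
          ((hk.pow_const q).mul ((hf.comp measurable_snd).pow_const p))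
    _ = (A ^ (1 - 1 / p) * B ^ (1 - 1 / q)) ^ r * ∫⁻ y, (∫⁻ x, k x y ^ q ∂μ) * f y ^ p ∂ν := by
        rw [lintegral_lintegral_swap
          ((hk.pow_const q).mul ((hf.comp measurable_snd).pow_const p)).aemeasurable]
        congr 1
        refine lintegral_congr fun y => ?_
        exact lintegral_mul_const _ ((hky y).pow_const q)
    _ ≤ (A ^ (1 - 1 / p) * B ^ (1 - 1 / q)) ^ r * ∫⁻ y, A * f y ^ p ∂ν := by
        gcongr with y
        exact h2 y
    _ = (A ^ (1 - 1 / p) * B ^ (1 - 1 / q)) ^ r * (A * B) := by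
        rw [lintegral_const_mul _ (hf.pow_const p)]
    _ = A ^ (r / q) * B ^ (r / p) := by
        rw [ENNReal.mul_rpow_of_nonneg _ _ hr.le, ← ENNReal.rpow_mul, ← ENNReal.rpow_mul,
          mul_mul_mul_comm]
        have b1 : (1 - 1 / p) * r + 1 = r / q := by
          have := congrArg (· * r) hpqr
          simp only [add_mul, one_div_mul_cancel hr.ne'] at this
          linarith [show r / q = 1 / q * r by ring]
        have b2 : (1 - 1 / q) * r + 1 = r / p := by
          have := congrArg (· * r) hpqr
          simp only [add_mul, one_div_mul_cancel hr.ne'] at this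
          linarith [show r / p = 1 / p * r by ring]
        rw [← b1, ← b2, ENNReal.rpow_add_of_nonneg _ _ (by positivity) zero_le_one,
          ENNReal.rpow_add_of_nonneg _ _ (by positivity) zero_le_one, ENNReal.rpow_one,
          ENNReal.rpow_one]

/-- The space-time kernel `(t, z), (τ, ξ) ↦ majorant (t - τ) (ξ - z)`, cut off to
`0 < t - τ < T`. -/
noncomputable def spaceTimeKernel (d : Fin 3 → ℝ) (T : ℝ) (p p' : ℝ × (Fin 3 → ℝ)) : ℝ≥0∞ :=
  (Ioo 0 T).indicator (fun σ => ENNReal.ofReal (majorant d σ (p'.2 - p.2))) (p.1 - p'.1)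

lemma measurable_majorant (d : Fin 3 → ℝ) : Measurable (Function.uncurry (majorant d)) := by
  unfold majorant Function.uncurry
  have := (continuous_sinQuad d).measurable
  fun_prop

lemma measurable_spaceTimeKernel (d : Fin 3 → ℝ) (T : ℝ) :
    Measurable (Function.uncurry (spaceTimeKernel d T)) := by
  have h1 : Measurable fun z : (ℝ × (Fin 3 → ℝ)) × (ℝ × (Fin 3 → ℝ)) =>
      ENNReal.ofReal (majorant d (z.1.1 - z.2.1) (z.2.2 - z.1.2)) := by
    refine ENNReal.measurable_ofReal.comp ((measurable_majorant d).comp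
      (f := fun z : (ℝ × (Fin 3 → ℝ)) × (ℝ × (Fin 3 → ℝ)) => (z.1.1 - z.2.1, z.2.2 - z.1.2)) ?_)
    fun_prop
  exact h1.indicator (s := {z | z.1.1 - z.2.1 ∈ Ioo 0 T})
    (measurableSet_Ioo.preimage (by fun_prop))

lemma setLIntegral_majorant_rpow_le {d : Fin 3 → ℝ} (hd : ∀ i, 0 < d i) :
    ∃ C : ℝ, 0 < C ∧ ∀ (z : Fin 3 → ℝ) (σ : ℝ), 0 < σ →
      ∫⁻ ξ in cell 3, ENNReal.ofReal (majorant d σ (ξ - z)) ^ (6 / 5 : ℝ)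
        ≤ ENNReal.ofReal (C * σ ^ (-(9 / 10) : ℝ)) := by
  obtain ⟨C, hC, h⟩ := exists_setIntegral_exp_sinQuad_le hd
  refine ⟨C * (3 / 5 : ℝ) ^ (-(3 / 2) : ℝ), by positivity, fun z σ hσ => ?_⟩
  have e1 : ∀ ξ, ENNReal.ofReal (majorant d σ (ξ - z)) ^ (6 / 5 : ℝ)
      = ENNReal.ofReal (σ ^ (-(12 / 5) : ℝ)) *
        ENNReal.ofReal (Real.exp (-(3 / 5 / σ * sinQuad d (ξ - z)))) := by
    intro ξ
    rw [ENNReal.ofReal_rpow_of_nonneg (majorant_nonneg _ _ _) (by norm_num),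
      ← ENNReal.ofReal_mul (by positivity)]
    congr 1
    rw [majorant, Real.mul_rpow (by positivity) (by positivity), ← Real.exp_mul,
      ← Real.rpow_natCast, ← Real.rpow_neg hσ.le, ← Real.rpow_mul hσ.le]
    congr 2
    · norm_num
    · field_simp
      ring
  simp only [e1]
  rw [lintegral_const_mul _ (by
    have := (continuous_sinQuad d).measurable
    fun_prop)]
  rw [← ofReal_integral_eq_lintegral_ofReal _ (Eventually.of_forall fun _ => (Real.exp_pos _).le),
    ← ENNReal.ofReal_mul (by positivity)]
  · refine ENNReal.ofReal_le_ofReal ?_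
    refine (mul_le_mul_of_nonneg_left (h z (3 / 5 / σ) (by positivity))
      (by positivity)).trans (le_of_eq ?_)
    rw [Real.div_rpow (by norm_num) hσ.le]
    -- the exponential integrates to a multiple of `σ ^ (3 / 2)`
    have : σ ^ (-(12 / 5) : ℝ) = σ ^ (-(9 / 10) : ℝ) * σ ^ (-(3 / 2) : ℝ) := by
      rw [← Real.rpow_add hσ]; norm_num
    rw [this]
    have := (Real.rpow_pos_of_pos hσ (-(3 / 2))).ne'
    field_simp
  · have hc : Continuous fun ξ => Real.exp (-(3 / 5 / σ * sinQuad d (ξ - z))) := by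
      have := continuous_sinQuad d
      fun_prop
    exact (memLp_cell_of_continuous hc).integrable (by norm_num)

lemma spaceTimeKernel_comm (d : Fin 3 → ℝ) (T t τ : ℝ) (z ξ : Fin 3 → ℝ) :
    spaceTimeKernel d T (t, z) (τ, ξ) = spaceTimeKernel d T (t, ξ) (τ, z) := by
  simp only [spaceTimeKernel, majorant, sinQuad_sub_comm d ξ z]

/-- The space-time kernel is in `L^{6/5}` uniformly in either variable. -/
theorem exists_lintegral_spaceTimeKernel_le {d : Fin 3 → ℝ} (hd : ∀ i, 0 < d i) {T : ℝ}
    (hT : 0 < T) :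
    ∃ A : ℝ≥0∞, A ≠ ⊤ ∧ ∀ s : ℝ,
      (∀ p, ∫⁻ p', spaceTimeKernel d T p p' ^ (6 / 5 : ℝ)
        ∂((volume.restrict (Ioo s T)).prod (volume.restrict (cell 3))) ≤ A) ∧
      (∀ p', ∫⁻ p, spaceTimeKernel d T p p' ^ (6 / 5 : ℝ)
        ∂((volume.restrict (Ioo s T)).prod (volume.restrict (cell 3))) ≤ A) := by
  obtain ⟨C, hC, h⟩ := setLIntegral_majorant_rpow_le hd
  have hk := measurable_spaceTimeKernel d T
  have hin : ∀ (t τ : ℝ) (z : Fin 3 → ℝ),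
      ∫⁻ ξ in cell 3, spaceTimeKernel d T (t, z) (τ, ξ) ^ (6 / 5 : ℝ)
        ≤ (Ioo (0 : ℝ) T).indicator (fun σ => ENNReal.ofReal (C * σ ^ (-(9 / 10) : ℝ)))
          (t - τ) := by
    intro t τ z
    by_cases ht : t - τ ∈ Ioo 0 T
    · simp only [spaceTimeKernel, indicator_of_mem ht]
      exact h z _ ht.1
    · simp only [spaceTimeKernel, indicator_of_notMem ht]
      simp
  refine ⟨∫⁻ σ in Ioo 0 T, ENNReal.ofReal (C * σ ^ (-(9 / 10) : ℝ)), ?_, fun s => ⟨?_, ?_⟩⟩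
  · have hI : IntegrableOn (fun σ : ℝ => C * σ ^ (-(9 / 10) : ℝ)) (Ioo 0 T) := by
      refine Integrable.const_mul ?_ C
      exact (intervalIntegral.integrableOn_Ioo_rpow_iff hT).2 (by norm_num)
    exact hI.lintegral_lt_top.ne
  · rintro ⟨t, z⟩
    have hm : Measurable fun p' => spaceTimeKernel d T (t, z) p' ^ (6 / 5 : ℝ) :=
      (hk.comp measurable_prodMk_left).pow_const _
    rw [lintegral_prod _ hm.aemeasurable]
    calc _ ≤ ∫⁻ τ in Ioo s T, (Ioo (0 : ℝ) T).indicator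
            (fun σ => ENNReal.ofReal (C * σ ^ (-(9 / 10) : ℝ))) (t - τ) :=
          lintegral_mono fun τ => hin t τ z
      _ ≤ ∫⁻ τ, (Ioo (0 : ℝ) T).indicator
            (fun σ => ENNReal.ofReal (C * σ ^ (-(9 / 10) : ℝ))) (t - τ) :=
          setLIntegral_le_lintegral _ _
      _ = _ := by rw [lintegral_sub_left_eq_self (μ := volume) _ t,
                    lintegral_indicator measurableSet_Ioo]
  · rintro ⟨τ, ξ⟩
    have hm : Measurable fun p => spaceTimeKernel d T p (τ, ξ) ^ (6 / 5 : ℝ) :=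
      (hk.comp measurable_prodMk_right).pow_const _
    rw [lintegral_prod _ hm.aemeasurable]
    calc _ ≤ ∫⁻ t in Ioo s T, (Ioo (0 : ℝ) T).indicator
            (fun σ => ENNReal.ofReal (C * σ ^ (-(9 / 10) : ℝ))) (t - τ) := by
          refine lintegral_mono fun t => ?_
          simp only [spaceTimeKernel_comm d T t τ _ ξ]
          exact hin t τ ξ
      _ ≤ ∫⁻ t, (Ioo (0 : ℝ) T).indicator
            (fun σ => ENNReal.ofReal (C * σ ^ (-(9 / 10) : ℝ))) (t - τ) :=
          setLIntegral_le_lintegral _ _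
      _ = _ := by rw [lintegral_sub_right_eq_self (μ := volume) _ τ,
                    lintegral_indicator measurableSet_Ioo]

/-! ### The integrability bootstrap -/

/-- Lebesgue measure on the space-time cylinder `(s, T) × Υ`. -/
noncomputable def cylinderMeasure (T s : ℝ) : Measure (ℝ × (Fin 3 → ℝ)) :=
  (volume.restrict (Ioo s T)).prod (volume.restrict (cell 3))

instance isFiniteMeasure_cylinderMeasure (T s : ℝ) : IsFiniteMeasure (cylinderMeasure T s) := by
  unfold cylinderMeasure; infer_instance

lemma cylinderMeasure_eq (T s : ℝ) : cylinderMeasure T s = volume.restrict (Ioo s T ×ˢ cell 3) := by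
  rw [cylinderMeasure, Measure.prod_restrict, ← Measure.volume_eq_prod]

lemma cylinderMeasure_mono {T s s' : ℝ} (h : s ≤ s') :
    cylinderMeasure T s' ≤ cylinderMeasure T s := by
  rw [cylinderMeasure_eq, cylinderMeasure_eq]
  exact Measure.restrict_mono (prod_mono (Ioo_subset_Ioo_left h) subset_rfl) le_rfl

/-- A function dominated by a constant plus a kernel operator applied to itself gains
integrability from `L^p` to `L^r`, `1/r = 1/p - 1/6`. -/
lemma lintegral_rpow_le_of_le_kernel {T s s' : ℝ} {A α b : ℝ≥0∞} {F : ℝ × (Fin 3 → ℝ) → ℝ≥0∞}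
    {k : ℝ × (Fin 3 → ℝ) → ℝ × (Fin 3 → ℝ) → ℝ≥0∞} (hk : Measurable (Function.uncurry k))
    (hF : Measurable F) (hs : 0 ≤ s')
    (h1 : ∀ p, ∫⁻ p', k p p' ^ (6 / 5 : ℝ) ∂cylinderMeasure T s ≤ A)
    (h2 : ∀ p', ∫⁻ p, k p p' ^ (6 / 5 : ℝ) ∂cylinderMeasure T s' ≤ A)
    (h : ∀ᵐ p ∂cylinderMeasure T s', F p ≤ α + b * ∫⁻ p', k p p' * F p' ∂cylinderMeasure T s)
    {p r : ℝ} (hp : 1 ≤ p) (hr : 1 ≤ r) (hpr : 1 / r + 1 / 6 = 1 / p) :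
    (∫⁻ x, F x ^ r ∂cylinderMeasure T s') ^ (1 / r)
      ≤ α * cylinderMeasure T 0 univ ^ (1 / r)
        + b * A ^ (5 / 6 : ℝ) * (∫⁻ x, F x ^ p ∂cylinderMeasure T s) ^ (1 / p) := by
  have hr0 : 0 < r := by linarith
  have hy := lintegral_rpow_lintegral_kernel_le (μ := cylinderMeasure T s')
    (ν := cylinderMeasure T s) hk hF hp (q := 6 / 5) (by norm_num) hr0 (by rw [← hpr]; ring) h1 h2
  have hmK : Measurable fun x => ∫⁻ p', k x p' * F p' ∂cylinderMeasure T s :=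
    Measurable.lintegral_prod_right' (f := fun z : (ℝ × (Fin 3 → ℝ)) × (ℝ × (Fin 3 → ℝ)) =>
      k z.1 z.2 * F z.2) (hk.mul (hF.comp measurable_snd))
  calc (∫⁻ x, F x ^ r ∂cylinderMeasure T s') ^ (1 / r)
      ≤ (∫⁻ x, ((fun _ => α : ℝ × (Fin 3 → ℝ) → ℝ≥0∞) + fun x =>
          b * ∫⁻ p', k x p' * F p' ∂cylinderMeasure T s) x ^ r
          ∂cylinderMeasure T s') ^ (1 / r) := by
        gcongr ?_ ^ _
        refine lintegral_mono_ae ?_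
        filter_upwards [h] with x hx
        gcongr
        exact hx
    _ ≤ (∫⁻ _, α ^ r ∂cylinderMeasure T s') ^ (1 / r)
        + (∫⁻ x, (b * ∫⁻ p', k x p' * F p' ∂cylinderMeasure T s) ^ r
          ∂cylinderMeasure T s') ^ (1 / r) :=
        ENNReal.lintegral_Lp_add_le aemeasurable_const (hmK.const_mul b).aemeasurable hr
    _ ≤ _ := by
        gcongr ?_ + ?_
        · rw [lintegral_const, ENNReal.mul_rpow_of_nonneg _ _ (by positivity), ← ENNReal.rpow_mul,
            mul_one_div_cancel hr0.ne', ENNReal.rpow_one]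
          gcongr
          exact cylinderMeasure_mono hs
        · simp_rw [ENNReal.mul_rpow_of_nonneg _ _ hr0.le]
          rw [lintegral_const_mul _ (hmK.pow_const r),
            ENNReal.mul_rpow_of_nonneg _ _ (by positivity), ← ENNReal.rpow_mul,
            mul_one_div_cancel hr0.ne', ENNReal.rpow_one, mul_assoc]
          gcongr
          calc _ ≤ (A ^ (r / (6 / 5)) *
                  (∫⁻ x, F x ^ p ∂cylinderMeasure T s) ^ (r / p)) ^ (1 / r) := by
                gcongr
            _ = _ := by
                rw [ENNReal.mul_rpow_of_nonneg _ _ (by positivity), ← ENNReal.rpow_mul,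
                  ← ENNReal.rpow_mul]
                congr 2 <;> field_simp

/-- The bootstrap `L² → L³ → L⁶ → L^∞` along the cylinders starting at `t/4`, `t/2`, `3t/4`, `t`,
for functions satisfying a Duhamel inequality from every initial time. -/
theorem ae_le_of_duhamel {d : Fin 3 → ℝ} (hd : ∀ i, 0 < d i) {T : ℝ} (hT : 0 < T)
    {a b : ℝ≥0∞} (ha : a ≠ ⊤) (hb : b ≠ ⊤) :
    ∃ C : ℝ, 0 < C ∧ ∀ (F : ℝ × (Fin 3 → ℝ) → ℝ≥0∞) (M : ℝ≥0∞), Measurable F →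
      (∫⁻ x, F x ^ (2 : ℝ) ∂cylinderMeasure T 0) ^ (1 / 2 : ℝ)
        ≤ ENNReal.ofReal T ^ (1 / 2 : ℝ) * M →
      (∀ s ∈ Ioo 0 T, ∀ᵐ p ∂cylinderMeasure T s,
        F p ≤ a * ENNReal.ofReal ((p.1 - s) ^ (-(3 / 2) : ℝ)) * M
          + b * ∫⁻ p', spaceTimeKernel d T p p' * F p' ∂cylinderMeasure T s) →
      ∀ t ∈ Ioo 0 T, ∀ᵐ p ∂cylinderMeasure T t,
        F p ≤ ENNReal.ofReal (C * (1 + t ^ (-(13 / 4) : ℝ))) * M := by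
  obtain ⟨A, hA, hAk⟩ := exists_lintegral_spaceTimeKernel_le hd hT
  have hk := measurable_spaceTimeKernel d T
  set B := b * A ^ (5 / 6 : ℝ) with hB
  set V := cylinderMeasure T 0 univ with hV
  have hBt : B ≠ ⊤ := ENNReal.mul_ne_top hb (ENNReal.rpow_ne_top_of_nonneg (by norm_num) hA)
  have hVt : V ≠ ⊤ := measure_ne_top _ _
  set c := 1 + B * V ^ (1 / 6 : ℝ) + B * B * V ^ (1 / 3 : ℝ) with hc
  set e := B * B * B * ENNReal.ofReal T ^ (1 / 2 : ℝ) with he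
  have hct : c ≠ ⊤ := by
    have h1 : V ^ (1 / 6 : ℝ) ≠ ⊤ := ENNReal.rpow_ne_top_of_nonneg (by norm_num) hVt
    have h2 : V ^ (1 / 3 : ℝ) ≠ ⊤ := ENNReal.rpow_ne_top_of_nonneg (by norm_num) hVt
    finiteness
  have het : e ≠ ⊤ := by
    have h1 : ENNReal.ofReal T ^ (1 / 2 : ℝ) ≠ ⊤ :=
      ENNReal.rpow_ne_top_of_nonneg (by norm_num) ENNReal.ofReal_ne_top
    finiteness
  have hte : a * 8 * c + e ≠ ⊤ := by finiteness
  -- the factor `8 = 4 ^ (3 / 2)` comes from the waiting time `t / 4` of each step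
  refine ⟨(a * 8 * c + e).toReal + 1, by positivity, fun F M hF hM hD t ht => ?_⟩
  have ht0 : 0 < t := ht.1
  set α := a * ENNReal.ofReal ((t / 4) ^ (-(3 / 2) : ℝ)) * M with hα
  have hstep : ∀ s s', 0 < s → s' ≤ T → s + t / 4 = s' → ∀ᵐ p ∂cylinderMeasure T s',
      F p ≤ α + b * ∫⁻ p', spaceTimeKernel d T p p' * F p' ∂cylinderMeasure T s := by
    intro s s' hs hs' hss
    have h1 := ae_mono (cylinderMeasure_mono (T := T) (show s ≤ s' by linarith))
      (hD s ⟨hs, by linarith⟩)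
    have h2 : ∀ᵐ p ∂cylinderMeasure T s', p ∈ Ioo s' T ×ˢ cell 3 := by
      rw [cylinderMeasure_eq]
      exact ae_restrict_mem (measurableSet_Ioo.prod (measurableSet_cell 3))
    filter_upwards [h1, h2] with p hp hp'
    refine hp.trans ?_
    rw [hα]
    gcongr ?_ + _
    gcongr a * ENNReal.ofReal ?_ * M
    refine Real.rpow_le_rpow_of_nonpos (by positivity) ?_ (by norm_num)
    linarith [hp'.1.1]
  have e0 : (∫⁻ x, F x ^ (2 : ℝ) ∂cylinderMeasure T (t / 4)) ^ (1 / 2 : ℝ)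
      ≤ ENNReal.ofReal T ^ (1 / 2 : ℝ) * M := by
    refine le_trans ?_ hM
    gcongr ?_ ^ _
    exact lintegral_mono' (cylinderMeasure_mono (by positivity)) le_rfl
  have e1 := lintegral_rpow_le_of_le_kernel hk hF (by positivity) (hAk (t / 4)).1 (hAk (t / 2)).2
    (hstep (t / 4) (t / 2) (by positivity) (by linarith [ht.2]) (by ring))
    (p := 2) (r := 3) (by norm_num) (by norm_num) (by norm_num)
  have e2 := lintegral_rpow_le_of_le_kernel hk hF (by positivity) (hAk (t / 2)).1
    (hAk (3 * t / 4)).2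
    (hstep (t / 2) (3 * t / 4) (by positivity) (by linarith [ht.2]) (by ring))
    (p := 3) (r := 6) (by norm_num) (by norm_num) (by norm_num)
  have e3 := hstep (3 * t / 4) t (by positivity) ht.2.le (by ring)
  filter_upwards [e3] with p hp
  have hkp : Measurable (spaceTimeKernel d T p) := hk.comp measurable_prodMk_left
  have hol : ∫⁻ p', spaceTimeKernel d T p p' * F p' ∂cylinderMeasure T (3 * t / 4)
      ≤ A ^ (5 / 6 : ℝ) * (∫⁻ x, F x ^ (6 : ℝ) ∂cylinderMeasure T (3 * t / 4)) ^ (1 / 6 : ℝ) := by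
    refine (ENNReal.lintegral_mul_le_Lp_mul_Lq _
      (Real.holderConjugate_iff.2 ⟨by norm_num, by norm_num⟩ : (6 / 5 : ℝ).HolderConjugate 6)
      hkp.aemeasurable hF.aemeasurable).trans ?_
    gcongr ?_ * _
    rw [show (1 / (6 / 5) : ℝ) = 5 / 6 by norm_num]
    gcongr
    exact (hAk _).1 p
  calc F p ≤ α + b * (A ^ (5 / 6 : ℝ) * (α * V ^ (1 / 6 : ℝ) + B * (α * V ^ (1 / 3 : ℝ)
        + B * (ENNReal.ofReal T ^ (1 / 2 : ℝ) * M)))) := by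
        refine hp.trans ?_
        gcongr
        refine hol.trans ?_
        gcongr
        refine e2.trans ?_
        gcongr
        refine e1.trans ?_
        gcongr
    _ = α * c + e * M := by rw [hc, he, hB]; ring
    _ = (a * ENNReal.ofReal ((t / 4) ^ (-(3 / 2) : ℝ)) * c + e) * M := by rw [hα]; ring
    _ ≤ (a * (8 * ENNReal.ofReal (1 + t ^ (-(13 / 4) : ℝ))) * c
          + e * ENNReal.ofReal (1 + t ^ (-(13 / 4) : ℝ))) * M := by
        have ht13 : 0 < t ^ (-(13 / 4) : ℝ) := Real.rpow_pos_of_pos ht0 _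
        have h1 : (t / 4) ^ (-(3 / 2) : ℝ) ≤ 8 * (1 + t ^ (-(13 / 4) : ℝ)) := by
          have h4 : (4 : ℝ) ^ (-(3 / 2) : ℝ) = 8⁻¹ := by
            rw [show (4 : ℝ) = 2 ^ (2 : ℝ) by norm_num, ← Real.rpow_mul (by norm_num),
              show (2 * (-(3 / 2)) : ℝ) = -((3 : ℕ) : ℝ) by norm_num,
              Real.rpow_neg (by norm_num), Real.rpow_natCast]
            norm_num
          rw [Real.div_rpow ht0.le (by norm_num), h4, div_inv_eq_mul, mul_comm]
          gcongr
          rcases le_total t 1 with h | h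
          · have := Real.rpow_le_rpow_of_exponent_ge ht0 h
              (show (-(13 / 4) : ℝ) ≤ -(3 / 2) by norm_num)
            linarith
          · have := Real.rpow_le_one_of_one_le_of_nonpos h (show (-(3 / 2) : ℝ) ≤ 0 by norm_num)
            linarith
        have h2 : ENNReal.ofReal ((t / 4) ^ (-(3 / 2) : ℝ))
            ≤ 8 * ENNReal.ofReal (1 + t ^ (-(13 / 4) : ℝ)) := by
          refine (ENNReal.ofReal_le_ofReal h1).trans (le_of_eq ?_)
          rw [ENNReal.ofReal_mul (by norm_num)]
          norm_num
        have h3 : e ≤ e * ENNReal.ofReal (1 + t ^ (-(13 / 4) : ℝ)) := by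
          refine le_mul_of_one_le_right' ?_
          rw [← ENNReal.ofReal_one]
          exact ENNReal.ofReal_le_ofReal (by linarith)
        gcongr
    _ = ((a * 8 * c + e) * ENNReal.ofReal (1 + t ^ (-(13 / 4) : ℝ))) * M := by ring
    _ ≤ _ := by
        have ht13 : 0 < t ^ (-(13 / 4) : ℝ) := Real.rpow_pos_of_pos ht0 _
        rw [ENNReal.ofReal_mul (by positivity)]
        gcongr
        conv_lhs => rw [← ENNReal.ofReal_toReal hte]
        exact ENNReal.ofReal_le_ofReal (by linarith)

/-! ### Smooth periodic test functions in `H¹_per(Υ)` -/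

lemma cell_ae_eq_Icc : (cell 3 : Set (Fin 3 → ℝ)) =ᵐ[volume]
    Icc (fun _ => 0) (fun _ => 2 * Real.pi) :=
  Measure.univ_pi_Ioo_ae_eq_Icc

lemma setIntegral_partial_eq_zero {g : (Fin 3 → ℝ) → ℝ} (hg : ContDiff ℝ ∞ g)
    (hp : CellPeriodic g) (i : Fin 3) :
    ∫ ξ in cell 3, fderiv ℝ g ξ (Pi.single i 1) = 0 := by
  rw [setIntegral_congr_set cell_ae_eq_Icc]
  have hle : (fun _ : Fin 3 => (0 : ℝ)) ≤ fun _ => 2 * Real.pi := fun _ => by positivity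
  have hdiff : Differentiable ℝ g := hg.differentiable (by simp)
  have h := integral_divergence_of_hasFDerivAt_off_countable' (E := ℝ)
    (fun _ : Fin 3 => (0 : ℝ)) (fun _ => 2 * Real.pi) hle
    (fun j => if j = i then g else 0) (fun j => if j = i then fderiv ℝ g else 0) ∅
    countable_empty
    (fun j => by
      split_ifs
      · exact hg.continuous.continuousOn
      · exact continuousOn_const)
    (fun x _ j => by
      split_ifs
      · exact (hdiff x).hasFDerivAt
      · exact hasFDerivAt_const (0 : ℝ) x)
    (by
      have : (fun x => ∑ j, (if j = i then fderiv ℝ g else 0) x (Pi.single j 1))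
          = fun x => fderiv ℝ g x (Pi.single i 1) := by
        funext x
        rw [Finset.sum_eq_single i]
        · simp
        · intro j _ hj; simp [hj]
        · simp
      rw [this]
      exact (continuous_partial hg i).continuousOn.integrableOn_compact isCompact_Icc)
  have h1 : (fun x => ∑ j, (if j = i then fderiv ℝ g else 0) x (Pi.single j 1))
      = fun x => fderiv ℝ g x (Pi.single i 1) := by
    funext x
    rw [Finset.sum_eq_single i]
    · simp
    · intro j _ hj; simp [hj]
    · simp
  rw [h1] at h
  rw [h]
  refine Finset.sum_eq_zero fun j _ => ?_
  split_ifs with hj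
  · subst hj
    rw [sub_eq_zero]
    refine integral_congr_ae (Eventually.of_forall fun x => ?_)
    simp only
    rw [← hp (j.insertNth 0 x) j]
    congr 1
    funext l
    rcases Fin.eq_self_or_eq_succAbove j l with rfl | ⟨m, rfl⟩
    · simp
    · simp
  · simp

lemma contDiff_partial {g : (Fin 3 → ℝ) → ℝ} (hg : ContDiff ℝ ∞ g) (i : Fin 3) :
    ContDiff ℝ ∞ fun ξ => fderiv ℝ g ξ (Pi.single i 1) :=
  (hg.fderiv_right (m := ∞) (by simp)).clm_apply contDiff_const

lemma cellPeriodic_partial {g : (Fin 3 → ℝ) → ℝ} (hp : CellPeriodic g) (i : Fin 3) :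
    CellPeriodic fun ξ => fderiv ℝ g ξ (Pi.single i 1) := by
  intro ξ j
  have : (fun ξ => g (ξ + Pi.single j (2 * Real.pi))) = g := funext fun ξ => hp ξ j
  conv_rhs => rw [← this]
  simp only
  rw [fderiv_comp_add_right]

/-- Integration by parts for smooth periodic functions on the cell. -/
lemma setIntegral_mul_partial {v ψ : (Fin 3 → ℝ) → ℝ} (hv : ContDiff ℝ ∞ v)
    (hvp : CellPeriodic v) (hψ : ContDiff ℝ ∞ ψ) (hψp : CellPeriodic ψ) (i : Fin 3) :
    ∫ ξ in cell 3, v ξ * fderiv ℝ ψ ξ (Pi.single i 1)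
      = -∫ ξ in cell 3, fderiv ℝ v ξ (Pi.single i 1) * ψ ξ := by
  have h0 := setIntegral_partial_eq_zero (hv.mul hψ)
    (fun ξ j => by simp only [hvp ξ j, hψp ξ j]) i
  have h1 : ∀ ξ, fderiv ℝ (fun ξ => v ξ * ψ ξ) ξ (Pi.single i 1)
      = v ξ * fderiv ℝ ψ ξ (Pi.single i 1) + fderiv ℝ v ξ (Pi.single i 1) * ψ ξ := by
    intro ξ
    rw [fderiv_fun_mul (hv.differentiable (by simp) ξ) (hψ.differentiable (by simp) ξ)]
    simp [mul_comm]
  simp only [h1] at h0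
  rw [integral_add] at h0
  · linarith
  · exact (memLp_cell_of_continuous (hv.continuous.mul (continuous_partial hψ i))).integrable
      (by norm_num)
  · exact (memLp_cell_of_continuous ((continuous_partial hv i).mul hψ.continuous)).integrable
      (by norm_num)

/-- The Euclidean gradient of a function on space-angle. -/
noncomputable def gradVec (v : (Fin 3 → ℝ) → ℝ) (ξ : Fin 3 → ℝ) : EuclideanSpace ℝ (Fin 3) :=
  WithLp.toLp 2 fun i => fderiv ℝ v ξ (Pi.single i 1)

lemma memLp_gradVec {v : (Fin 3 → ℝ) → ℝ} (hv : ContDiff ℝ ∞ v) :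
    MemLp (gradVec v) 2 (volume.restrict (cell 3)) := by
  have hc : Continuous (gradVec v) :=
    (PiLp.continuous_toLp 2 _).comp (continuous_pi fun i => continuous_partial hv i)
  have h := memLp_cell_of_continuous hc.norm
  exact (memLp_norm_iff hc.aestronglyMeasurable).1 h

/-- A smooth periodic function as an element of `H¹_per(Υ)`. -/
noncomputable def smoothToH1 (v : (Fin 3 → ℝ) → ℝ) (hv : ContDiff ℝ ∞ v) (hvp : CellPeriodic v) :
    H1per :=
  ⟨WithLp.toLp 2 ((memLp_cell_of_continuous hv.continuous).toLp v,
    (memLp_gradVec hv).toLp (gradVec v)), by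
    intro ψ hψ hψp i
    have h1 := (memLp_cell_of_continuous hv.continuous).coeFn_toLp
    have h2 := (memLp_gradVec hv).coeFn_toLp
    refine Eq.trans (integral_congr_ae ?_) ((setIntegral_mul_partial hv hvp hψ hψp i).trans
      (congrArg Neg.neg (integral_congr_ae ?_)))
    · filter_upwards [h1] with ξ h
      exact congrArg (· * fderiv ℝ ψ ξ (Pi.single i 1)) h
    · filter_upwards [h2] with ξ h
      exact (congrArg (fun e : EuclideanSpace ℝ (Fin 3) => e i * ψ ξ) h).symm⟩

lemma h1Val_smoothToH1 {v : (Fin 3 → ℝ) → ℝ} (hv : ContDiff ℝ ∞ v) (hvp : CellPeriodic v) :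
    h1Val (smoothToH1 v hv hvp) =ᵐ[volume.restrict (cell 3)] v :=
  (memLp_cell_of_continuous hv.continuous).coeFn_toLp

lemma h1Grad_smoothToH1 {v : (Fin 3 → ℝ) → ℝ} (hv : ContDiff ℝ ∞ v) (hvp : CellPeriodic v) :
    h1Grad (smoothToH1 v hv hvp) =ᵐ[volume.restrict (cell 3)] gradVec v :=
  (memLp_gradVec hv).coeFn_toLp

lemma h1Grad_zero : h1Grad (0 : H1per) =ᵐ[volume.restrict (cell 3)] 0 :=
  Lp.coeFn_zero _ _ _

/-- The defining property of the weak gradient, in terms of `h1Val` and `h1Grad`. -/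
lemma setIntegral_h1Grad_mul (w : H1per) {ψ : (Fin 3 → ℝ) → ℝ} (hψ : ContDiff ℝ ∞ ψ)
    (hψp : CellPeriodic ψ) (i : Fin 3) :
    ∫ ξ in cell 3, h1Grad w ξ i * ψ ξ
      = -∫ ξ in cell 3, h1Val w ξ * fderiv ℝ ψ ξ (Pi.single i 1) := by
  have := w.2 ψ hψ hψp i
  rw [eq_neg_iff_add_eq_zero, add_comm, ← eq_neg_iff_add_eq_zero]
  exact this

/-! ### Weak derivatives and increments on an interval -/

lemma deriv_smoothTransition_nonneg (x : ℝ) : 0 ≤ deriv Real.smoothTransition x :=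
  Real.smoothTransition.monotone.deriv_nonneg

lemma hasDerivAt_smoothTransition_div (c δ t : ℝ) :
    HasDerivAt (fun t => Real.smoothTransition ((t - c) / δ))
      (deriv Real.smoothTransition ((t - c) / δ) / δ) t := by
  have h1 : HasDerivAt Real.smoothTransition _ ((t - c) / δ) :=
    ((Real.smoothTransition.contDiff (n := 1)).differentiable (by simp) _).hasDerivAt
  have h2 := h1.comp t (((hasDerivAt_id t).sub_const c).div_const δ)
  simpa [div_eq_mul_inv, Function.comp_def] using h2

/-- Against the derivative of a smooth step at `c` of width `δ`, a continuous function integrates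
to nearly its value at `c`. -/
lemma abs_setIntegral_deriv_step_sub_le {T : ℝ} {W : ℝ → ℝ} (hW : ContinuousOn W (Icc 0 T))
    {c δ κ : ℝ} (hc : 0 < c) (hδ : 0 < δ) (hcT : c + δ < T)
    (hκ : ∀ t ∈ Icc c (c + δ), |W t - W c| ≤ κ) :
    |(∫ t in Ioo 0 T, deriv Real.smoothTransition ((t - c) / δ) / δ * W t) - W c| ≤ κ := by
  set ρ : ℝ → ℝ := fun t => deriv Real.smoothTransition ((t - c) / δ) / δ with hρ
  have hder : ∀ t, HasDerivAt (fun t => Real.smoothTransition ((t - c) / δ)) (ρ t) t :=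
    hasDerivAt_smoothTransition_div c δ
  have hρc : Continuous ρ := by
    have : Continuous (deriv Real.smoothTransition) :=
      (Real.smoothTransition.contDiff (n := 1)).continuous_deriv (by simp)
    fun_prop
  have hρ0 : ∀ t, 0 ≤ ρ t := fun t => div_nonneg (deriv_smoothTransition_nonneg _) hδ.le
  have hout : ∀ t, t ∉ Icc c (c + δ) → ρ t = 0 := by
    intro t ht
    rw [← (hder t).deriv]
    rw [mem_Icc, not_and_or, not_le, not_le] at ht
    rcases ht with ht | ht
    · have : (fun t => Real.smoothTransition ((t - c) / δ)) =ᶠ[𝓝 t] fun _ => 0 := by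
        filter_upwards [Iio_mem_nhds ht] with x hx
        exact Real.smoothTransition.zero_of_nonpos
          (div_nonpos_of_nonpos_of_nonneg (by linarith [mem_Iio.1 hx]) hδ.le)
      rw [this.deriv_eq, deriv_const]
    · have : (fun t => Real.smoothTransition ((t - c) / δ)) =ᶠ[𝓝 t] fun _ => 1 := by
        filter_upwards [Ioi_mem_nhds ht] with x hx
        exact Real.smoothTransition.one_of_one_le
          ((one_le_div hδ).2 (by linarith [mem_Ioi.1 hx]))
      rw [this.deriv_eq, deriv_const]
  have hsub : Icc c (c + δ) ⊆ Ioo 0 T := fun t ht => ⟨hc.trans_le ht.1, ht.2.trans_lt hcT⟩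
  have hsub' : Icc c (c + δ) ⊆ Icc 0 T := hsub.trans Ioo_subset_Icc_self
  have hI1 : ∫ t in Icc c (c + δ), ρ t = 1 := by
    rw [integral_Icc_eq_integral_Ioc, ← intervalIntegral.integral_of_le (by linarith),
      intervalIntegral.integral_eq_sub_of_hasDerivAt (fun t _ => hder t)
        (hρc.intervalIntegrable _ _)]
    simp [hδ.ne']
  have hI2 : ∫ t in Ioo 0 T, ρ t * W t = ∫ t in Icc c (c + δ), ρ t * W t := by
    refine setIntegral_eq_of_subset_of_forall_sdiff_eq_zero measurableSet_Ioo hsub fun t ht => ?_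
    rw [hout t ht.2, zero_mul]
  have hWi : IntegrableOn (fun t => ρ t * W t) (Icc c (c + δ)) :=
    (hρc.continuousOn.mul (hW.mono hsub')).integrableOn_compact isCompact_Icc
  have hρi : IntegrableOn ρ (Icc c (c + δ)) := hρc.continuousOn.integrableOn_compact isCompact_Icc
  have hI3 : (∫ t in Icc c (c + δ), ρ t * W t) - W c
      = ∫ t in Icc c (c + δ), ρ t * (W t - W c) := by
    simp only [mul_sub]
    rw [integral_sub hWi (hρi.mul_const _), integral_mul_const, hI1, one_mul]
  rw [hI2, hI3, ← Real.norm_eq_abs]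
  calc _ ≤ ∫ t in Icc c (c + δ), ρ t * κ := by
        refine norm_integral_le_of_norm_le (hρi.mul_const _) ?_
        filter_upwards [ae_restrict_mem measurableSet_Icc] with t ht
        rw [norm_mul, Real.norm_of_nonneg (hρ0 t), Real.norm_eq_abs]
        exact mul_le_mul_of_nonneg_left (hκ t ht) (hρ0 t)
    _ = κ := by rw [integral_mul_const, hI1, one_mul]

/-- A continuous function with an integrable distributional derivative satisfies the fundamental
theorem of calculus. -/
theorem sub_eq_intervalIntegral_of_weak_deriv {T : ℝ} {W g : ℝ → ℝ}
    (hW : ContinuousOn W (Icc 0 T)) (hg : IntegrableOn g (Ioo 0 T))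
    (h : ∀ η : ℝ → ℝ, ContDiff ℝ ∞ η → HasCompactSupport η → tsupport η ⊆ Ioo 0 T →
      ∫ t in Ioo 0 T, deriv η t * W t = -∫ t in Ioo 0 T, η t * g t)
    {a b : ℝ} (ha : 0 < a) (hab : a ≤ b) (hb : b < T) :
    W b - W a = ∫ t in Ioo a b, g t := by
  have hstep : ∀ c, 0 < c → c < T → Tendsto (fun δ : ℝ => ∫ t in Ioo 0 T,
      deriv Real.smoothTransition ((t - c) / δ) / δ * W t) (𝓝[>] 0) (𝓝 (W c)) := by
    intro c hc hcT
    rw [Metric.tendsto_nhds]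
    intro ε hε
    have hcont : ContinuousAt W c := hW.continuousAt (Icc_mem_nhds hc hcT)
    obtain ⟨r, hr, hWr⟩ := Metric.continuousAt_iff.1 hcont (ε / 2) (by positivity)
    have hmem : Ioo (0 : ℝ) (min r (T - c)) ∈ 𝓝[>] (0 : ℝ) :=
      Ioo_mem_nhdsGT (lt_min hr (by linarith))
    filter_upwards [hmem] with δ hδ
    rw [mem_Ioo, lt_min_iff] at hδ
    rw [Real.dist_eq]
    refine lt_of_le_of_lt (abs_setIntegral_deriv_step_sub_le hW hc hδ.1 (by linarith) (κ := ε / 2)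
      fun t ht => ?_) (by linarith)
    have := hWr (x := t) (by
      rw [Real.dist_eq, abs_of_nonneg (by linarith [ht.1])]; linarith [ht.2])
    rw [Real.dist_eq] at this
    exact this.le
  set η : ℝ → ℝ → ℝ := fun δ t =>
    Real.smoothTransition ((t - a) / δ) - Real.smoothTransition ((t - b) / δ) with hη
  have hW' : ∀ (c δ : ℝ), IntegrableOn
      (fun t => deriv Real.smoothTransition ((t - c) / δ) / δ * W t) (Ioo 0 T) := by
    intro c δ
    have hc : Continuous (deriv Real.smoothTransition) :=
      (Real.smoothTransition.contDiff (n := 1)).continuous_deriv (by simp)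
    have hc2 : Continuous fun t => deriv Real.smoothTransition ((t - c) / δ) / δ := by fun_prop
    exact ((hc2.continuousOn.mul hW).integrableOn_compact isCompact_Icc).mono_set
      Ioo_subset_Icc_self
  have hev : ∀ᶠ δ : ℝ in 𝓝[>] 0,
      (∫ t in Ioo 0 T, deriv Real.smoothTransition ((t - a) / δ) / δ * W t)
        - (∫ t in Ioo 0 T, deriv Real.smoothTransition ((t - b) / δ) / δ * W t)
      = -∫ t in Ioo 0 T, η δ t * g t := by
    filter_upwards [Ioo_mem_nhdsGT (show (0 : ℝ) < T - b by linarith)] with δ hδ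
    have hsupp : Function.support (η δ) ⊆ Icc a (b + δ) := by
      intro t ht
      by_contra hn
      refine ht ?_
      rw [mem_Icc, not_and_or, not_le, not_le] at hn
      simp only [hη]
      rcases hn with hn | hn
      · rw [Real.smoothTransition.zero_of_nonpos
          (div_nonpos_of_nonpos_of_nonneg (by linarith) hδ.1.le),
          Real.smoothTransition.zero_of_nonpos
          (div_nonpos_of_nonpos_of_nonneg (by linarith) hδ.1.le), sub_self]
      · rw [Real.smoothTransition.one_of_one_le ((one_le_div hδ.1).2 (by linarith)),
          Real.smoothTransition.one_of_one_le ((one_le_div hδ.1).2 (by linarith)), sub_self]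
    have hts : tsupport (η δ) ⊆ Icc a (b + δ) := closure_minimal hsupp isClosed_Icc
    have hsm : ∀ c : ℝ, ContDiff ℝ ∞ fun t : ℝ => Real.smoothTransition ((t - c) / δ) := fun c =>
      Real.smoothTransition.contDiff.comp ((contDiff_id.sub contDiff_const).div_const _)
    rw [← h (η δ) ((hsm a).sub (hsm b)) (HasCompactSupport.of_support_subset_isCompact
      isCompact_Icc hsupp) (hts.trans fun t ht => ⟨ha.trans_le ht.1, by linarith [ht.2, hδ.2]⟩),
      ← integral_sub (hW' a δ) (hW' b δ)]
    refine integral_congr_ae (Eventually.of_forall fun t => ?_)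
    simp only
    rw [((hasDerivAt_smoothTransition_div a δ t).fun_sub
      (hasDerivAt_smoothTransition_div b δ t)).deriv, sub_mul]
  have hlim : Tendsto (fun δ : ℝ => ∫ t in Ioo 0 T, η δ t * g t) (𝓝[>] 0)
      (𝓝 (∫ t in Ioo 0 T, (Ioc a b).indicator g t)) := by
    refine tendsto_integral_filter_of_dominated_convergence (fun t => |g t|) ?_ ?_ hg.abs ?_
    · refine Eventually.of_forall fun δ => ?_
      have : Continuous (η δ) := by
        have := Real.smoothTransition.continuous
        simp only [hη]
        fun_prop
      exact this.aestronglyMeasurable.mul hg.aestronglyMeasurable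
    · refine Eventually.of_forall fun δ => Eventually.of_forall fun t => ?_
      rw [norm_mul, Real.norm_eq_abs, Real.norm_eq_abs]
      refine mul_le_of_le_one_left (abs_nonneg _) ?_
      have h1 := Real.smoothTransition.le_one ((t - a) / δ)
      have h2 := Real.smoothTransition.nonneg ((t - a) / δ)
      have h3 := Real.smoothTransition.le_one ((t - b) / δ)
      have h4 := Real.smoothTransition.nonneg ((t - b) / δ)
      rw [abs_le]
      constructor <;> simp only [hη] <;> linarith
    · refine Eventually.of_forall fun t => ?_
      refine tendsto_const_nhds.congr' ?_
      have hzero : ∀ c, t ≤ c → ∀ δ : ℝ, 0 < δ → Real.smoothTransition ((t - c) / δ) = 0 :=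
        fun c hc δ hδ => Real.smoothTransition.zero_of_nonpos
          (div_nonpos_of_nonpos_of_nonneg (by linarith) hδ.le)
      have hone : ∀ c, c < t → ∀ δ : ℝ, 0 < δ → δ < t - c →
          Real.smoothTransition ((t - c) / δ) = 1 :=
        fun c hc δ hδ hδ' => Real.smoothTransition.one_of_one_le ((one_le_div hδ).2 hδ'.le)
      rcases le_or_gt t a with hta | hta
      · filter_upwards [self_mem_nhdsWithin] with δ hδ
        rw [indicator_of_notMem (fun h => absurd h.1 (not_lt.2 hta))]
        simp only [hη]
        rw [hzero a hta δ hδ, hzero b (hta.trans hab) δ hδ]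
        simp
      · rcases le_or_gt t b with htb | htb
        · filter_upwards [Ioo_mem_nhdsGT (sub_pos.2 hta)] with δ hδ
          rw [indicator_of_mem (show t ∈ Ioc a b from ⟨hta, htb⟩)]
          simp only [hη]
          rw [hone a hta δ hδ.1 hδ.2, hzero b htb δ hδ.1]
          simp
        · filter_upwards [Ioo_mem_nhdsGT (sub_pos.2 htb)] with δ hδ
          rw [indicator_of_notMem (fun h => absurd h.2 (not_le.2 htb))]
          simp only [hη]
          rw [hone a hta δ hδ.1 (by linarith [hδ.2]), hone b htb δ hδ.1 hδ.2]
          simp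
  have hfin := tendsto_nhds_unique (((hstep a ha (hab.trans_lt hb)).sub
    (hstep b (ha.trans_le hab) hb)).congr' hev) hlim.neg
  rw [setIntegral_indicator measurableSet_Ioc] at hfin
  have hinter : Ioo 0 T ∩ Ioc a b = Ioc a b :=
    inter_eq_right.2 fun t ht => ⟨ha.trans ht.1, ht.2.trans_lt hb⟩
  rw [hinter, integral_Ioc_eq_integral_Ioo] at hfin
  linarith

/-- A function whose increments are bounded, up to `o(length)` uniformly, by those of `M` has all
its increments bounded by those of `M`. -/
lemma abs_sub_le_sub_of_locally {h M : ℝ → ℝ} {s b : ℝ} (hsb : s ≤ b)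
    (H : ∀ ε > 0, ∃ δ > 0, ∀ x ∈ Icc s b, ∀ y ∈ Icc s b, x ≤ y → y - x < δ →
      |h y - h x| ≤ M y - M x + ε * (y - x)) :
    |h b - h s| ≤ M b - M s := by
  refine le_of_forall_pos_le_add fun ε' hε' => ?_
  obtain ⟨δ, hδ, hloc⟩ := H (ε' / (b - s + 1)) (by have := sub_nonneg.2 hsb; positivity)
  set ε := ε' / (b - s + 1) with hε
  obtain ⟨n, hn⟩ := exists_nat_gt ((b - s) / δ)
  have hn0 : (0 : ℝ) < n := lt_of_le_of_lt (div_nonneg (sub_nonneg.2 hsb) hδ.le) hn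
  set x : ℕ → ℝ := fun i => s + i * ((b - s) / n) with hx
  have hstep0 : 0 ≤ (b - s) / n := div_nonneg (sub_nonneg.2 hsb) hn0.le
  have hxs : ∀ i, x (i + 1) - x i = (b - s) / n := fun i => by simp only [hx]; push_cast; ring
  have hxn : x n = b := by simp only [hx]; field_simp; ring
  have hx0 : x 0 = s := by simp [hx]
  have hmono : Monotone x := monotone_nat_of_le_succ fun i => by linarith [hxs i]
  have hind : ∀ i ≤ n, |h (x i) - h s| ≤ M (x i) - M s + ε * (x i - s) := by
    intro i
    induction i with
    | zero => intro _; simp [hx0]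
    | succ i ih =>
      intro hi
      have h1 := ih (by omega)
      have hm : ∀ j ≤ n, x j ∈ Icc s b := fun j hj =>
        ⟨hx0 ▸ hmono (Nat.zero_le j), hxn ▸ hmono hj⟩
      have h2 := hloc (x i) (hm i (by omega)) (x (i + 1)) (hm _ hi) (hmono (Nat.le_succ i)) (by
        rw [hxs, div_lt_iff₀ hn0, mul_comm, ← div_lt_iff₀ hδ]; exact hn)
      calc |h (x (i + 1)) - h s| ≤ |h (x (i + 1)) - h (x i)| + |h (x i) - h s| :=
            abs_sub_le _ _ _
        _ ≤ _ := by linarith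
  have hfin := hind n le_rfl
  rw [hxn] at hfin
  refine hfin.trans ?_
  have : ε * (b - s) ≤ ε' := by
    have hp : 0 < b - s + 1 := by linarith
    rw [hε, div_mul_eq_mul_div, div_le_iff₀ hp]
    nlinarith
  linarith

/-! ### Pairings of curves in `L¹` with time-dependent test functions -/

/-- `f` is a uniformly continuous curve in `L¹(Υ)` over the set of times `I`. -/
structure IsL1Curve (I : Set ℝ) (f : ℝ → (Fin 3 → ℝ) → ℝ) : Prop where
  integrable : ∀ t ∈ I, IntegrableOn (f t) (cell 3)
  unif : ∀ ε > 0, ∃ δ > 0, ∀ s ∈ I, ∀ t ∈ I, |t - s| < δ → ∫ ξ in cell 3, |f t ξ - f s ξ| ≤ ε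

/-- `m` is a bounded, uniformly continuous curve of bounded continuous functions over the set of
times `I`. -/
structure IsUniformCurve (I : Set ℝ) (m : ℝ → (Fin 3 → ℝ) → ℝ) : Prop where
  cont : ∀ t ∈ I, Continuous (m t)
  bound : ∃ B : ℝ, 0 ≤ B ∧ ∀ t ∈ I, ∀ ξ, |m t ξ| ≤ B
  unif : ∀ ε > 0, ∃ δ > 0, ∀ s ∈ I, ∀ t ∈ I, |t - s| < δ → ∀ ξ, |m t ξ - m s ξ| ≤ ε

lemma IsL1Curve.mono {I J : Set ℝ} {f : ℝ → (Fin 3 → ℝ) → ℝ} (h : IsL1Curve I f) (hJ : J ⊆ I) :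
    IsL1Curve J f :=
  ⟨fun t ht => h.integrable t (hJ ht), fun ε hε => by
    obtain ⟨δ, hδ, H⟩ := h.unif ε hε
    exact ⟨δ, hδ, fun s hs t ht => H s (hJ hs) t (hJ ht)⟩⟩

lemma IsL1Curve.abs {I : Set ℝ} {f : ℝ → (Fin 3 → ℝ) → ℝ} (h : IsL1Curve I f) :
    IsL1Curve I fun t ξ => |f t ξ| :=
  ⟨fun t ht => (h.integrable t ht).abs, fun ε hε => by
    obtain ⟨δ, hδ, H⟩ := h.unif ε hε
    refine ⟨δ, hδ, fun s hs t ht hst => le_trans ?_ (H s hs t ht hst)⟩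
    exact integral_mono ((h.integrable t ht).abs.sub (h.integrable s hs).abs).abs
      ((h.integrable t ht).sub (h.integrable s hs)).abs fun ξ => abs_abs_sub_abs_le _ _⟩

lemma IsUniformCurve.const (I : Set ℝ) {ψ : (Fin 3 → ℝ) → ℝ} (hψ : Continuous ψ) {B : ℝ}
    (hB : ∀ ξ, |ψ ξ| ≤ B) : IsUniformCurve I fun _ => ψ :=
  ⟨fun _ _ => hψ, ⟨B, (abs_nonneg _).trans (hB 0), fun _ _ => hB⟩,
    fun ε hε => ⟨1, one_pos, fun _ _ _ _ _ ξ => by simpa using hε.le⟩⟩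

lemma integrableOn_mul_of_bound {g ψ : (Fin 3 → ℝ) → ℝ} (hg : IntegrableOn g (cell 3))
    (hψ : Continuous ψ) {B : ℝ} (hB : ∀ ξ, |ψ ξ| ≤ B) :
    IntegrableOn (fun ξ => g ξ * ψ ξ) (cell 3) :=
  hg.mul_bdd hψ.aestronglyMeasurable (Eventually.of_forall hB)

lemma abs_setIntegral_mul_le {g ψ : (Fin 3 → ℝ) → ℝ} (hg : IntegrableOn g (cell 3)) {B : ℝ}
    (hB : ∀ ξ, |ψ ξ| ≤ B) :
    |∫ ξ in cell 3, g ξ * ψ ξ| ≤ B * ∫ ξ in cell 3, |g ξ| := by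
  rw [← integral_const_mul, ← Real.norm_eq_abs]
  refine norm_integral_le_of_norm_le (hg.abs.const_mul B) (Eventually.of_forall fun ξ => ?_)
  rw [Real.norm_eq_abs, abs_mul, mul_comm]
  exact mul_le_mul_of_nonneg_right (hB ξ) (abs_nonneg _)

lemma continuousOn_integral_mul {I : Set ℝ} {f m : ℝ → (Fin 3 → ℝ) → ℝ} (hf : IsL1Curve I f)
    (hm : IsUniformCurve I m) : ContinuousOn (fun t => ∫ ξ in cell 3, f t ξ * m t ξ) I := by
  obtain ⟨B, hB0, hB⟩ := hm.bound
  intro s hs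
  set N := ∫ ξ in cell 3, |f s ξ| with hN
  have hN0 : 0 ≤ N := integral_nonneg fun ξ => abs_nonneg _
  rw [ContinuousWithinAt, Metric.tendsto_nhdsWithin_nhds]
  intro ε hε
  obtain ⟨δ1, hδ1, h1⟩ := hf.unif (ε / (2 * (B + N + 1))) (by positivity)
  obtain ⟨δ2, hδ2, h2⟩ := hm.unif (ε / (2 * (B + N + 1))) (by positivity)
  set ε1 := ε / (2 * (B + N + 1)) with hε1
  refine ⟨min δ1 δ2, lt_min hδ1 hδ2, fun {t} ht hts => ?_⟩
  rw [Real.dist_eq, lt_min_iff] at hts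
  have hft := hf.integrable t ht
  have hfs := hf.integrable s hs
  have e : (∫ ξ in cell 3, f t ξ * m t ξ) - ∫ ξ in cell 3, f s ξ * m s ξ
      = (∫ ξ in cell 3, (f t ξ - f s ξ) * m t ξ) + ∫ ξ in cell 3, f s ξ * (m t ξ - m s ξ) := by
    have i1 := integrableOn_mul_of_bound hft (hm.cont t ht) (hB t ht)
    have i2 := integrableOn_mul_of_bound hfs (hm.cont s hs) (hB s hs)
    have i3 := integrableOn_mul_of_bound hfs (hm.cont t ht) (hB t ht)
    simp only [sub_mul, mul_sub]
    rw [integral_sub i1 i3, integral_sub i3 i2]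
    ring
  have a1 := abs_setIntegral_mul_le (hft.sub hfs) (hB t ht)
  have a2 := abs_setIntegral_mul_le hfs (h2 s hs t ht hts.2)
  have a3 := h1 s hs t ht hts.1
  simp only [Pi.sub_apply] at a1
  have hε0 : 0 < ε1 := by positivity
  rw [Real.dist_eq, e]
  calc _ ≤ B * ε1 + ε1 * N := (abs_add_le _ _).trans (add_le_add (a1.trans (by gcongr)) a2)
    _ = ε1 * (B + N) := by ring
    _ < ε1 * (2 * (B + N + 1)) := by gcongr; linarith
    _ = ε := by rw [hε1]; field_simp

lemma IsL1Curve.exists_integral_abs_le {f : ℝ → (Fin 3 → ℝ) → ℝ} {s b : ℝ}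
    (hf : IsL1Curve (Icc s b) f) :
    ∃ N : ℝ, 0 ≤ N ∧ ∀ t ∈ Icc s b, ∫ ξ in cell 3, |f t ξ| ≤ N := by
  have h := continuousOn_integral_mul hf.abs
    (IsUniformCurve.const _ (continuous_const (y := (1 : ℝ))) (B := 1) (by simp))
  simp only [mul_one] at h
  obtain ⟨N, hN⟩ := isCompact_Icc.exists_bound_of_continuousOn h
  refine ⟨|N|, abs_nonneg _, fun t ht => (le_abs_self _).trans ((hN t ht).trans (le_abs_self N))⟩

/-- Passage from test functions frozen in time to time-dependent ones. If the increments from time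
`x` of the pairing with the frozen function `φ x` cancel the pairing with its time derivative `φ' x`
up to an error controlled by `m x`, then the increments of the pairing with `φ t` are controlled by
`m t`. -/
theorem abs_pairing_sub_le {f φ φ' m : ℝ → (Fin 3 → ℝ) → ℝ} {s b : ℝ} (hsb : s ≤ b)
    (hf : IsL1Curve (Icc s b) f) (hφ : IsUniformCurve (Icc s b) φ)
    (hφ' : IsUniformCurve (Icc s b) φ') (hm : IsUniformCurve (Icc s b) m)
    (hder : ∀ ξ, ∀ t ∈ Icc s b, HasDerivAt (fun t => φ t ξ) (φ' t ξ) t)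
    (hstep : ∀ x ∈ Icc s b, ∀ y ∈ Icc s b, x ≤ y →
      |(∫ ξ in cell 3, f y ξ * φ x ξ) - (∫ ξ in cell 3, f x ξ * φ x ξ)
        + ∫ τ in x..y, ∫ ξ in cell 3, f τ ξ * φ' x ξ|
      ≤ ∫ τ in x..y, ∫ ξ in cell 3, |f τ ξ| * m x ξ) :
    |(∫ ξ in cell 3, f b ξ * φ b ξ) - ∫ ξ in cell 3, f s ξ * φ s ξ|
      ≤ ∫ τ in s..b, ∫ ξ in cell 3, |f τ ξ| * m τ ξ := by
  obtain ⟨N, hN0, hN⟩ := hf.exists_integral_abs_le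
  obtain ⟨B, hB0, hB⟩ := hφ'.bound
  obtain ⟨Bφ, hBφ0, hBφ⟩ := hφ.bound
  obtain ⟨Bm, hBm0, hBm⟩ := hm.bound
  have hmc := continuousOn_integral_mul hf.abs hm
  have hii : ∀ (G : ℝ → ℝ), ContinuousOn G (Icc s b) → ∀ x ∈ Icc s b, ∀ y ∈ Icc s b,
      IntervalIntegrable G volume x y := by
    intro G hG x hx y hy
    exact (hG.mono (uIcc_subset_Icc hx hy)).intervalIntegrable
  have key := abs_sub_le_sub_of_locally (h := fun t => ∫ ξ in cell 3, f t ξ * φ t ξ)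
    (M := fun t => ∫ τ in s..t, ∫ ξ in cell 3, |f τ ξ| * m τ ξ) hsb ?_
  · simpa using key
  intro ε hε
  -- the three error terms below amount to `ε1 * (2 * N + B) * (y - x)`
  set ε1 := ε / (2 * N + B + 1) with hε1
  have hε0 : 0 < ε1 := by positivity
  obtain ⟨δ1, hδ1, h1⟩ := hf.unif ε1 hε0
  obtain ⟨δ2, hδ2, h2⟩ := hφ'.unif ε1 hε0
  obtain ⟨δ3, hδ3, h3⟩ := hm.unif ε1 hε0
  refine ⟨min δ1 (min δ2 δ3), lt_min hδ1 (lt_min hδ2 hδ3), fun x hx y hy hxy hlt => ?_⟩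
  rw [lt_min_iff, lt_min_iff] at hlt
  have hsub : Icc x y ⊆ Icc s b := Icc_subset_Icc hx.1 hy.2
  have hs : s ∈ Icc s b := left_mem_Icc.2 hsb
  have hfy := hf.integrable y hy
  -- the remainder in the first-order Taylor expansion of `φ` in time
  have hR : ∀ ξ, |φ y ξ - φ x ξ - (y - x) * φ' x ξ| ≤ ε1 * (y - x) := by
    intro ξ
    have hd : ∀ t ∈ Icc x y, HasDerivWithinAt (fun t => φ t ξ - t * φ' x ξ)
        (φ' t ξ - φ' x ξ) (Icc x y) t := by
      intro t ht
      have := (hder ξ t (hsub ht)).sub ((hasDerivAt_id t).mul_const (φ' x ξ))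
      rw [one_mul] at this
      exact this.hasDerivWithinAt
    have := (convex_Icc x y).norm_image_sub_le_of_norm_hasDerivWithin_le hd
      (C := ε1) (fun t ht => h2 x hx t (hsub ht) (by
        rw [abs_of_nonneg (by linarith [ht.1])]; linarith [ht.2, hlt.2.1]) ξ)
      (left_mem_Icc.2 hxy) (right_mem_Icc.2 hxy)
    rw [Real.norm_eq_abs, Real.norm_eq_abs, abs_of_nonneg (sub_nonneg.2 hxy)] at this
    refine le_trans (le_of_eq ?_) this
    congr 1; ring
  set X := (∫ ξ in cell 3, f y ξ * φ x ξ) - ∫ ξ in cell 3, f x ξ * φ x ξ with hX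
  set Y := ∫ ξ in cell 3, f y ξ * (φ y ξ - φ x ξ - (y - x) * φ' x ξ) with hY
  set Z := ∫ ξ in cell 3, f y ξ * φ' x ξ with hZ
  have e : (∫ ξ in cell 3, f y ξ * φ y ξ) - ∫ ξ in cell 3, f x ξ * φ x ξ
      = X + Y + (y - x) * Z := by
    have i1 := integrableOn_mul_of_bound hfy (hφ.cont y hy) (hBφ y hy)
    have i2 := integrableOn_mul_of_bound hfy (hφ.cont x hx) (hBφ x hx)
    have i3 := integrableOn_mul_of_bound hfy (hφ'.cont x hx) (hB x hx)
    have : Y = (∫ ξ in cell 3, f y ξ * φ y ξ) - (∫ ξ in cell 3, f y ξ * φ x ξ)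
        - (y - x) * Z := by
      have i12 : IntegrableOn (fun ξ => f y ξ * φ y ξ - f y ξ * φ x ξ) (cell 3) := i1.sub i2
      rw [hY, hZ, ← integral_const_mul, ← integral_sub i1 i2,
        ← integral_sub i12 (i3.const_mul _)]
      refine integral_congr_ae (Eventually.of_forall fun ξ => ?_)
      simp only
      ring
    rw [this, hX]; ring
  have bY : |Y| ≤ ε1 * (y - x) * N :=
    (abs_setIntegral_mul_le hfy hR).trans (mul_le_mul_of_nonneg_left (hN y hy)
      (mul_nonneg hε0.le (sub_nonneg.2 hxy)))
  have hcφ' := continuousOn_integral_mul hf (IsUniformCurve.const _ (hφ'.cont x hx) (hB x hx))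
  have hcm := continuousOn_integral_mul hf.abs (IsUniformCurve.const _ (hm.cont x hx) (hBm x hx))
  have bZ : |(y - x) * Z - ∫ τ in x..y, ∫ ξ in cell 3, f τ ξ * φ' x ξ| ≤ B * ε1 * (y - x) := by
    have : (y - x) * Z - ∫ τ in x..y, ∫ ξ in cell 3, f τ ξ * φ' x ξ
        = ∫ τ in x..y, (Z - ∫ ξ in cell 3, f τ ξ * φ' x ξ) := by
      rw [intervalIntegral.integral_sub intervalIntegrable_const (hii _ hcφ' x hx y hy),
        intervalIntegral.integral_const, smul_eq_mul]
    rw [this, ← Real.norm_eq_abs]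
    refine (intervalIntegral.norm_integral_le_of_norm_le_const (C := B * ε1) fun τ hτ => ?_).trans
      (by rw [abs_of_nonneg (sub_nonneg.2 hxy)])
    rw [uIoc_of_le hxy] at hτ
    have hτI := hsub (Ioc_subset_Icc_self hτ)
    have hfτ := hf.integrable τ hτI
    rw [hZ, ← integral_sub (integrableOn_mul_of_bound hfy (hφ'.cont x hx) (hB x hx))
      (integrableOn_mul_of_bound hfτ (hφ'.cont x hx) (hB x hx)), Real.norm_eq_abs]
    simp only [← sub_mul]
    refine (abs_setIntegral_mul_le (hfy.sub hfτ) (hB x hx)).trans ?_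
    gcongr
    exact h1 τ hτI y hy (by rw [abs_of_nonneg (by linarith [hτ.2])]; linarith [hτ.1, hlt.1])
  have bm : ∫ τ in x..y, ∫ ξ in cell 3, |f τ ξ| * m x ξ
      ≤ (∫ τ in x..y, ∫ ξ in cell 3, |f τ ξ| * m τ ξ) + ε1 * N * (y - x) := by
    have : (∫ τ in x..y, ∫ ξ in cell 3, |f τ ξ| * m τ ξ) + ε1 * N * (y - x)
        = ∫ τ in x..y, ((∫ ξ in cell 3, |f τ ξ| * m τ ξ) + ε1 * N) := by
      rw [intervalIntegral.integral_add (hii _ hmc x hx y hy) intervalIntegrable_const,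
        intervalIntegral.integral_const, smul_eq_mul]
      ring
    rw [this]
    refine intervalIntegral.integral_mono_on hxy (hii _ hcm x hx y hy)
      ((hii _ hmc x hx y hy).add intervalIntegrable_const) fun τ hτ => ?_
    have hτI := hsub hτ
    have hfτ := (hf.integrable τ hτI).abs
    rw [← sub_le_iff_le_add', ← integral_sub
      (integrableOn_mul_of_bound hfτ (hm.cont x hx) (hBm x hx))
      (integrableOn_mul_of_bound hfτ (hm.cont τ hτI) (hBm τ hτI))]
    simp only [← mul_sub]
    refine (le_abs_self _).trans ((abs_setIntegral_mul_le hfτ (h3 τ hτI x hx (by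
      rw [abs_sub_comm, abs_of_nonneg (by linarith [hτ.1])]
      linarith [hτ.2, hlt.2.2]))).trans ?_)
    simp only [abs_abs]
    gcongr
    exact hN τ hτI
  have bX := hstep x hx y hy hxy
  rw [← hX] at bX
  have hM : (∫ τ in s..y, ∫ ξ in cell 3, |f τ ξ| * m τ ξ)
      - (∫ τ in s..x, ∫ ξ in cell 3, |f τ ξ| * m τ ξ)
      = ∫ τ in x..y, ∫ ξ in cell 3, |f τ ξ| * m τ ξ :=
    intervalIntegral.integral_interval_sub_left (hii _ hmc s hs y hy) (hii _ hmc s hs x hx)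
  have hεε : ε1 * (2 * N + B) ≤ ε := by
    rw [hε1, div_mul_eq_mul_div, div_le_iff₀ (by positivity)]
    nlinarith
  rw [hM, e]
  set P := ∫ τ in x..y, ∫ ξ in cell 3, f τ ξ * φ' x ξ
  have : X + Y + (y - x) * Z = (X + P) + Y + ((y - x) * Z - P) := by ring
  rw [this]
  calc _ ≤ |X + P| + |Y| + |(y - x) * Z - P| :=
        (abs_add_le _ _).trans (add_le_add (abs_add_le _ _) le_rfl)
    _ ≤ (∫ τ in x..y, ∫ ξ in cell 3, |f τ ξ| * m τ ξ) + ε1 * (2 * N + B) * (y - x) := by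
        linarith
    _ ≤ _ := by
        have := mul_le_mul_of_nonneg_right hεε (sub_nonneg.2 hxy)
        linarith

/-! ### The weak formulation tested against smooth periodic functions -/

variable {Pe De T : ℝ} {f₀ : (Fin 3 → ℝ) → ℝ} {f : ℝ → (Fin 3 → ℝ) → ℝ}

lemma IsWeakSolution.integrable (h : IsWeakSolution Pe De T f₀ f) {t : ℝ} (ht : t ∈ Icc 0 T) :
    IntegrableOn (f t) (cell 3) :=
  (h.memLp t ht).integrable (by norm_num)

/-- Continuity into `L²` on the compact time interval gives uniform continuity into `L¹`. -/
lemma IsWeakSolution.isL1Curve (h : IsWeakSolution Pe De T f₀ f) : IsL1Curve (Icc 0 T) f := by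
  refine ⟨fun t ht => h.integrable ht, ?_⟩
  have hint : ∀ t : Icc (0 : ℝ) T, Integrable (f t) (volume.restrict (cell 3)) :=
    fun t => h.integrable t.2
  let G : Icc (0 : ℝ) T → Lp ℝ 1 (volume.restrict (cell 3)) := fun t => (hint t).toL1 (f t)
  have hd : ∀ s t : Icc (0 : ℝ) T, dist (G t) (G s) = ∫ ξ in cell 3, |f t ξ - f s ξ| := by
    intro s t
    simp only [G]
    rw [dist_eq_norm, ← Integrable.toL1_sub, L1.norm_of_fun_eq_integral_norm]
    rfl
  have hG : Continuous G := by
    rw [continuous_iff_continuousAt]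
    intro s
    rw [ContinuousAt, tendsto_iff_edist_tendsto_0]
    have h1 := h.continuous s s.2
    have h2 : Tendsto (fun t => eLpNorm (f t - f s) 2 (volume.restrict (cell 3))
        * (volume.restrict (cell 3)) univ ^ (1 / (1 : ℝ≥0∞).toReal - 1 / (2 : ℝ≥0∞).toReal))
        (𝓝[Icc 0 T] s) (𝓝 0) := by
      have := ENNReal.Tendsto.mul_const (b := (volume.restrict (cell 3)) univ
        ^ (1 / (1 : ℝ≥0∞).toReal - 1 / (2 : ℝ≥0∞).toReal)) h1
        (Or.inr (ENNReal.rpow_ne_top_of_nonneg (by norm_num) (measure_ne_top _ _)))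
      simpa using this
    have h3 : Tendsto (fun t : Icc (0 : ℝ) T => eLpNorm (f t - f s) 2 (volume.restrict (cell 3))
        * (volume.restrict (cell 3)) univ ^ (1 / (1 : ℝ≥0∞).toReal - 1 / (2 : ℝ≥0∞).toReal))
        (𝓝 s) (𝓝 0) := by
      have := (tendsto_nhdsWithin_iff_subtype s.2 _ _).1 h2
      exact this
    refine tendsto_of_tendsto_of_tendsto_of_le_of_le tendsto_const_nhds h3
      (fun _ => bot_le) fun t => ?_
    simp only [G]
    rw [edist_dist, dist_eq_norm, ← Integrable.toL1_sub, ofReal_norm, Integrable.enorm_toL1,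
      ← eLpNorm_one_eq_lintegral_enorm]
    exact eLpNorm_le_eLpNorm_mul_rpow_measure_univ (by norm_num)
      ((h.integrable t.2).sub (h.integrable s.2)).aestronglyMeasurable
  have hu := CompactSpace.uniformContinuous_of_continuous hG
  intro ε hε
  obtain ⟨δ, hδ, H⟩ := Metric.uniformContinuous_iff.1 hu ε hε
  refine ⟨δ, hδ, fun s hs t ht hst => ?_⟩
  have := H (a := ⟨t, ht⟩) (b := ⟨s, hs⟩) hst
  rw [hd] at this
  exact this.le

/-- The spatial coordinates of a point of space-angle. -/
noncomputable def spatial (ξ : Fin 3 → ℝ) : Fin 2 → ℝ := ![ξ 0, ξ 1]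

lemma quasiMeasurePreserving_spatial : Measure.QuasiMeasurePreserving spatial volume volume := by
  have h1 := (volume_preserving_piFinSuccAbove (fun _ : Fin 3 => ℝ) 2).quasiMeasurePreserving
  have h2 : Measure.QuasiMeasurePreserving (Prod.snd : ℝ × (Fin 2 → ℝ) → Fin 2 → ℝ)
      volume volume := Measure.quasiMeasurePreserving_snd
  have h3 := h2.comp h1
  have e : spatial = Prod.snd ∘ MeasurableEquiv.piFinSuccAbove (fun _ : Fin 3 => ℝ) 2 := by
    funext ξ i
    fin_cases i <;> rfl
  rw [e]
  exact h3

/-- The bounds on the density, as a bound on the coefficient of the drift almost everywhere on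
space-angle. -/
lemma IsWeakSolution.ae_density (h : IsWeakSolution Pe De T f₀ f) :
    ∀ᵐ t ∂(volume.restrict (Ioo 0 T)), ∀ᵐ ξ ∂(volume.restrict (cell 3)),
      |1 - density (f t) ![ξ 0, ξ 1]| ≤ 1 := by
  have h1 := h.density_mem
  rw [Measure.volume_eq_prod, ← Measure.prod_restrict] at h1
  filter_upwards [Measure.ae_ae_of_ae_prod h1] with t ht
  rw [ae_restrict_iff' (measurableSet_cell 2)] at ht
  rw [ae_restrict_iff' (measurableSet_cell 3)]
  filter_upwards [quasiMeasurePreserving_spatial.ae ht] with ξ hξ hc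
  have hmem : spatial ξ ∈ cell 2 := by
    intro i _
    fin_cases i
    · exact hc 0 trivial
    · exact hc 1 trivial
  have := hξ hmem
  simp only [spatial] at this
  rw [abs_le]
  constructor <;> linarith [this.1, this.2]

/-- The diffusivities `(De, De, 1)` in the three coordinates. -/
def diffusivity (De : ℝ) : Fin 3 → ℝ := ![De, De, 1]

lemma diffusivity_pos {De : ℝ} (hDe : 0 < De) (i : Fin 3) : 0 < diffusivity De i := by
  fin_cases i
  · exact hDe
  · exact hDe
  · exact one_pos

/-- The elliptic operator `De Δ_x + ∂_θ²`. -/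
noncomputable def ellipticOp (De : ℝ) (v : (Fin 3 → ℝ) → ℝ) (ξ : Fin 3 → ℝ) : ℝ :=
  ∑ i, diffusivity De i *
    fderiv ℝ (fun ξ => fderiv ℝ v ξ (Pi.single i 1)) ξ (Pi.single i 1)

/-- A continuous periodic function is bounded. -/
lemma CellPeriodic.exists_bound {g : (Fin 3 → ℝ) → ℝ} (hp : CellPeriodic g) (hg : Continuous g) :
    ∃ B : ℝ, ∀ ξ, |g ξ| ≤ B := by
  obtain ⟨B, hB⟩ := (isCompact_Icc (a := fun _ : Fin 3 => (0 : ℝ))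
    (b := fun _ => 2 * Real.pi)).exists_bound_of_continuousOn hg.continuousOn
  have hpi : 0 < 2 * Real.pi := by positivity
  -- shift one coordinate at a time into the fundamental interval
  have hz : ∀ (i : Fin 3) (n : ℤ) (ξ : Fin 3 → ℝ),
      g (ξ + n • Pi.single i (2 * Real.pi)) = g ξ := by
    intro i n ξ
    exact Function.Periodic.zsmul (f := g) (c := Pi.single i (2 * Real.pi)) (fun ξ => hp ξ i) n ξ
  refine ⟨B, fun ξ => ?_⟩
  have key : ∃ ζ ∈ Icc (fun _ : Fin 3 => (0 : ℝ)) (fun _ => 2 * Real.pi), g ζ = g ξ := by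
    let n : Fin 3 → ℤ := fun i => -toIcoDiv hpi 0 (ξ i)
    refine ⟨ξ + n 0 • Pi.single 0 (2 * Real.pi) + n 1 • Pi.single 1 (2 * Real.pi)
      + n 2 • Pi.single 2 (2 * Real.pi), ?_, by rw [hz, hz, hz]⟩
    have hm : ∀ i, ξ i + n i • (2 * Real.pi) ∈ Icc 0 (2 * Real.pi) := by
      intro i
      have := toIcoMod_mem_Ico hpi 0 (ξ i)
      rw [toIcoMod, zero_add] at this
      simp only [n, neg_smul, ← sub_eq_add_neg]
      exact Ico_subset_Icc_self this
    constructor <;> intro i <;> fin_cases i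
    · simpa using (hm 0).1
    · simpa using (hm 1).1
    · simpa using (hm 2).1
    · simpa using (hm 0).2
    · simpa using (hm 1).2
    · simpa using (hm 2).2
  obtain ⟨ζ, hζ, e⟩ := key
  rw [← e]
  exact hB ζ hζ

/-- The weak formulation tested against a smooth periodic function on a time interval: up to the
drift, bounded by means of `|1 - ρ| ≤ 1`, the increment of the pairing is the integral of the
pairing with `De Δ_x v + ∂_θ² v`. -/
theorem IsWeakSolution.abs_increment_sub_le (h : IsWeakSolution Pe De T f₀ f)
    {v : (Fin 3 → ℝ) → ℝ} (hv : ContDiff ℝ ∞ v) (hvp : CellPeriodic v) {a b : ℝ}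
    (ha : 0 < a) (hab : a ≤ b) (hb : b < T) :
    |(∫ ξ in cell 3, f b ξ * v ξ) - (∫ ξ in cell 3, f a ξ * v ξ)
        - ∫ t in a..b, ∫ ξ in cell 3, f t ξ * ellipticOp De v ξ|
      ≤ |Pe| * ∫ t in a..b, ∫ ξ in cell 3, |f t ξ| *
          (|fderiv ℝ v ξ (Pi.single 0 1)| + |fderiv ℝ v ξ (Pi.single 1 1)|) := by
  obtain ⟨u, F, hu, hF, hweak⟩ := h.weak_form
  set J := smoothToH1 v hv hvp with hJ
  have hJv := h1Val_smoothToH1 hv hvp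
  have hJg := h1Grad_smoothToH1 hv hvp
  have hL := h.isL1Curve
  have hdc : ∀ i, Continuous fun ξ => fderiv ℝ v ξ (Pi.single i 1) := continuous_partial hv
  have hds : ∀ i, ContDiff ℝ ∞ fun ξ => fderiv ℝ v ξ (Pi.single i 1) := contDiff_partial hv
  have hdp : ∀ i, CellPeriodic fun ξ => fderiv ℝ v ξ (Pi.single i 1) := cellPeriodic_partial hvp
  have hddc : ∀ i, Continuous fun ξ =>
      fderiv ℝ (fun ξ => fderiv ℝ v ξ (Pi.single i 1)) ξ (Pi.single i 1) :=
    fun i => continuous_partial (hds i) i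
  have hddp : ∀ i, CellPeriodic fun ξ =>
      fderiv ℝ (fun ξ => fderiv ℝ v ξ (Pi.single i 1)) ξ (Pi.single i 1) :=
    fun i => cellPeriodic_partial (hdp i) i
  have hsub : Ioo a b ⊆ Ioo 0 T := Ioo_subset_Ioo ha.le hb.le
  have hsubc : Icc a b ⊆ Icc 0 T := Icc_subset_Icc ha.le hb.le
  -- the fundamental theorem of calculus for the pairing with `v`
  obtain ⟨Bv, hBv⟩ := hvp.exists_bound hv.continuous
  have hWc : ContinuousOn (fun t => ∫ ξ in cell 3, f t ξ * v ξ) (Icc 0 T) :=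
    continuousOn_integral_mul hL (IsUniformCurve.const _ hv.continuous hBv)
  have hFJ : IntegrableOn (fun t => F t J) (Ioo 0 T) := by
    have h1 : Integrable (fun t => ‖F t‖ * ‖J‖) (volume.restrict (Ioo 0 T)) :=
      (hF.memLp_norm.integrable (by norm_num)).mul_const _
    refine h1.mono' ?_ (Eventually.of_forall fun t => (F t).le_opNorm J)
    exact (ContinuousLinearMap.apply ℝ ℝ J).continuous.comp_aestronglyMeasurable hF.measurable
  have hFTC := sub_eq_intervalIntegral_of_weak_deriv hWc hFJ (fun η h1 h2 h3 => by
    rw [← hF.integral_eq η h1 h2 h3 J]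
    refine integral_congr_ae (Eventually.of_forall fun t => ?_)
    simp only
    congr 1
    refine integral_congr_ae ?_
    filter_upwards [hJv] with ξ hξ
    rw [hξ]) ha hab hb
  -- the weak formulation with test function `J` on `(a, b)`
  have hφ : MemLp ((Ioo a b).indicator fun _ => J) 2 (volume.restrict (Ioo 0 T)) :=
    (memLp_const J).indicator measurableSet_Ioo
  have hw := hweak _ hφ
  have hI : ∀ g : ℝ → ℝ, ∫ t in Ioo 0 T, (Ioo a b).indicator g t = ∫ t in Ioo a b, g t := by
    intro g
    rw [integral_indicator measurableSet_Ioo, Measure.restrict_restrict measurableSet_Ioo,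
      inter_eq_left.2 hsub]
  have hgrad : ∀ t, ∀ᵐ ξ ∂(volume.restrict (cell 3)), ∀ i,
      h1Grad ((Ioo a b).indicator (fun _ => J) t) ξ i
        = (Ioo a b).indicator (fun _ => fderiv ℝ v ξ (Pi.single i 1)) t := by
    intro t
    by_cases ht : t ∈ Ioo a b
    · simp only [indicator_of_mem ht]
      filter_upwards [hJg] with ξ hξ i
      rw [hξ]; rfl
    · simp only [indicator_of_notMem ht]
      filter_upwards [h1Grad_zero] with ξ hξ i
      rw [hξ]; rfl
  have w1 : ∫ t in Ioo 0 T, F t ((Ioo a b).indicator (fun _ => J) t) = ∫ t in Ioo a b, F t J := by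
    rw [← hI]
    refine integral_congr_ae (Eventually.of_forall fun t => ?_)
    by_cases ht : t ∈ Ioo a b
    · simp only [indicator_of_mem ht]
    · simp only [indicator_of_notMem ht, map_zero]
  set D : ℝ → ℝ := fun t => ∫ ξ in cell 3, (1 - density (f t) ![ξ 0, ξ 1]) * f t ξ *
    (Real.cos (ξ 2) * fderiv ℝ v ξ (Pi.single 0 1) + Real.sin (ξ 2) * fderiv ℝ v ξ (Pi.single 1 1))
    with hD
  have w2 : (∫ t in Ioo 0 T, ∫ ξ in cell 3, (1 - density (f t) ![ξ 0, ξ 1]) * f t ξ *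
      (Real.cos (ξ 2) * h1Grad ((Ioo a b).indicator (fun _ => J) t) ξ 0
        + Real.sin (ξ 2) * h1Grad ((Ioo a b).indicator (fun _ => J) t) ξ 1))
      = ∫ t in Ioo a b, D t := by
    rw [← hI]
    refine integral_congr_ae (Eventually.of_forall fun t => ?_)
    by_cases ht : t ∈ Ioo a b
    · simp only [indicator_of_mem ht, hD]
      refine integral_congr_ae ?_
      filter_upwards [hgrad t] with ξ hξ
      simp only [indicator_of_mem ht] at hξ
      rw [hξ 0, hξ 1]
    · simp only [indicator_of_notMem ht]
      refine integral_eq_zero_of_ae ?_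
      filter_upwards [hgrad t] with ξ hξ
      simp only [indicator_of_notMem ht] at hξ
      rw [hξ 0, hξ 1]; simp
  -- the pairing of the gradient of `f` with that of `v`
  have hgu : ∀ i, ∀ᵐ t ∂(volume.restrict (Ioo 0 T)),
      ∫ ξ in cell 3, h1Grad (u t) ξ i * fderiv ℝ v ξ (Pi.single i 1)
        = -∫ ξ in cell 3, f t ξ *
          fderiv ℝ (fun ξ => fderiv ℝ v ξ (Pi.single i 1)) ξ (Pi.single i 1) := by
    intro i
    filter_upwards [hu.ae_eq] with t ht
    rw [setIntegral_h1Grad_mul (u t) (hds i) (hdp i) i]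
    congr 1
    refine integral_congr_ae ?_
    filter_upwards [ht] with ξ hξ
    rw [hξ]
  set E : Fin 3 → ℝ → ℝ := fun i t => ∫ ξ in cell 3, f t ξ *
    fderiv ℝ (fun ξ => fderiv ℝ v ξ (Pi.single i 1)) ξ (Pi.single i 1) with hE
  have hEc : ∀ i, ContinuousOn (E i) (Icc 0 T) := by
    intro i
    obtain ⟨B, hB⟩ := (hddp i).exists_bound (hddc i)
    exact continuousOn_integral_mul hL (IsUniformCurve.const _ (hddc i) hB)
  have hEi : ∀ i, IntegrableOn (E i) (Ioo a b) := fun i =>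
    (((hEc i).mono hsubc).integrableOn_compact isCompact_Icc).mono_set Ioo_subset_Icc_self
  have hgi : ∀ t i, Integrable (fun ξ => h1Grad (u t) ξ i * fderiv ℝ v ξ (Pi.single i 1))
      (volume.restrict (cell 3)) := fun t i => integrable_coord_mul (h1Grad (u t)) (hds i) i
  have w3 : (∫ t in Ioo 0 T, ∫ ξ in cell 3,
      (h1Grad (u t) ξ 0 * h1Grad ((Ioo a b).indicator (fun _ => J) t) ξ 0
        + h1Grad (u t) ξ 1 * h1Grad ((Ioo a b).indicator (fun _ => J) t) ξ 1))
      = ∫ t in Ioo a b, -(E 0 t + E 1 t) := by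
    rw [← hI]
    refine integral_congr_ae ?_
    filter_upwards [hgu 0, hgu 1] with t h0 h1
    by_cases ht : t ∈ Ioo a b
    · simp only [indicator_of_mem ht]
      rw [neg_add, hE]
      simp only
      rw [← h0, ← h1, ← integral_add (hgi t 0) (hgi t 1)]
      refine integral_congr_ae ?_
      filter_upwards [hgrad t] with ξ hξ
      simp only [indicator_of_mem ht] at hξ
      rw [hξ 0, hξ 1]
    · simp only [indicator_of_notMem ht]
      refine integral_eq_zero_of_ae ?_
      filter_upwards [hgrad t] with ξ hξ
      simp only [indicator_of_notMem ht] at hξ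
      rw [hξ 0, hξ 1]; simp
  have w4 : (∫ t in Ioo 0 T, ∫ ξ in cell 3,
      h1Grad (u t) ξ 2 * h1Grad ((Ioo a b).indicator (fun _ => J) t) ξ 2)
      = ∫ t in Ioo a b, -E 2 t := by
    rw [← hI]
    refine integral_congr_ae ?_
    filter_upwards [hgu 2] with t h0
    by_cases ht : t ∈ Ioo a b
    · simp only [indicator_of_mem ht]
      rw [hE]
      simp only
      rw [← h0]
      refine integral_congr_ae ?_
      filter_upwards [hgrad t] with ξ hξ
      simp only [indicator_of_mem ht] at hξ
      rw [hξ 2]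
    · simp only [indicator_of_notMem ht]
      refine integral_eq_zero_of_ae ?_
      filter_upwards [hgrad t] with ξ hξ
      simp only [indicator_of_notMem ht] at hξ
      rw [hξ 2]; simp
  have hE01 : IntegrableOn (fun t => De * (E 0 t + E 1 t)) (Ioo a b) :=
    ((hEi 0).add (hEi 1)).const_mul De
  have hell : ∫ t in a..b, ∫ ξ in cell 3, f t ξ * ellipticOp De v ξ
      = De * (∫ t in Ioo a b, (E 0 t + E 1 t)) + ∫ t in Ioo a b, E 2 t := by
    rw [intervalIntegral.integral_of_le hab, integral_Ioc_eq_integral_Ioo, ← integral_const_mul,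
      ← integral_add hE01 (hEi 2)]
    refine setIntegral_congr_fun measurableSet_Ioo fun t ht => ?_
    have hft := h.integrable (Ioo_subset_Icc_self (hsub ht))
    have hi : ∀ i, IntegrableOn (fun ξ => f t ξ *
        fderiv ℝ (fun ξ => fderiv ℝ v ξ (Pi.single i 1)) ξ (Pi.single i 1)) (cell 3) := by
      intro i
      obtain ⟨B, hB⟩ := (hddp i).exists_bound (hddc i)
      exact integrableOn_mul_of_bound hft (hddc i) hB
    have hi01 := ((hi 0).add (hi 1)).const_mul De
    simp only [Pi.add_apply] at hi01
    simp only [hE]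
    rw [← integral_add (hi 0) (hi 1), ← integral_const_mul, ← integral_add hi01 (hi 2)]
    refine integral_congr_ae (Eventually.of_forall fun ξ => ?_)
    simp only [ellipticOp, diffusivity, Fin.sum_univ_three, Matrix.cons_val]
    ring
  have hmain : (∫ ξ in cell 3, f b ξ * v ξ) - (∫ ξ in cell 3, f a ξ * v ξ)
        - ∫ t in a..b, ∫ ξ in cell 3, f t ξ * ellipticOp De v ξ = Pe * ∫ t in Ioo a b, D t := by
    rw [hFTC, ← w1, hw, w2, w3, w4, hell, integral_neg, integral_neg]
    ring
  rw [hmain, abs_mul]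
  refine mul_le_mul_of_nonneg_left ?_ (abs_nonneg _)
  rw [intervalIntegral.integral_of_le hab, integral_Ioc_eq_integral_Ioo, ← Real.norm_eq_abs]
  have hmc : Continuous fun ξ =>
      |fderiv ℝ v ξ (Pi.single 0 1)| + |fderiv ℝ v ξ (Pi.single 1 1)| :=
    (hdc 0).abs.add (hdc 1).abs
  have hmp : CellPeriodic fun ξ =>
      |fderiv ℝ v ξ (Pi.single 0 1)| + |fderiv ℝ v ξ (Pi.single 1 1)| := by
    intro ξ i
    have h0 := hdp 0 ξ i
    have h1 := hdp 1 ξ i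
    simp only at h0 h1 ⊢
    rw [h0, h1]
  obtain ⟨Bm, hBm⟩ := hmp.exists_bound hmc
  have hmC := continuousOn_integral_mul hL.abs (IsUniformCurve.const _ hmc hBm)
  refine norm_integral_le_of_norm_le
    (((hmC.mono hsubc).integrableOn_compact isCompact_Icc).mono_set Ioo_subset_Icc_self) ?_
  have hρ := ae_mono (Measure.restrict_mono hsub (le_refl volume)) h.ae_density
  filter_upwards [hρ, ae_restrict_mem measurableSet_Ioo] with t ht hmem
  have hft := h.integrable (Ioo_subset_Icc_self (hsub hmem))
  refine norm_integral_le_of_norm_le (integrableOn_mul_of_bound hft.abs hmc hBm) ?_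
  filter_upwards [ht] with ξ hξ
  rw [Real.norm_eq_abs, abs_mul, abs_mul]
  refine mul_le_mul (mul_le_of_le_one_left (abs_nonneg _) hξ) ?_ (abs_nonneg _) (abs_nonneg _)
  refine (abs_add_le _ _).trans (add_le_add ?_ ?_)
  · rw [abs_mul]
    exact mul_le_of_le_one_left (abs_nonneg _) (Real.abs_cos_le_one _)
  · rw [abs_mul]
    exact mul_le_of_le_one_left (abs_nonneg _) (Real.abs_sin_le_one _)

/-! ### Duhamel's inequality -/

/-- Functions of `t₀ - t` and of `sinQuad d (ξ - z)` are uniform curves away from `t = t₀`. -/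
lemma isUniformCurve_sinQuad {d : Fin 3 → ℝ} (hd : ∀ i, 0 < d i) {G : ℝ × ℝ → ℝ}
    (hG : ContinuousOn G (Ioi 0 ×ˢ univ)) {s b t₀ : ℝ} (hbt : b < t₀) (z : Fin 3 → ℝ) :
    IsUniformCurve (Icc s b) fun t ξ => G (t₀ - t, sinQuad d (ξ - z)) := by
  set K : Set (ℝ × ℝ) := Icc (t₀ - b) (t₀ - s) ×ˢ Icc 0 (∑ i, 1 / d i) with hK
  have hKc : IsCompact K := isCompact_Icc.prod isCompact_Icc
  have hKG : ContinuousOn G K := hG.mono (prod_mono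
    (fun x hx => lt_of_lt_of_le (sub_pos.2 hbt) hx.1) (subset_univ _))
  have hmem : ∀ t ∈ Icc s b, ∀ ξ, (t₀ - t, sinQuad d (ξ - z)) ∈ K := fun t ht ξ =>
    ⟨⟨by linarith [ht.2], by linarith [ht.1]⟩, sinQuad_nonneg hd _, sinQuad_le hd _⟩
  refine ⟨fun t ht => ?_, ?_, ?_⟩
  · refine hKG.comp_continuous ?_ (hmem t ht)
    exact continuous_const.prodMk ((continuous_sinQuad d).comp (continuous_id.sub continuous_const))
  · obtain ⟨B, hB⟩ := hKc.exists_bound_of_continuousOn hKG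
    exact ⟨|B|, abs_nonneg _, fun t ht ξ => (hB _ (hmem t ht ξ)).trans (le_abs_self B)⟩
  · intro ε hε
    have hu := hKc.uniformContinuousOn_of_continuous hKG
    obtain ⟨δ, hδ, H⟩ := Metric.uniformContinuousOn_iff.1 hu ε hε
    refine ⟨δ, hδ, fun s' hs' t ht hst ξ => ?_⟩
    refine (H _ (hmem t ht ξ) _ (hmem s' hs' ξ) ?_).le
    rw [Prod.dist_eq, dist_self, max_eq_left dist_nonneg, Real.dist_eq]
    rw [show t₀ - t - (t₀ - s') = -(t - s') by ring, abs_neg]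
    exact hst

lemma isUniformCurve_parametrix {d : Fin 3 → ℝ} (hd : ∀ i, 0 < d i) {s b t₀ : ℝ} (hbt : b < t₀)
    (z : Fin 3 → ℝ) : IsUniformCurve (Icc s b) fun t ξ => parametrix d (t₀ - t) (ξ - z) := by
  refine isUniformCurve_sinQuad hd
    (G := fun p => p.1 ^ (-(3 / 2) : ℝ) * Real.exp (-(p.2 / p.1))) ?_ hbt z
  have h0 : ∀ p ∈ (Ioi (0 : ℝ) ×ˢ univ : Set (ℝ × ℝ)), p.1 ≠ 0 := fun p hp => (mem_Ioi.1 hp.1).ne'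
  refine ContinuousOn.mul (continuousOn_fst.rpow_const fun p hp => Or.inl (h0 p hp)) ?_
  exact Real.continuous_exp.comp_continuousOn (continuousOn_snd.div continuousOn_fst h0).neg

lemma isUniformCurve_parametrixDeriv {d : Fin 3 → ℝ} (hd : ∀ i, 0 < d i) {s b t₀ : ℝ}
    (hbt : b < t₀) (z : Fin 3 → ℝ) :
    IsUniformCurve (Icc s b) fun t ξ => -parametrixDeriv d (t₀ - t) (ξ - z) := by
  refine isUniformCurve_sinQuad hd (G := fun p => -((-(3 / (2 * p.1)) + p.2 / p.1 ^ 2) *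
    (p.1 ^ (-(3 / 2) : ℝ) * Real.exp (-(p.2 / p.1))))) ?_ hbt z
  have h0 : ∀ p ∈ (Ioi (0 : ℝ) ×ˢ univ : Set (ℝ × ℝ)), p.1 ≠ 0 := fun p hp => (mem_Ioi.1 hp.1).ne'
  refine (ContinuousOn.mul (ContinuousOn.add ?_ ?_) (ContinuousOn.mul
    (continuousOn_fst.rpow_const fun p hp => Or.inl (h0 p hp)) ?_)).neg
  · exact (continuousOn_const.div (continuousOn_const.mul continuousOn_fst)
      fun p hp => mul_ne_zero two_ne_zero (h0 p hp)).neg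
  · exact continuousOn_snd.div (continuousOn_fst.pow 2) fun p hp => pow_ne_zero 2 (h0 p hp)
  · exact Real.continuous_exp.comp_continuousOn (continuousOn_snd.div continuousOn_fst h0).neg

lemma isUniformCurve_majorant {d : Fin 3 → ℝ} (hd : ∀ i, 0 < d i) (C : ℝ) {s b t₀ : ℝ}
    (hbt : b < t₀) (z : Fin 3 → ℝ) :
    IsUniformCurve (Icc s b) fun t ξ => C * majorant d (t₀ - t) (ξ - z) := by
  refine isUniformCurve_sinQuad hd
    (G := fun p => C * ((p.1 ^ 2)⁻¹ * Real.exp (-(p.2 / (2 * p.1))))) ?_ hbt z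
  have h0 : ∀ p ∈ (Ioi (0 : ℝ) ×ˢ univ : Set (ℝ × ℝ)), p.1 ≠ 0 := fun p hp => (mem_Ioi.1 hp.1).ne'
  refine continuousOn_const.mul (ContinuousOn.mul
    ((continuousOn_fst.pow 2).inv₀ fun p hp => pow_ne_zero 2 (h0 p hp)) ?_)
  exact Real.continuous_exp.comp_continuousOn (continuousOn_snd.div
    (continuousOn_const.mul continuousOn_fst) fun p hp => mul_ne_zero two_ne_zero (h0 p hp)).neg

/-- The constant in the Duhamel inequality: the first term comes from the defect of the
parametrix, the second one from the drift. -/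
noncomputable def duhamelConst (Pe De T : ℝ) : ℝ :=
  9 * (∑ i, diffusivity De i) * T ^ (1 / 2 : ℝ) + |Pe| * (2 * (1 + 1 / De))

/-- Duhamel's inequality for weak solutions, with the parametrix in place of the heat kernel. The
pole `t₀` is strictly later than the final time `b`, which keeps the test function smooth. -/
theorem IsWeakSolution.duhamel (h : IsWeakSolution Pe De T f₀ f) (hDe : 0 < De) {s b t₀ : ℝ}
    (hs : 0 < s) (hsb : s ≤ b) (hbt : b < t₀) (ht : t₀ ≤ T) (z : Fin 3 → ℝ) :
    |∫ ξ in cell 3, f b ξ * parametrix (diffusivity De) (t₀ - b) (ξ - z)|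
      ≤ |∫ ξ in cell 3, f s ξ * parametrix (diffusivity De) (t₀ - s) (ξ - z)|
        + ∫ τ in s..b, ∫ ξ in cell 3, |f τ ξ| *
          (duhamelConst Pe De T * majorant (diffusivity De) (t₀ - τ) (ξ - z)) := by
  set d := diffusivity De with hd'
  set C := duhamelConst Pe De T with hC
  have hd : ∀ i, 0 < d i := diffusivity_pos hDe
  have hbT : b < T := hbt.trans_le ht
  have hI : Icc s b ⊆ Icc 0 T := Icc_subset_Icc hs.le hbT.le
  have hL : IsL1Curve (Icc s b) f := h.isL1Curve.mono hI
  have key := abs_pairing_sub_le hsb hL (isUniformCurve_parametrix hd hbt z)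
    (isUniformCurve_parametrixDeriv hd hbt z) (isUniformCurve_majorant hd C hbt z) ?_ ?_
  · have := abs_sub_abs_le_abs_sub
      (∫ ξ in cell 3, f b ξ * parametrix d (t₀ - b) (ξ - z))
      (∫ ξ in cell 3, f s ξ * parametrix d (t₀ - s) (ξ - z))
    linarith
  · intro ξ t ht'
    have h1 := hasDerivAt_parametrix d (show 0 < t₀ - t by linarith [ht'.2]) (ξ - z)
    have h2 := HasDerivAt.scomp t h1 ((hasDerivAt_id t).const_sub t₀)
    simp only [neg_smul, one_smul] at h2
    exact h2
  · intro x hx y hy hxy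
    have hσ : 0 < t₀ - x := by linarith [hx.2]
    have hσT : t₀ - x ≤ T := by linarith [hx.1]
    set v := fun ξ => parametrix d (t₀ - x) (ξ - z) with hv
    have hvs : ContDiff ℝ ∞ v := contDiff_parametrix d _ z
    have hvp : CellPeriodic v := cellPeriodic_parametrix d _ z
    have hw := h.abs_increment_sub_le hvs hvp (hs.trans_le hx.1) hxy (hy.2.trans_lt hbT)
    have hLx : IsL1Curve (Icc x y) f := hL.mono (Icc_subset_Icc hx.1 hy.2)
    have hii : ∀ (G : ℝ → ℝ), ContinuousOn G (Icc x y) → IntervalIntegrable G volume x y := by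
      intro G hG
      exact (by rwa [uIcc_of_le hxy] : ContinuousOn G (uIcc x y)).intervalIntegrable
    -- continuity and bounds of the functions of `ξ` involved
    have hec : Continuous (ellipticOp De v) :=
      continuous_finsetSum _ fun i _ => continuous_const.mul
        (continuous_partial (contDiff_partial hvs i) i)
    have hep : CellPeriodic (ellipticOp De v) := by
      intro ξ j
      refine Finset.sum_congr rfl fun i _ => ?_
      exact congrArg (diffusivity De i * ·)
        (cellPeriodic_partial (cellPeriodic_partial hvp i) i ξ j)
    obtain ⟨Be, hBe⟩ := hep.exists_bound hec
    have hφ' := isUniformCurve_parametrixDeriv (s := s) hd hbt z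
    have hm := isUniformCurve_majorant (s := s) hd 1 hbt z
    obtain ⟨Bp, -, hBp⟩ := hφ'.bound
    obtain ⟨Bm, -, hBm⟩ := hm.bound
    have hmc := hm.cont x hx
    have hmb := hBm x hx
    simp only [one_mul] at hmc hmb
    have c1 := hii _ (continuousOn_integral_mul hLx (IsUniformCurve.const _ hec hBe))
    have c2 := hii _ (continuousOn_integral_mul hLx
      (IsUniformCurve.const _ (hφ'.cont x hx) (hBp x hx)))
    have c3 := hii _ (continuousOn_integral_mul hLx.abs (IsUniformCurve.const _ hmc hmb))
    set X := (∫ ξ in cell 3, f y ξ * v ξ) - ∫ ξ in cell 3, f x ξ * v ξ with hX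
    set mj := fun ξ => majorant d (t₀ - x) (ξ - z) with hmj
    set M := ∫ τ in x..y, ∫ ξ in cell 3, |f τ ξ| * mj ξ with hM
    -- the drift
    have b1 : ∫ t in x..y, ∫ ξ in cell 3, |f t ξ| *
          (|fderiv ℝ v ξ (Pi.single 0 1)| + |fderiv ℝ v ξ (Pi.single 1 1)|)
        ≤ 2 * (1 + 1 / De) * M := by
      rw [hM, ← intervalIntegral.integral_const_mul]
      have hgp : CellPeriodic fun ξ =>
          |fderiv ℝ v ξ (Pi.single 0 1)| + |fderiv ℝ v ξ (Pi.single 1 1)| := by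
        intro ξ i
        have h0 := cellPeriodic_partial hvp 0 ξ i
        have h1 := cellPeriodic_partial hvp 1 ξ i
        simp only at h0 h1 ⊢
        rw [h0, h1]
      have hgc : Continuous fun ξ =>
          |fderiv ℝ v ξ (Pi.single 0 1)| + |fderiv ℝ v ξ (Pi.single 1 1)| :=
        (continuous_partial hvs 0).abs.add (continuous_partial hvs 1).abs
      obtain ⟨Bg, hBg⟩ := hgp.exists_bound hgc
      refine intervalIntegral.integral_mono_on hxy
        (hii _ (continuousOn_integral_mul hLx.abs (IsUniformCurve.const _ hgc hBg)))
        (c3.const_mul _) fun τ hτ => ?_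
      have hfτ := (hLx.integrable τ hτ).abs
      rw [← integral_const_mul]
      refine integral_mono (integrableOn_mul_of_bound hfτ hgc hBg)
        ((integrableOn_mul_of_bound hfτ hmc hmb).const_mul _) fun ξ => ?_
      have g0 := abs_fderiv_parametrix_le hd hσ z ξ 0
      have g1 := abs_fderiv_parametrix_le hd hσ z ξ 1
      have e0 : d 0 = De := rfl
      have e1 : d 1 = De := rfl
      rw [e0] at g0
      rw [e1] at g1
      calc _ ≤ |f τ ξ| * ((1 + 1 / De) * mj ξ + (1 + 1 / De) * mj ξ) :=
            mul_le_mul_of_nonneg_left (add_le_add g0 g1) (abs_nonneg _)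
        _ = _ := by ring
    -- the defect of the parametrix
    have b2 : |(∫ τ in x..y, ∫ ξ in cell 3, f τ ξ * ellipticOp De v ξ)
        + ∫ τ in x..y, ∫ ξ in cell 3, f τ ξ * -parametrixDeriv d (t₀ - x) (ξ - z)|
        ≤ 9 * (∑ i, d i) * T ^ (1 / 2 : ℝ) * M := by
      rw [← intervalIntegral.integral_add c1 c2, hM, ← intervalIntegral.integral_const_mul,
        ← Real.norm_eq_abs]
      refine intervalIntegral.norm_integral_le_of_norm_le hxy ?_ (c3.const_mul _)
      refine Eventually.of_forall fun τ hτ => ?_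
      have hfτ := hLx.integrable τ (Ioc_subset_Icc_self hτ)
      rw [← integral_add (integrableOn_mul_of_bound hfτ hec hBe)
        (integrableOn_mul_of_bound hfτ (hφ'.cont x hx) (hBp x hx)), ← integral_const_mul]
      refine norm_integral_le_of_norm_le
        ((integrableOn_mul_of_bound hfτ.abs hmc hmb).const_mul _) (Eventually.of_forall fun ξ => ?_)
      have hdef := abs_parametrix_defect_le hd hσ hσT z ξ
      have e : f τ ξ * ellipticOp De v ξ + f τ ξ * -parametrixDeriv d (t₀ - x) (ξ - z)
          = -(f τ ξ * (parametrixDeriv d (t₀ - x) (ξ - z) - ellipticOp De v ξ)) := by ring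
      rw [e, norm_neg, Real.norm_eq_abs, abs_mul]
      calc _ ≤ |f τ ξ| * (9 * (∑ i, d i) * T ^ (1 / 2 : ℝ) * mj ξ) :=
            mul_le_mul_of_nonneg_left hdef (abs_nonneg _)
        _ = _ := by ring
    have b3 : ∫ τ in x..y, ∫ ξ in cell 3, |f τ ξ| * (C * majorant d (t₀ - x) (ξ - z)) = C * M := by
      rw [hM, ← intervalIntegral.integral_const_mul]
      refine intervalIntegral.integral_congr fun τ _ => ?_
      refine Eq.trans ?_ (integral_const_mul C _)
      refine integral_congr_ae (Eventually.of_forall fun ξ => ?_)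
      simp only [hmj]
      ring
    rw [b3]
    set P := ∫ τ in x..y, ∫ ξ in cell 3, f τ ξ * ellipticOp De v ξ
    set R := ∫ τ in x..y, ∫ ξ in cell 3, f τ ξ * -parametrixDeriv d (t₀ - x) (ξ - z)
    calc |X + R| = |(X - P) + (P + R)| := by congr 1; ring
      _ ≤ |X - P| + |P + R| := abs_add_le _ _
      _ ≤ |Pe| * (2 * (1 + 1 / De) * M) + 9 * (∑ i, d i) * T ^ (1 / 2 : ℝ) * M :=
          add_le_add (hw.trans (mul_le_mul_of_nonneg_left b1 (abs_nonneg _))) b2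
      _ = C * M := by rw [hC, duhamelConst]; ring

/-! ### The parametrix as an approximate identity -/

/-- The total mass of the parametrix over a period cell. -/
noncomputable def parametrixMass (d : Fin 3 → ℝ) (ε : ℝ) : ℝ := ∫ ξ in cell 3, parametrix d ε ξ

/-- Convolution over the cell with the parametrix, normalised to have unit mass. -/
noncomputable def smoothing (d : Fin 3 → ℝ) (ε : ℝ) (g : (Fin 3 → ℝ) → ℝ) (z : Fin 3 → ℝ) : ℝ :=
  (parametrixMass d ε)⁻¹ * ∫ ξ in cell 3, g ξ * parametrix d ε (ξ - z)

variable {d : Fin 3 → ℝ}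

lemma continuous_parametrix (d : Fin 3 → ℝ) (ε : ℝ) : Continuous (parametrix d ε) := by
  simpa using (contDiff_parametrix d ε 0).continuous

lemma setIntegral_parametrix (d z : Fin 3 → ℝ) (ε : ℝ) :
    ∫ ξ in cell 3, parametrix d ε (ξ - z)
      = ε ^ (-(3 / 2) : ℝ) * ∫ ξ in cell 3, Real.exp (-(1 / ε * sinQuad d (ξ - z))) := by
  rw [← integral_const_mul]
  refine integral_congr_ae (Eventually.of_forall fun ξ => ?_)
  simp only [parametrix]
  rw [one_div_mul_eq_div]

lemma setIntegral_parametrix_eq_mass (d z : Fin 3 → ℝ) (ε : ℝ) :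
    ∫ ξ in cell 3, parametrix d ε (ξ - z) = parametrixMass d ε := by
  have h0 := setIntegral_parametrix d 0 ε
  rw [setIntegral_exp_sinQuad] at h0
  simp only [sub_zero] at h0
  rw [setIntegral_parametrix, setIntegral_exp_sinQuad, parametrixMass, h0]

lemma exists_le_parametrixMass (hd : ∀ i, 0 < d i) :
    ∃ c : ℝ, 0 < c ∧ ∃ ε₀ : ℝ, 0 < ε₀ ∧ ∀ ε ∈ Ioo 0 ε₀, c ≤ parametrixMass d ε := by
  obtain ⟨c, hc, h⟩ := exists_le_setIntegral_exp_sinQuad hd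
  have hD : 0 < ∑ i, d i := Finset.sum_pos (fun i _ => hd i) ⟨0, Finset.mem_univ _⟩
  refine ⟨c, hc, 1 / ∑ i, d i, by positivity, fun ε hε => ?_⟩
  have hε0 := hε.1
  have h1 := h 0 (1 / ε) (by rw [le_div_iff₀ hε.1, mul_comm, ← le_div_iff₀ hD]; exact hε.2.le)
  rw [← setIntegral_parametrix_eq_mass d 0, setIntegral_parametrix]
  have h2 : 0 < ε ^ (-(3 / 2) : ℝ) := Real.rpow_pos_of_pos hε.1 _
  calc c = ε ^ (-(3 / 2) : ℝ) * (c * (1 / ε) ^ (-(3 / 2) : ℝ)) := by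
        rw [one_div, Real.inv_rpow hε.1.le]
        field_simp
    _ ≤ _ := by gcongr

lemma parametrixMass_pos (d : Fin 3 → ℝ) {ε : ℝ} (hε : 0 < ε) : 0 < parametrixMass d ε := by
  rw [← setIntegral_parametrix_eq_mass d 0, setIntegral_parametrix, setIntegral_exp_sinQuad]
  refine mul_pos (Real.rpow_pos_of_pos hε _) (Finset.prod_pos fun i _ => ?_)
  refine intervalIntegral.intervalIntegral_pos_of_pos (Continuous.intervalIntegrable (by fun_prop)
    _ _) (fun x => Real.exp_pos _) (by linarith [Real.pi_pos])

lemma integrableOn_mul_parametrix (hd : ∀ i, 0 < d i) {ε : ℝ} (hε : 0 < ε)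
    {g : (Fin 3 → ℝ) → ℝ} (hg : IntegrableOn g (cell 3)) (z : Fin 3 → ℝ) :
    IntegrableOn (fun ξ => g ξ * parametrix d ε (ξ - z)) (cell 3) :=
  integrableOn_mul_of_bound hg ((continuous_parametrix d ε).comp
    (continuous_id.sub continuous_const))
    fun ξ => by
      rw [abs_of_pos (parametrix_pos d hε _)]
      exact parametrix_le hd hε _

lemma smoothing_sub (hd : ∀ i, 0 < d i) {ε : ℝ} (hε : 0 < ε) {g h : (Fin 3 → ℝ) → ℝ}
    (hg : IntegrableOn g (cell 3)) (hh : IntegrableOn h (cell 3)) (z : Fin 3 → ℝ) :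
    smoothing d ε (g - h) z = smoothing d ε g z - smoothing d ε h z := by
  simp only [smoothing, Pi.sub_apply, sub_mul]
  rw [integral_sub (integrableOn_mul_parametrix hd hε hg z)
    (integrableOn_mul_parametrix hd hε hh z), mul_sub]

lemma aestronglyMeasurable_kernel_mul (d : Fin 3 → ℝ) (ε : ℝ) {g : (Fin 3 → ℝ) → ℝ}
    (hg : IntegrableOn g (cell 3)) :
    AEStronglyMeasurable (fun p : (Fin 3 → ℝ) × (Fin 3 → ℝ) => g p.2 * parametrix d ε (p.2 - p.1))
      ((volume.restrict (cell 3)).prod (volume.restrict (cell 3))) :=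
  hg.aestronglyMeasurable.comp_snd.mul
    ((continuous_parametrix d ε).comp (continuous_snd.sub continuous_fst)).aestronglyMeasurable

lemma aestronglyMeasurable_smoothing (d : Fin 3 → ℝ) (ε : ℝ) {g : (Fin 3 → ℝ) → ℝ}
    (hg : IntegrableOn g (cell 3)) :
    AEStronglyMeasurable (smoothing d ε g) (volume.restrict (cell 3)) :=
  (aestronglyMeasurable_kernel_mul d ε hg).integral_prod_right'.const_mul _

/-- The smoothing operators are contractions of `L¹`. -/
lemma lintegral_smoothing_le {ε : ℝ} (hε : 0 < ε) {g : (Fin 3 → ℝ) → ℝ}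
    (hg : IntegrableOn g (cell 3)) :
    ∫⁻ z in cell 3, ‖smoothing d ε g z‖ₑ ≤ ∫⁻ ξ in cell 3, ‖g ξ‖ₑ := by
  have hm := parametrixMass_pos d hε
  have hK : ∀ ξ, ∫⁻ z in cell 3, ‖g ξ * parametrix d ε (ξ - z)‖ₑ
      = ENNReal.ofReal (parametrixMass d ε) * ‖g ξ‖ₑ := by
    intro ξ
    have hc : Continuous fun z => parametrix d ε (z - ξ) :=
      (continuous_parametrix d ε).comp (continuous_id.sub continuous_const)
    have e : ∀ z, ‖g ξ * parametrix d ε (ξ - z)‖ₑ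
        = ‖g ξ‖ₑ * ENNReal.ofReal (parametrix d ε (z - ξ)) := by
      intro z
      rw [enorm_mul, Real.enorm_eq_ofReal (parametrix_pos d hε _).le]
      congr 2
      simp only [parametrix, sinQuad_sub_comm d ξ z]
    simp only [e]
    rw [lintegral_const_mul _ hc.measurable.ennreal_ofReal, mul_comm,
      ← ofReal_integral_eq_lintegral_ofReal
        ((memLp_cell_of_continuous hc).integrable (by norm_num))
        (Eventually.of_forall fun _ => (parametrix_pos d hε _).le),
      setIntegral_parametrix_eq_mass]
  calc ∫⁻ z in cell 3, ‖smoothing d ε g z‖ₑ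
      ≤ ∫⁻ z in cell 3, ENNReal.ofReal (parametrixMass d ε)⁻¹ *
          ∫⁻ ξ in cell 3, ‖g ξ * parametrix d ε (ξ - z)‖ₑ := by
        refine lintegral_mono fun z => ?_
        rw [smoothing, enorm_mul, Real.enorm_eq_ofReal (inv_nonneg.2 hm.le)]
        gcongr
        exact enorm_integral_le_lintegral_enorm _
    _ = ENNReal.ofReal (parametrixMass d ε)⁻¹ *
          ∫⁻ z in cell 3, ∫⁻ ξ in cell 3, ‖g ξ * parametrix d ε (ξ - z)‖ₑ :=
        lintegral_const_mul' _ _ ENNReal.ofReal_ne_top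
    _ = ENNReal.ofReal (parametrixMass d ε)⁻¹ *
          ∫⁻ ξ in cell 3, ENNReal.ofReal (parametrixMass d ε) * ‖g ξ‖ₑ := by
        rw [lintegral_lintegral_swap (aestronglyMeasurable_kernel_mul d ε hg).enorm]
        simp only [hK]
    _ = ∫⁻ ξ in cell 3, ‖g ξ‖ₑ := by
        rw [lintegral_const_mul' _ _ ENNReal.ofReal_ne_top, ← mul_assoc,
          ← ENNReal.ofReal_mul (inv_nonneg.2 hm.le), inv_mul_cancel₀ hm.ne', ENNReal.ofReal_one,
          one_mul]

/-- The form `sinQuad d (ξ - z)` vanishes on the closed cell only at `ξ = z`, because `z` is in the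
open cell. -/
lemma sinQuad_sub_pos (hd : ∀ i, 0 < d i) {z ξ : Fin 3 → ℝ} (hz : z ∈ cell 3)
    (hξ : ξ ∈ Icc (fun _ : Fin 3 => (0 : ℝ)) (fun _ => 2 * Real.pi)) (hne : ξ ≠ z) :
    0 < sinQuad d (ξ - z) := by
  obtain ⟨i, hi⟩ := Function.ne_iff.1 hne
  refine lt_of_lt_of_le ?_ (sin_half_sq_div_le hd (ξ - z) i)
  have hzi := hz i trivial
  have h1 := hξ.1 i
  have h2 := hξ.2 i
  simp only at h1 h2
  have hs : Real.sin ((ξ - z) i / 2) ≠ 0 := by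
    intro h0
    rw [Real.sin_eq_zero_iff_of_lt_of_lt (by simp only [Pi.sub_apply]; linarith [hzi.2])
      (by simp only [Pi.sub_apply]; linarith [hzi.1])] at h0
    simp only [Pi.sub_apply] at h0
    exact hi (by linarith)
  have := hd i
  positivity

lemma tendsto_smoothing_of_continuous (hd : ∀ i, 0 < d i) {φ : (Fin 3 → ℝ) → ℝ}
    (hφ : Continuous φ) {z : Fin 3 → ℝ} (hz : z ∈ cell 3) :
    Tendsto (fun ε => smoothing d ε φ z) (𝓝[>] 0) (𝓝 (φ z)) := by
  obtain ⟨c, hc, ε₀, hε₀, hmass⟩ := exists_le_parametrixMass hd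
  have key := tendsto_setIntegral_peak_smul_of_integrableOn_of_tendsto (μ := volume)
    (φ := fun ε ξ => (parametrixMass d ε)⁻¹ * parametrix d ε (ξ - z)) (g := φ) (l := 𝓝[>] 0)
    (x₀ := z) (a := φ z) (s := cell 3) (t := cell 3)
    (measurableSet_cell 3) (measurableSet_cell 3) subset_rfl self_mem_nhdsWithin
    (volume_cell_ne_top 3) ?_ ?_ ?_ ?_ ?_ ?_
  · refine key.congr fun ε => ?_
    rw [smoothing, ← integral_const_mul]
    refine integral_congr_ae (Eventually.of_forall fun ξ => ?_)
    simp only [smul_eq_mul]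
    ring
  · filter_upwards [self_mem_nhdsWithin] with ε hε ξ _
    exact mul_nonneg (inv_nonneg.2 (parametrixMass_pos d hε).le) (parametrix_pos d hε _).le
  · intro u hu hzu
    have hK : IsCompact (Icc (fun _ : Fin 3 => (0 : ℝ)) (fun _ => 2 * Real.pi) \ u) :=
      isCompact_Icc.diff hu
    obtain ⟨m, hm, hmin⟩ := hK.exists_forall_le' (f := fun ξ => sinQuad d (ξ - z)) (a := 0)
      ((continuous_sinQuad d).comp (continuous_id.sub continuous_const)).continuousOn
      (fun ξ hξ => sinQuad_sub_pos hd hz hξ.1 fun e => hξ.2 (e ▸ hzu))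
    have hlim : Tendsto (fun ε : ℝ => c⁻¹ * (ε⁻¹ ^ (3 / 2 : ℝ) * Real.exp (-m * ε⁻¹))) (𝓝[>] 0)
        (𝓝 (c⁻¹ * 0)) :=
      ((tendsto_rpow_mul_exp_neg_mul_atTop_nhds_zero (3 / 2) m hm).comp
        tendsto_inv_nhdsGT_zero).const_mul _
    rw [mul_zero] at hlim
    rw [Metric.tendstoUniformlyOn_iff]
    intro r hr
    filter_upwards [hlim.eventually (gt_mem_nhds hr), Ioo_mem_nhdsGT hε₀] with ε h1 hε ξ hξ
    have hε0 : 0 < ε := hε.1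
    have hmp := parametrixMass_pos d hε0
    have hp := parametrix_pos d hε0 (ξ - z)
    rw [Pi.zero_apply, dist_zero_left, Real.norm_of_nonneg (by positivity)]
    refine lt_of_le_of_lt ?_ h1
    have hξm : m ≤ sinQuad d (ξ - z) := hmin ξ
      ⟨⟨fun i => (hξ.1 i trivial).1.le, fun i => (hξ.1 i trivial).2.le⟩, hξ.2⟩
    refine mul_le_mul (inv_anti₀ hc (hmass ε hε)) ?_ hp.le (inv_nonneg.2 hc.le)
    rw [parametrix, Real.rpow_neg hε0.le, Real.inv_rpow hε0.le]
    gcongr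
    rw [neg_mul, neg_le_neg_iff, ← div_eq_mul_inv]
    gcongr
  · refine tendsto_const_nhds.congr' ?_
    filter_upwards [self_mem_nhdsWithin] with ε hε
    rw [integral_const_mul, setIntegral_parametrix_eq_mass,
      inv_mul_cancel₀ (parametrixMass_pos d hε).ne']
  · refine Eventually.of_forall fun ε => ?_
    exact (continuous_const.mul ((continuous_parametrix d ε).comp
      (continuous_id.sub continuous_const))).aestronglyMeasurable
  · exact (memLp_cell_of_continuous hφ).integrable (by norm_num)
  · exact hφ.continuousAt.continuousWithinAt

lemma abs_smoothing_le {ε : ℝ} (hε : 0 < ε) {φ : (Fin 3 → ℝ) → ℝ} {B : ℝ}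
    (hB : ∀ ξ, |φ ξ| ≤ B) (z : Fin 3 → ℝ) : |smoothing d ε φ z| ≤ B := by
  have hm := parametrixMass_pos d hε
  have hc : Continuous fun ξ => parametrix d ε (ξ - z) :=
    (continuous_parametrix d ε).comp (continuous_id.sub continuous_const)
  have hi : IntegrableOn (fun ξ => parametrix d ε (ξ - z)) (cell 3) :=
    (memLp_cell_of_continuous hc).integrable (by norm_num)
  have h1 : |∫ ξ in cell 3, φ ξ * parametrix d ε (ξ - z)| ≤ B * parametrixMass d ε := by
    rw [← setIntegral_parametrix_eq_mass d z, ← integral_const_mul, ← Real.norm_eq_abs]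
    refine norm_integral_le_of_norm_le (hi.const_mul B) (Eventually.of_forall fun ξ => ?_)
    rw [norm_mul, Real.norm_eq_abs, Real.norm_of_nonneg (parametrix_pos d hε _).le]
    exact mul_le_mul_of_nonneg_right (hB ξ) (parametrix_pos d hε _).le
  rw [smoothing, abs_mul, abs_of_pos (inv_pos.2 hm), inv_mul_le_iff₀ hm, mul_comm]
  exact h1

/-- The smoothing operators converge strongly to the identity in `L¹`, and the function to which
they are applied may vary. -/
theorem tendsto_lintegral_smoothing_sub (hd : ∀ i, 0 < d i) {g : (Fin 3 → ℝ) → ℝ}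
    (hg : IntegrableOn g (cell 3)) {h : ℕ → (Fin 3 → ℝ) → ℝ}
    (hh : ∀ n, IntegrableOn (h n) (cell 3))
    (hlim : Tendsto (fun n => ∫⁻ ξ in cell 3, ‖h n ξ - g ξ‖ₑ) atTop (𝓝 0)) {ε : ℕ → ℝ}
    (hε : ∀ n, 0 < ε n) (hε0 : Tendsto ε atTop (𝓝 0)) :
    Tendsto (fun n => ∫⁻ z in cell 3, ‖smoothing d (ε n) (h n) z - g z‖ₑ) atTop (𝓝 0) := by
  have hε0' : Tendsto ε atTop (𝓝[>] 0) :=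
    tendsto_nhdsWithin_iff.2 ⟨hε0, Eventually.of_forall hε⟩
  rw [ENNReal.tendsto_nhds_zero] at hlim ⊢
  intro r hr
  have hr4 : r / 4 ≠ 0 := (ENNReal.div_pos hr.ne' (by norm_num)).ne'
  obtain ⟨φ, hφs, hφ1, hφc, hφi⟩ := Integrable.exists_hasCompactSupport_lintegral_sub_le hg hr4
  obtain ⟨B, hB⟩ := hφs.exists_bound_of_continuous hφc
  have hφt : Tendsto (fun n => ∫⁻ z in cell 3, ‖smoothing d (ε n) φ z - φ z‖ₑ) atTop (𝓝 0) := by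
    have := tendsto_lintegral_of_dominated_convergence' (μ := volume.restrict (cell 3))
      (F := fun n z => ‖smoothing d (ε n) φ z - φ z‖ₑ) (f := fun _ => 0)
      (fun _ => ENNReal.ofReal (2 * B)) ?_ ?_ ?_ ?_
    · simpa using this
    · intro n
      exact ((aestronglyMeasurable_smoothing d (ε n) hφi).sub hφc.aestronglyMeasurable).enorm
    · refine fun n => Eventually.of_forall fun z => ?_
      beta_reduce
      rw [← ofReal_norm]
      refine ENNReal.ofReal_le_ofReal ?_
      have h1 := abs_smoothing_le (d := d) (hε n) hB z
      have h2 := hB z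
      rw [Real.norm_eq_abs] at h2 ⊢
      exact (abs_sub _ _).trans (by linarith)
    · rw [lintegral_const]
      exact ENNReal.mul_ne_top ENNReal.ofReal_ne_top (measure_ne_top _ _)
    · filter_upwards [ae_restrict_mem (measurableSet_cell 3)] with z hz
      have h1 := ((tendsto_smoothing_of_continuous hd hφc hz).comp hε0').sub_const (φ z)
      rw [sub_self] at h1
      have h2 := h1.enorm
      rw [enorm_zero] at h2
      exact h2
  rw [ENNReal.tendsto_nhds_zero] at hφt
  filter_upwards [hlim (r / 4) (pos_iff_ne_zero.2 hr4), hφt (r / 4) (pos_iff_ne_zero.2 hr4)]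
    with n h1 h2
  have hgi : IntegrableOn (h n - g) (cell 3) := (hh n).sub hg
  have hgφ : IntegrableOn (g - φ) (cell 3) := hg.sub hφi
  have m1 := (aestronglyMeasurable_smoothing d (ε n) hgi).enorm
  have m2 := (aestronglyMeasurable_smoothing d (ε n) hgφ).enorm
  have m3 : AEMeasurable (fun z => ‖smoothing d (ε n) φ z - φ z‖ₑ) (volume.restrict (cell 3)) :=
    ((aestronglyMeasurable_smoothing d (ε n) hφi).sub hφc.aestronglyMeasurable).enorm
  have m12 : AEMeasurable (fun z => ‖smoothing d (ε n) (h n - g) z‖ₑ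
      + ‖smoothing d (ε n) (g - φ) z‖ₑ) (volume.restrict (cell 3)) := m1.add m2
  have m123 : AEMeasurable (fun z => ‖smoothing d (ε n) (h n - g) z‖ₑ
      + ‖smoothing d (ε n) (g - φ) z‖ₑ + ‖smoothing d (ε n) φ z - φ z‖ₑ)
      (volume.restrict (cell 3)) := m12.add m3
  calc ∫⁻ z in cell 3, ‖smoothing d (ε n) (h n) z - g z‖ₑ
      ≤ ∫⁻ z in cell 3, (‖smoothing d (ε n) (h n - g) z‖ₑ + ‖smoothing d (ε n) (g - φ) z‖ₑ
          + ‖smoothing d (ε n) φ z - φ z‖ₑ + ‖g z - φ z‖ₑ) := by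
        refine lintegral_mono fun z => ?_
        rw [smoothing_sub hd (hε n) (hh n) hg, smoothing_sub hd (hε n) hg hφi]
        have e : smoothing d (ε n) (h n) z - g z
            = (smoothing d (ε n) (h n) z - smoothing d (ε n) g z)
              + (smoothing d (ε n) g z - smoothing d (ε n) φ z)
              + (smoothing d (ε n) φ z - φ z) - (g z - φ z) := by ring
        rw [e]
        refine (enorm_sub_le).trans ?_
        gcongr
        refine (enorm_add_le _ _).trans ?_
        gcongr
        exact enorm_add_le _ _
    _ = (∫⁻ z in cell 3, ‖smoothing d (ε n) (h n - g) z‖ₑ)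
          + (∫⁻ z in cell 3, ‖smoothing d (ε n) (g - φ) z‖ₑ)
          + (∫⁻ z in cell 3, ‖smoothing d (ε n) φ z - φ z‖ₑ)
          + ∫⁻ z in cell 3, ‖g z - φ z‖ₑ := by
        rw [lintegral_add_left' m123, lintegral_add_left' m12,
          lintegral_add_left' m1]
    _ ≤ r / 4 + r / 4 + r / 4 + r / 4 := by
        gcongr
        · exact (lintegral_smoothing_le (hε n) hgi).trans h1
        · exact (lintegral_smoothing_le (hε n) hgφ).trans hφ1
    _ = r := by
        rw [← ENNReal.add_div, ← ENNReal.add_div, ← ENNReal.add_div]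
        rw [show r + r + r + r = r * 4 by ring]
        exact ENNReal.mul_div_cancel_right (by norm_num) (by norm_num)

/-! ### The pointwise Duhamel inequality and the bound on `(t, T) × Υ` -/

/-- Duhamel's inequality for the pairing at time `t - ε` with the parametrix of parameter `ε`, with
the integral extended up to time `t`, so that the right-hand side does not depend on `ε`. -/
lemma IsWeakSolution.enorm_pairing_le (h : IsWeakSolution Pe De T f₀ f) (hDe : 0 < De)
    {s t ε : ℝ} (hs : 0 < s) (hε : 0 < ε) (hεt : s ≤ t - ε) (htT : t ≤ T) (z : Fin 3 → ℝ) :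
    ‖∫ ξ in cell 3, f (t - ε) ξ * parametrix (diffusivity De) ε (ξ - z)‖ₑ
      ≤ ENNReal.ofReal ((t - s) ^ (-(3 / 2) : ℝ)) * (∫⁻ ξ in cell 3, ‖f s ξ‖ₑ)
        + ENNReal.ofReal (duhamelConst Pe De T) * ∫⁻ τ in Ioo s t, ∫⁻ ξ in cell 3,
          ENNReal.ofReal (majorant (diffusivity De) (t - τ) (ξ - z)) * ‖f τ ξ‖ₑ := by
  set d := diffusivity De with hd'
  have hd : ∀ i, 0 < d i := diffusivity_pos hDe
  have hst : 0 < t - s := by linarith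
  have hT : 0 < T := by linarith
  have hC : 0 ≤ duhamelConst Pe De T := by
    have : 0 ≤ ∑ i, d i := Finset.sum_nonneg fun i _ => (hd i).le
    unfold duhamelConst
    positivity
  have hdu := h.duhamel hDe hs hεt (sub_lt_self t hε) htT z
  rw [sub_sub_cancel, ← hd'] at hdu
  rw [← ofReal_norm, Real.norm_eq_abs]
  refine (ENNReal.ofReal_le_ofReal hdu).trans (ENNReal.ofReal_add_le.trans ?_)
  gcongr ?_ + ?_
  · rw [← Real.norm_eq_abs, ofReal_norm]
    refine (enorm_integral_le_lintegral_enorm _).trans ?_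
    rw [← lintegral_const_mul' _ _ ENNReal.ofReal_ne_top]
    refine lintegral_mono fun ξ => ?_
    rw [enorm_mul, mul_comm, Real.enorm_eq_ofReal (parametrix_pos d hst _).le]
    gcongr
    exact parametrix_le hd hst _
  · refine (Real.ofReal_le_enorm _).trans ?_
    rw [intervalIntegral.integral_of_le hεt]
    refine (enorm_integral_le_lintegral_enorm _).trans ?_
    rw [← lintegral_const_mul' _ _ ENNReal.ofReal_ne_top]
    refine (lintegral_mono_set (t := Ioo s t) fun τ hτ => ⟨hτ.1, by linarith [hτ.2]⟩).trans ?_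
    refine lintegral_mono fun τ => ?_
    refine (enorm_integral_le_lintegral_enorm _).trans ?_
    rw [← lintegral_const_mul' _ _ ENNReal.ofReal_ne_top]
    refine lintegral_mono fun ξ => le_of_eq ?_
    rw [enorm_mul, enorm_mul, Real.enorm_abs, Real.enorm_eq_ofReal hC,
      Real.enorm_eq_ofReal (majorant_nonneg _ _ _)]
    ring

/-- The pointwise Duhamel inequality, in the limit `ε → 0` along which the normalised parametrix
recovers `f t`. -/
theorem exists_ae_enorm_le (Pe : ℝ) {De : ℝ} (hDe : 0 < De) (T : ℝ) :
    ∃ c : ℝ, 0 < c ∧ ∀ (f₀ : (Fin 3 → ℝ) → ℝ) (f : ℝ → (Fin 3 → ℝ) → ℝ),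
      IsWeakSolution Pe De T f₀ f → ∀ s t, 0 < s → s < t → t < T →
      ∀ᵐ z ∂(volume.restrict (cell 3)), ‖f t z‖ₑ ≤ ENNReal.ofReal c *
        (ENNReal.ofReal ((t - s) ^ (-(3 / 2) : ℝ)) * (∫⁻ ξ in cell 3, ‖f s ξ‖ₑ)
        + ENNReal.ofReal (duhamelConst Pe De T) * ∫⁻ τ in Ioo s t, ∫⁻ ξ in cell 3,
          ENNReal.ofReal (majorant (diffusivity De) (t - τ) (ξ - z)) * ‖f τ ξ‖ₑ) := by
  have hd : ∀ i, 0 < diffusivity De i := diffusivity_pos hDe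
  obtain ⟨c, hc, ε₀, hε₀, hmass⟩ := exists_le_parametrixMass hd
  refine ⟨c⁻¹, inv_pos.2 hc, fun f₀ f h s t hs hst htT => ?_⟩
  -- `ε n` is below `ε₀`, for the bound on the mass, and below `t - s`, so that `s ≤ t - ε n`
  set r := min ε₀ (t - s) with hr
  have hr0 : 0 < r := lt_min hε₀ (by linarith)
  set ε : ℕ → ℝ := fun n => r / (n + 2) with hεdef
  have hε : ∀ n, 0 < ε n := fun n => by positivity
  have hεr : ∀ n, ε n < r := fun n => div_lt_self hr0 (by
    have : (0 : ℝ) ≤ n := Nat.cast_nonneg n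
    linarith)
  have hε0 : Tendsto ε atTop (𝓝 0) :=
    tendsto_const_nhds.div_atTop (tendsto_atTop_add_const_right _ _ tendsto_natCast_atTop_atTop)
  have hεs : ∀ n, s ≤ t - ε n := fun n => by
    linarith [hεr n, min_le_right ε₀ (t - s)]
  have hmem : ∀ n, t - ε n ∈ Icc 0 T := fun n =>
    ⟨hs.le.trans (hεs n), by linarith [hε n]⟩
  have ht : t ∈ Icc 0 T := ⟨by linarith, htT.le⟩
  have hL := h.isL1Curve
  have hlim : Tendsto (fun n => ∫⁻ ξ in cell 3, ‖f (t - ε n) ξ - f t ξ‖ₑ) atTop (𝓝 0) := by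
    rw [ENNReal.tendsto_nhds_zero]
    intro r' hr'
    obtain ⟨q, hq0, hq⟩ := ENNReal.lt_iff_exists_nnreal_btwn.1 hr'
    obtain ⟨δ, hδ, H⟩ := hL.unif q (by exact_mod_cast hq0)
    filter_upwards [hε0.eventually (gt_mem_nhds hδ)] with n hn
    have h1 := H t ht (t - ε n) (hmem n) (by
      rw [sub_sub_cancel_left, abs_neg, abs_of_pos (hε n)]; exact hn)
    have h2 := ofReal_integral_norm_eq_lintegral_enorm
      ((h.integrable (hmem n)).sub (h.integrable ht))
    simp only [Pi.sub_apply, Real.norm_eq_abs] at h2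
    rw [← h2]
    refine (ENNReal.ofReal_le_ofReal h1).trans ?_
    rw [ENNReal.ofReal_coe_nnreal]
    exact hq.le
  have hconv := tendsto_lintegral_smoothing_sub hd (h.integrable ht)
    (fun n => h.integrable (hmem n)) hlim hε hε0
  have hmeas : TendstoInMeasure (volume.restrict (cell 3))
      (fun n => smoothing (diffusivity De) (ε n) (f (t - ε n))) atTop (f t) := by
    refine tendstoInMeasure_of_tendsto_eLpNorm (p := 1) one_ne_zero
      (fun n => aestronglyMeasurable_smoothing _ _ (h.integrable (hmem n)))
      (h.integrable ht).aestronglyMeasurable ?_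
    simp only [eLpNorm_one_eq_lintegral_enorm]
    exact hconv
  obtain ⟨ns, -, hns⟩ := hmeas.exists_seq_tendsto_ae
  filter_upwards [hns] with z hz
  refine le_of_tendsto hz.enorm (Eventually.of_forall fun k => ?_)
  have hk := h.enorm_pairing_le hDe hs (hε (ns k)) (hεs _) htT.le z
  rw [smoothing, enorm_mul, Real.enorm_eq_ofReal (inv_nonneg.2 (parametrixMass_pos _ (hε _)).le)]
  gcongr
  · exact hmass _ ⟨hε _, (hεr _).trans_le (min_le_left _ _)⟩

/-- The `L²` norm at every time is bounded by its essential supremum, by continuity in time. -/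
lemma IsWeakSolution.eLpNorm_le_essSup (h : IsWeakSolution Pe De T f₀ f) {s : ℝ}
    (hs : s ∈ Ioo 0 T) :
    eLpNorm (f s) 2 (volume.restrict (cell 3))
      ≤ essSup (fun t => eLpNorm (f t) 2 (volume.restrict (cell 3)))
        (volume.restrict (Ioo 0 T)) := by
  set M := essSup (fun t => eLpNorm (f t) 2 (volume.restrict (cell 3)))
    (volume.restrict (Ioo 0 T)) with hM
  -- otherwise the norm would exceed `M` on a neighbourhood of `s`, which has positive measure
  by_contra! hlt
  have hae : ∀ᵐ t ∂(volume.restrict (Ioo 0 T)),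
      eLpNorm (f t) 2 (volume.restrict (cell 3)) ≤ M := ae_le_essSup
  have hsI := Ioo_subset_Icc_self hs
  have hcont := h.continuous s hsI
  rw [nhdsWithin_eq_nhds.2 (Icc_mem_nhds hs.1 hs.2)] at hcont
  have hev : ∀ᶠ t in 𝓝 s, t ∈ Ioo 0 T ∧ ¬ eLpNorm (f t) 2 (volume.restrict (cell 3)) ≤ M := by
    filter_upwards [hcont.eventually (gt_mem_nhds (tsub_pos_of_lt hlt)),
      Ioo_mem_nhds hs.1 hs.2] with t ht hmem
    refine ⟨hmem, fun hle => ?_⟩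
    have htI := Ioo_subset_Icc_self hmem
    have h1 : eLpNorm (f s) 2 (volume.restrict (cell 3))
        ≤ eLpNorm (f t) 2 (volume.restrict (cell 3))
          + eLpNorm (f t - f s) 2 (volume.restrict (cell 3)) := by
      have e : f s = f t - (f t - f s) := by abel
      conv_lhs => rw [e]
      exact eLpNorm_sub_le (h.memLp t htI).1 ((h.memLp t htI).sub (h.memLp s hsI)).1 (by norm_num)
    have h2 : eLpNorm (f t) 2 (volume.restrict (cell 3))
          + eLpNorm (f t - f s) 2 (volume.restrict (cell 3))
        < M + (eLpNorm (f s) 2 (volume.restrict (cell 3)) - M) :=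
      ENNReal.add_lt_add_of_le_of_lt (h.memLp t htI).2.ne hle ht
    rw [add_tsub_cancel_of_le hlt.le] at h2
    exact absurd h1 (not_le.2 h2)
  rw [ae_restrict_iff' measurableSet_Ioo] at hae
  have hpos := Measure.measure_pos_of_mem_nhds volume hev
  refine hpos.ne' (measure_mono_null (fun t ht => ?_) hae)
  exact fun himp => ht.2 (himp ht.1)

lemma essSup_le_parabolicNorm (T : ℝ) (f : ℝ → (Fin 3 → ℝ) → ℝ) :
    essSup (fun t => eLpNorm (f t) 2 (volume.restrict (cell 3))) (volume.restrict (Ioo 0 T))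
      ≤ parabolicNorm T f := by
  set M := essSup (fun t => eLpNorm (f t) 2 (volume.restrict (cell 3)))
    (volume.restrict (Ioo 0 T)) with hM
  calc M = (M ^ 2) ^ (1 / 2 : ℝ) := by
        rw [← ENNReal.rpow_natCast, ← ENNReal.rpow_mul]; norm_num
    _ ≤ _ := by
        unfold parabolicNorm
        gcongr
        exact le_self_add

end ActiveMatter

theorem proposition3p1 (Pe De T : ℝ) (hDe : 0 < De) (hT : 0 < T) :
    ∃ C : ℝ, 0 < C ∧
      ∀ (f₀ : (Fin 3 → ℝ) → ℝ) (f : ℝ → (Fin 3 → ℝ) → ℝ),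
        ActiveMatter.IsAdmissible f₀ → ActiveMatter.IsWeakSolution Pe De T f₀ f →
        ∀ t ∈ Ioo 0 T,
          eLpNorm (fun p : ℝ × (Fin 3 → ℝ) => f p.1 p.2) ⊤
              (volume.restrict (Ioo t T ×ˢ ActiveMatter.cell 3))
            ≤ ENNReal.ofReal (C * (1 + t ^ (-(13 / 4) : ℝ))) * ActiveMatter.parabolicNorm T f := by
  open ActiveMatter in
  obtain ⟨c, hc, hpt⟩ := exists_ae_enorm_le Pe hDe T
  have hd : ∀ i, 0 < diffusivity De i := diffusivity_pos hDe
  set d := diffusivity De with hd'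
  set V := (volume.restrict (cell 3)) univ ^ (1 / (1 : ℝ≥0∞).toReal - 1 / (2 : ℝ≥0∞).toReal) with hV
  have hVt : V ≠ ⊤ := ENNReal.rpow_ne_top_of_nonneg (by norm_num) (measure_ne_top _ _)
  set b := ENNReal.ofReal c * ENNReal.ofReal (duhamelConst Pe De T) with hb
  obtain ⟨C, hC, hboot⟩ := ae_le_of_duhamel hd hT
    (a := ENNReal.ofReal c * V) (b := b) (by finiteness) (by finiteness)
  refine ⟨C, hC, fun f₀ f _ h t ht => ?_⟩
  set M := essSup (fun t => eLpNorm (f t) 2 (volume.restrict (cell 3)))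
    (volume.restrict (Ioo 0 T)) with hM
  have hfm := h.measurable
  rw [← cylinderMeasure_eq] at hfm
  -- a measurable representative, for the iterated integrals
  set g := hfm.mk _ with hg
  have hgm : Measurable g := hfm.stronglyMeasurable_mk.measurable
  have hfg : ∀ᵐ p ∂cylinderMeasure T 0, f p.1 p.2 = g p := hfm.ae_eq_mk
  have hfg' : ∀ᵐ τ ∂(volume.restrict (Ioo 0 T)), ∀ᵐ ξ ∂(volume.restrict (cell 3)),
      f τ ξ = g (τ, ξ) := Measure.ae_ae_of_ae_prod hfg
  set F : ℝ × (Fin 3 → ℝ) → ℝ≥0∞ := fun p => ‖g p‖ₑ with hF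
  have hFm : Measurable F := hgm.enorm
  have hL2 : (∫⁻ x, F x ^ (2 : ℝ) ∂cylinderMeasure T 0) ^ (1 / 2 : ℝ)
      ≤ ENNReal.ofReal T ^ (1 / 2 : ℝ) * M := by
    have h1 : ∫⁻ x, F x ^ (2 : ℝ) ∂cylinderMeasure T 0 ≤ ENNReal.ofReal T * M ^ (2 : ℝ) := by
      rw [cylinderMeasure, lintegral_prod _ (hFm.pow_const _).aemeasurable]
      calc _ ≤ ∫⁻ _ in Ioo 0 T, M ^ (2 : ℝ) := by
            refine lintegral_mono_ae ?_
            filter_upwards [hfg', ae_restrict_mem measurableSet_Ioo] with τ hτ hmem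
            have h2 := h.eLpNorm_le_essSup hmem
            rw [eLpNorm_eq_lintegral_rpow_enorm_toReal (by norm_num) (by norm_num),
              ENNReal.toReal_ofNat] at h2
            rw [← ENNReal.rpow_le_rpow_iff (show (0 : ℝ) < 1 / 2 by norm_num),
              ← ENNReal.rpow_mul M, mul_one_div_cancel (two_ne_zero), ENNReal.rpow_one]
            refine le_trans (le_of_eq ?_) h2
            congr 1
            refine lintegral_congr_ae ?_
            filter_upwards [hτ] with ξ hξ
            simp only [hF]
            rw [hξ]
        _ = _ := by
            rw [lintegral_const, Measure.restrict_apply_univ, Real.volume_Ioo, sub_zero, mul_comm]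
    calc _ ≤ (ENNReal.ofReal T * M ^ (2 : ℝ)) ^ (1 / 2 : ℝ) := by gcongr
      _ = _ := by
        rw [ENNReal.mul_rpow_of_nonneg _ _ (by norm_num), ← ENNReal.rpow_mul M,
          mul_one_div_cancel (two_ne_zero), ENNReal.rpow_one]
  have hkm := measurable_spaceTimeKernel d T
  have hD : ∀ s ∈ Ioo 0 T, ∀ᵐ p ∂cylinderMeasure T s,
      F p ≤ ENNReal.ofReal c * V * ENNReal.ofReal ((p.1 - s) ^ (-(3 / 2) : ℝ)) * M
        + b * ∫⁻ p', spaceTimeKernel d T p p' * F p' ∂cylinderMeasure T s := by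
    intro s hs
    have hKm : Measurable fun p => ∫⁻ p', spaceTimeKernel d T p p' * F p' ∂cylinderMeasure T s :=
      Measurable.lintegral_prod_right' (f := fun z : (ℝ × (Fin 3 → ℝ)) × (ℝ × (Fin 3 → ℝ)) =>
        spaceTimeKernel d T z.1 z.2 * F z.2) (hkm.mul (hFm.comp measurable_snd))
    have hset : MeasurableSet {p | F p ≤ ENNReal.ofReal c * V *
        ENNReal.ofReal ((p.1 - s) ^ (-(3 / 2) : ℝ)) * M
        + b * ∫⁻ p', spaceTimeKernel d T p p' * F p' ∂cylinderMeasure T s} := by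
      refine measurableSet_le hFm (Measurable.add ?_ (hKm.const_mul b))
      fun_prop
    have hsub : Ioo s T ⊆ Ioo 0 T := Ioo_subset_Ioo_left hs.1.le
    refine (Measure.ae_prod_iff_ae_ae hset).2 ?_
    have hfgs := ae_mono (Measure.restrict_mono hsub (le_refl volume)) hfg'
    filter_upwards [hfgs, ae_restrict_mem measurableSet_Ioo] with t' ht' hmem
    filter_upwards [ht', hpt f₀ f h s t' hs.1 hmem.1 hmem.2] with z hz hz'
    have hL1 : ∫⁻ ξ in cell 3, ‖f s ξ‖ₑ ≤ M * V := by
      rw [← eLpNorm_one_eq_lintegral_enorm]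
      refine (eLpNorm_le_eLpNorm_mul_rpow_measure_univ (q := 2) (by norm_num)
        (h.memLp s (Ioo_subset_Icc_self hs)).1).trans ?_
      gcongr
      exact h.eLpNorm_le_essSup hs
    have hK : ∫⁻ τ in Ioo s t', ∫⁻ ξ in cell 3,
          ENNReal.ofReal (majorant d (t' - τ) (ξ - z)) * ‖f τ ξ‖ₑ
        ≤ ∫⁻ p', spaceTimeKernel d T (t', z) p' * F p' ∂cylinderMeasure T s := by
      have hm : Measurable fun p' => spaceTimeKernel d T (t', z) p' * F p' :=
        (hkm.comp measurable_prodMk_left).mul hFm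
      rw [cylinderMeasure, lintegral_prod _ hm.aemeasurable]
      refine le_trans (lintegral_mono_ae ?_)
        (lintegral_mono_set (Ioo_subset_Ioo_right hmem.2.le))
      have hsub' : Ioo s t' ⊆ Ioo 0 T := Ioo_subset_Ioo hs.1.le hmem.2.le
      filter_upwards [ae_mono (Measure.restrict_mono hsub' (le_refl volume)) hfg',
        ae_restrict_mem measurableSet_Ioo] with τ hτ hτm
      refine lintegral_mono_ae ?_
      filter_upwards [hτ] with ξ hξ
      have hin : t' - τ ∈ Ioo 0 T := ⟨by linarith [hτm.2], by linarith [hτm.1, hs.1, hmem.2]⟩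
      simp only [spaceTimeKernel, indicator_of_mem hin, hF]
      rw [hξ]
    simp only [hF]
    rw [← hz]
    calc ‖f t' z‖ₑ ≤ _ := hz'
      _ ≤ ENNReal.ofReal c * (ENNReal.ofReal ((t' - s) ^ (-(3 / 2) : ℝ)) * (M * V)
          + ENNReal.ofReal (duhamelConst Pe De T) *
            ∫⁻ p', spaceTimeKernel d T (t', z) p' * F p' ∂cylinderMeasure T s) := by gcongr
      _ = _ := by rw [hb]; ring
  have hfin := hboot F M hFm hL2 hD t ht
  rw [eLpNorm_exponent_top, ← cylinderMeasure_eq]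
  refine eLpNormEssSup_le_of_ae_enorm_bound ?_
  filter_upwards [hfin, ae_mono (cylinderMeasure_mono ht.1.le) hfg] with p hp hp'
  rw [hp']
  refine hp.trans ?_
  gcongr
  exact essSup_le_parabolicNorm T f
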